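/- A *virtual diagram* is an oriented circle generically immersed in $\mathbb R^2$ (a smooth immersion all of whose multiple points are transverse double points, called crossings), together with a division of its crossings into real and virtual ones. Two virtual diagrams are related by a *detour move* if they have the same real crossings and are identical except along one arc of the circle that passes through no real crossing (i.e. along a semiarc, or a part of it). They are *strictly equivalent* if they are related by a finite sequence of detour moves and isotopies of $\mathbb R^2$. For $n\ge 0$, let $\mathbf{Diagram}_{\rm strict}(n)$ be the set of virtual diagrams with exactly $n$ real crossings modulo strict equivalence, and let $\mathbf{Diagram}_{\rm strict+rev}(n)$ be the set of these diagrams modulo the equivalence relation generated by strict equivalence and reversal of the orientation of the circle. A *Gauss code* on $n$ letters is a sequence $x_1x_2\dots x_{2n}$ in which every element of $\{1,\dots,n\}\times\{L,R\}$ appears. Two Gauss codes are *orientedly equivalent* if one is obtained from the other by a permutation of the letters $1,\dots,n$ followed by a cyclic shift; $w$ and $w'$ are *unorientedly equivalent* if $w$ is orientedly equivalent to $w'$ or to the reversed sequence of $w'$. Let $\mathbf{Gauss}_{\rm ori}(n)$ and $\mathbf{Gauss}_{\rm unori}(n)$ be the sets of equivalence classes. Let $D$ be a virtual diagram with $n$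 real crossings. Label the real crossings by $1,\dots,n$ bijectively, choose a base point on $D$ that is not a real crossing, and run once along $D$ from it. Each time a real crossing, with label $j$ say, is passed, write $(j,L)$ if the other branch of $D$ there passes from the left to the right of the branch one runs along, and $(j,R)$ if it passes from the right to the left. The resulting sequence is called a *Gauss code of $D$*. **Proposition.** For every $n\ge 0$, assigning to a virtual diagram its Gauss codes induces bijections $$\mathbf{Diagram}_{\rm strict}(n)\longleftrightarrow \mathbf{Gauss}_{\rm ori}(n)\qquad\text{and}\qquad \mathbf{Diagram}_{\rm strict+rev}(n)\longleftrightarrow \mathbf{Gauss}_{\rm unori}(n).$$ Explicitly, the class of $D$ corresponds to the class of $w$ under the first bijection if and only if $w$ is a Gauss code of $D$, and under the second if and only if $w$ is a Gauss code of $D$ or of $D$ with the reversed orientation. -/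

import Mathlib

open scoped ContDiff Manifold

/-- The plane `ℝ²`. -/
abbrev Plane : Type := EuclideanSpace ℝ (Fin 2)

/-- `cross u v = det (u, v)`; it is negative iff `v` points from the left side of the oriented line
spanned by `u` to its right side. -/
def cross (u v : Plane) : ℝ := u 0 * v 1 - u 1 * v 0

/-- Two parameters represent the same point of the circle `ℝ / ℤ`. -/
def SamePoint (s t : ℝ) : Prop := ∃ k : ℤ, s = t + k

/-- A virtual diagram: an oriented circle, generically (and smoothly) immersed in the plane, with
some of its crossings declared real; the other crossings are virtual. The circle is `ℝ / ℤ`, so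
that the immersion is given by a `1`-periodic map `ℝ → ℝ²`. -/
structure VirtualDiagram where
  /-- the immersion, oriented by the direction of increasing parameter -/
  curve : ℝ → Plane
  smooth : ContDiff ℝ ∞ curve
  periodic : ∀ t, curve (t + 1) = curve t
  immersed : ∀ t, deriv curve t ≠ 0
  /-- branches meet transversely -/
  transverse : ∀ s t, curve s = curve t → ¬ SamePoint s t →
    cross (deriv curve s) (deriv curve t) ≠ 0
  /-- every multiple point is a double point -/
  double : ∀ s t u, curve s = curve t → curve t = curve u →
    SamePoint s t ∨ SamePoint t u ∨ SamePoint s u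
  /-- the real crossings -/
  real : Finset Plane
  real_crossing : ∀ p ∈ real, ∃ s t, ¬ SamePoint s t ∧ curve s = p ∧ curve t = p

namespace VirtualDiagram

/-- `D` and `D'` are the same oriented curve, with the same real crossings, up to an
orientation preserving change of the parameter on the circle. -/
def Reparam (D D' : VirtualDiagram) : Prop :=
  (∃ φ : ℝ → ℝ, ContDiff ℝ ∞ φ ∧ (∀ t, 0 < deriv φ t) ∧ (∀ t, φ (t + 1) = φ t + 1) ∧
    ∀ t, D'.curve t = D.curve (φ t)) ∧
  D'.real = D.real

/-- `D` is carried to `D'` by an isotopy `H` of the plane (the values of `H` at times outside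
`[0, 1]` play no role). -/
def Isotopic (D D' : VirtualDiagram) : Prop :=
  ∃ H : ℝ → Plane → Plane,
    ContDiff ℝ ∞ (fun p : ℝ × Plane => H p.1 p.2) ∧
    (∀ t ∈ Set.Icc (0 : ℝ) 1,
      ∃ e : Plane ≃ₘ^∞⟮𝓘(ℝ, Plane), 𝓘(ℝ, Plane)⟯ Plane, ∀ x, e x = H t x) ∧
    (∀ x, H 0 x = x) ∧
    (∀ t, D'.curve t = H 1 (D.curve t)) ∧
    (D'.real : Set Plane) = H 1 '' (D.real : Set Plane)

/-- `D'` is obtained from `D` by a detour move: they are identical except for an arc of the circle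
(with parameters `[a, b]`) that runs through no real crossing, that is, lies in a semiarc. -/
def Detour (D D' : VirtualDiagram) : Prop :=
  D'.real = D.real ∧
  ∃ a b : ℝ, a < b ∧ b < a + 1 ∧
    (∀ t ∈ Set.Icc a b, D.curve t ∉ D.real ∧ D'.curve t ∉ D'.real) ∧
    ∀ t ∈ Set.Icc b (a + 1), D'.curve t = D.curve t

/-- One step of a strict equivalence. -/
def StrictMove (D D' : VirtualDiagram) : Prop :=
  Reparam D D' ∨ Isotopic D D' ∨ Detour D D'

theorem SamePoint.neg_iff {s t : ℝ} : SamePoint (-s) (-t) ↔ SamePoint s t := by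
  constructor
  · rintro ⟨k, hk⟩
    exact ⟨-k, by push_cast; linarith⟩
  · rintro ⟨k, hk⟩
    exact ⟨-k, by push_cast; linarith⟩

/-- The diagram with the reversed orientation. -/
def rev (D : VirtualDiagram) : VirtualDiagram where
  curve t := D.curve (-t)
  smooth := D.smooth.comp contDiff_neg
  periodic t := by
    have h := D.periodic (-(t + 1))
    rw [← h]
    congr 1
    ring
  immersed t := by
    rw [deriv_comp_neg]
    exact neg_ne_zero.mpr (D.immersed _)
  transverse s t h hst := by
    have h1 := D.transverse (-s) (-t) h (fun h2 => hst (SamePoint.neg_iff.mp h2))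
    rw [deriv_comp_neg, deriv_comp_neg]
    simpa [cross] using h1
  double s t u hst htu := by
    have h := D.double (-s) (-t) (-u) hst htu
    simpa only [SamePoint.neg_iff] using h
  real := D.real
  real_crossing p hp := by
    obtain ⟨s, t, hst, hs, ht⟩ := D.real_crossing p hp
    exact ⟨-s, -t, fun h => hst (SamePoint.neg_iff.mp h), by simpa using hs, by simpa using ht⟩

/-- Strict equivalence: a finite sequence of detour moves and isotopies of the plane. -/
def StrictEquiv : VirtualDiagram → VirtualDiagram → Prop := Relation.EqvGen StrictMove

/-- A finite sequence of detour moves, isotopies of the plane and reversals of orientation. -/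
def StrictRevEquiv : VirtualDiagram → VirtualDiagram → Prop :=
  Relation.EqvGen (fun D D' => StrictMove D D' ∨ D' = D.rev)

end VirtualDiagram

/-- Virtual diagrams with exactly `n` real crossings. -/
abbrev Diagram (n : ℕ) : Type := {D : VirtualDiagram // D.real.card = n}

def strictSetoid (n : ℕ) : Setoid (Diagram n) where
  r D D' := VirtualDiagram.StrictEquiv D.1 D'.1
  iseqv := ⟨fun D => .refl D.1, fun h => .symm _ _ h, fun h h' => .trans _ _ _ h h'⟩

def strictRevSetoid (n : ℕ) : Setoid (Diagram n) where
  r D D' := VirtualDiagram.StrictRevEquiv D.1 D'.1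
  iseqv := ⟨fun D => .refl D.1, fun h => .symm _ _ h, fun h h' => .trans _ _ _ h h'⟩

/-- Virtual diagrams with `n` real crossings modulo strict equivalence. -/
def DiagramStrict (n : ℕ) : Type := Quotient (strictSetoid n)

/-- Virtual diagrams with `n` real crossings modulo strict equivalence and reversal. -/
def DiagramStrictRev (n : ℕ) : Type := Quotient (strictRevSetoid n)

/-- The two kinds of branches, left and right. -/
inductive Side where
  | L
  | R

/-- A Gauss code on `n` letters: a sequence of length `2n` in which all the `2n` elements of
`{1, …, n} × {L, R}` appear. -/
@[ext]
structure GaussCode (n : ℕ) where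
  seq : Fin (2 * n) → Fin n × Side
  surj : Function.Surjective seq

namespace GaussCode

variable {n : ℕ}

/-- `π_*`: relabel the letters by a permutation. -/
def relabel (π : Equiv.Perm (Fin n)) (w : GaussCode n) : GaussCode n where
  seq i := (π (w.seq i).1, (w.seq i).2)
  surj := by
    rintro ⟨j, s⟩
    obtain ⟨i, hi⟩ := w.surj (π.symm j, s)
    exact ⟨i, by simp [hi]⟩

/-- `x₁ x₂ ⋯ x₂ₙ ↦ xₘ₊₁ ⋯ x₂ₙ x₁ ⋯ xₘ`, for an arbitrary integer `m` (modulo `2n`);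
`finRotate (2 * n)` is the cyclic permutation `i ↦ i + 1`. -/
def shift (m : ℤ) (w : GaussCode n) : GaussCode n where
  seq i := w.seq ((finRotate (2 * n) ^ m) i)
  surj := w.surj.comp (finRotate (2 * n) ^ m).surjective

/-- `x₁ x₂ ⋯ x₂ₙ ↦ x₂ₙ ⋯ x₂ x₁`. -/
def rev (w : GaussCode n) : GaussCode n where
  seq i := w.seq (Fin.rev i)
  surj := w.surj.comp Fin.rev_surjective

/-- Oriented equivalence. -/
def OriEquiv (w w' : GaussCode n) : Prop :=
  ∃ (π : Equiv.Perm (Fin n)) (m : ℤ), w' = shift m (relabel π w)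

/-- Unoriented equivalence. -/
def UnoriEquiv (w w' : GaussCode n) : Prop := OriEquiv w w' ∨ OriEquiv w w'.rev

theorem OriEquiv.refl (w : GaussCode n) : OriEquiv w w :=
  ⟨1, 0, by ext i <;> simp [shift, relabel]⟩

theorem OriEquiv.symm {w w' : GaussCode n} : OriEquiv w w' → OriEquiv w' w := by
  rintro ⟨π, m, rfl⟩
  refine ⟨π⁻¹, -m, ?_⟩
  ext i <;> simp [shift, relabel]

theorem OriEquiv.trans {w w' w'' : GaussCode n} :
    OriEquiv w w' → OriEquiv w' w'' → OriEquiv w w'' := by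
  rintro ⟨π, m, rfl⟩ ⟨π', m', rfl⟩
  refine ⟨π' * π, m + m', ?_⟩
  ext i <;> simp [shift, relabel, zpow_add]

theorem rev_rev (w : GaussCode n) : w.rev.rev = w := by
  ext i <;> simp [rev]

theorem finRotate_rev : ∀ (k : ℕ) (i : Fin k),
    finRotate k (Fin.rev (finRotate k i)) = Fin.rev i
  | 0, i => i.elim0
  | k + 1, i => by
    simp only [finRotate_apply]
    rw [Fin.rev_add]
    exact sub_add_cancel _ _

theorem OriEquiv.rev {w w' : GaussCode n} : OriEquiv w w' → OriEquiv w.rev w'.rev := by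
  rintro ⟨π, m, rfl⟩
  refine ⟨π, -m, ?_⟩
  have key : ∀ i : Fin (2 * n),
      (finRotate (2 * n) ^ m) (Fin.rev i) = Fin.rev ((finRotate (2 * n) ^ (-m)) i) := by
    have h0 : Fin.revPerm * finRotate (2 * n) * Fin.revPerm⁻¹ = (finRotate (2 * n))⁻¹ := by
      rw [mul_inv_eq_iff_eq_mul, eq_inv_mul_iff_mul_eq]
      refine Equiv.ext fun i => ?_
      exact finRotate_rev _ i
    intro i
    have h1 := conj_zpow (i := m) (a := (Fin.revPerm : Equiv.Perm (Fin (2 * n))))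
      (b := finRotate (2 * n))
    rw [h0, inv_zpow, ← zpow_neg] at h1
    rw [h1]
    simp
  ext i <;> simp [shift, relabel, GaussCode.rev, key]

/-- `OriEquiv` as a setoid. -/
def oriSetoid (n : ℕ) : Setoid (GaussCode n) where
  r := OriEquiv
  iseqv := ⟨OriEquiv.refl, OriEquiv.symm, OriEquiv.trans⟩

/-- `UnoriEquiv` as a setoid. -/
def unoriSetoid (n : ℕ) : Setoid (GaussCode n) where
  r := UnoriEquiv
  iseqv := by
    refine ⟨fun w => Or.inl (OriEquiv.refl w), ?_, ?_⟩
    · rintro w w' (h | h)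
      · exact Or.inl h.symm
      · exact Or.inr (by simpa only [rev_rev] using h.symm.rev)
    · rintro w w' w'' (h | h) (h' | h')
      · exact Or.inl (h.trans h')
      · exact Or.inr (h.trans h')
      · exact Or.inr (h.trans h'.rev)
      · exact Or.inl (h.trans (by simpa only [rev_rev] using h'.rev))

end GaussCode

/-- Gauss codes modulo relabeling and cyclic shift. -/
def GaussOri (n : ℕ) : Type := Quotient (GaussCode.oriSetoid n)

/-- Gauss codes modulo relabeling, cyclic shift and reversal. -/
def GaussUnori (n : ℕ) : Type := Quotient (GaussCode.unoriSetoid n)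

namespace VirtualDiagram

/-- The branch of `D` at the parameter `t` (where `D` has a crossing) is left if the other branch
passes from the left to the right, and right if it passes from the right to the left. -/
def HasSide (D : VirtualDiagram) (t : ℝ) : Side → Prop
  | .L => ∃ u, ¬ SamePoint t u ∧ D.curve u = D.curve t ∧
      cross (deriv D.curve t) (deriv D.curve u) < 0
  | .R => ∃ u, ¬ SamePoint t u ∧ D.curve u = D.curve t ∧
      0 < cross (deriv D.curve t) (deriv D.curve u)

/-- `w` is the Gauss code of `D` with respect to the labeling `f` of its real crossings and the
base semiarc that contains the parameter `a`: the numbers `b i` are the parameters of the branches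
at real crossings in the order in which they are met on the way from `a` once around the circle. -/
def IsGaussCodeAt {n : ℕ} (D : VirtualDiagram) (a : ℝ) (f : {p // p ∈ D.real} ≃ Fin n)
    (w : GaussCode n) : Prop :=
  D.curve a ∉ D.real ∧
  ∃ b : Fin (2 * n) → ℝ, StrictMono b ∧
    Set.range b = {t | t ∈ Set.Ioo a (a + 1) ∧ D.curve t ∈ D.real} ∧
    ∀ (i : Fin (2 * n)) (h : D.curve (b i) ∈ D.real),
      (w.seq i).1 = f ⟨D.curve (b i), h⟩ ∧ D.HasSide (b i) (w.seq i).2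

/-- `w` is a Gauss code of `D`, for some base semiarc and some labeling. -/
def IsGaussCode {n : ℕ} (D : VirtualDiagram) (w : GaussCode n) : Prop :=
  ∃ (a : ℝ) (f : {p // p ∈ D.real} ≃ Fin n), D.IsGaussCodeAt a f w

end VirtualDiagram

/-! A Gauss code records the cyclic order of the branches at real crossings and the side of each. A
detour changes nothing near the real crossings. A reparametrization preserves orientation, and so
does an isotopy, because its Jacobian determinant starts at 1 and never vanishes. Hence strict moves
preserve Gauss codes (`StrictEquiv.isGaussCode_iff`, via `IsGaussCode.transfer`). Moving the base
point past a real crossing shifts the code, so the codes of one diagram form exactly one oriented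
class (`IsGaussCode.oriEquiv`, `IsGaussCode.of_oriEquiv`).

The geometric half rests on a normal form `IsNormal`. The base point and the branches at real
crossings have the parameters `i / (2n+1)`. The crossing labelled `j` lies at `(j, j)`; near it the
left branch runs straight to the right, the right branch straight down, both at speed `κ`. Every
code has such a diagram (`exists_isNormal`): a closed curve with the prescribed germs is perturbed
away from them, first to an immersion and then to a generic curve. Conversely, every diagram with
code `w` reaches normal form (`HasMarks.exists_isNormal`). Horizontal and vertical shears, which are
isotopic to the identity, position the crossings and straighten the branches; a diffeomorphism of
the circle then fixes parameters and speed. This works for every large `κ`, so two diagrams can be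
given the same one.

Two normal forms with the same `w` and `κ` agree near all marks and differ only along semiarcs, with
the base point cutting one of them. These arcs are exchanged one at a time by detours
(`strictEquiv_of_eqOn_nearMarks`). The intermediate curves must be generic too, so detours first
make one diagram mutually generic with the other; exchanging arcs of mutually generic curves
preserves genericity (`genericOn_of_mutGeneric`).

All general position comes from one form of Sard's theorem, `ae_transverse`: pushing an arc by `χ
v`, with `χ` a bump function, makes it transverse to a given curve for almost every vector `v`.
Reversing a diagram reverses the code and keeps the sides, which gives the second bijection from the
first. -/

open MeasureTheory Filter Topology

/-! ### Parameters on the circle -/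

namespace SamePoint

theorem symm {s t : ℝ} : SamePoint s t → SamePoint t s := by
  rintro ⟨k, hk⟩
  exact ⟨-k, by push_cast; linarith⟩

theorem trans {s t u : ℝ} : SamePoint s t → SamePoint t u → SamePoint s u := by
  rintro ⟨k, hk⟩ ⟨l, hl⟩
  exact ⟨k + l, by push_cast; linarith⟩

theorem add_int (t : ℝ) (k : ℤ) : SamePoint (t + k) t := ⟨k, rfl⟩

end SamePoint

theorem Function.Periodic.eq_of_samePoint {α : Type*} {f : ℝ → α} (hf : Function.Periodic f 1)
    {s t : ℝ} (h : SamePoint s t) : f s = f t := by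
  obtain ⟨k, rfl⟩ := h
  simpa using hf.int_mul k t

theorem Function.Periodic.deriv {f : ℝ → Plane} (hf : Function.Periodic f 1) :
    Function.Periodic (_root_.deriv f) 1 := by
  intro t
  have : (fun s => f (s + 1)) = f := funext hf
  rw [← deriv_comp_add_const, this]

/-! ### The determinant of two plane vectors -/

section Cross

theorem cross_add_left (u v w : Plane) : cross (u + v) w = cross u w + cross v w := by
  simp [cross]; ring

theorem cross_add_right (u v w : Plane) : cross u (v + w) = cross u v + cross u w := by
  simp [cross]; ring

theorem cross_smul_left (a : ℝ) (u v : Plane) : cross (a • u) v = a * cross u v := by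
  simp [cross]; ring

theorem cross_smul_right (a : ℝ) (u v : Plane) : cross u (a • v) = a * cross u v := by
  simp [cross]; ring

theorem cross_neg_left (u v : Plane) : cross (-u) v = -cross u v := by
  simp [cross]; ring

theorem cross_neg_right (u v : Plane) : cross u (-v) = -cross u v := by
  simp [cross]; ring

theorem cross_swap (u v : Plane) : cross v u = -cross u v := by
  simp [cross]; ring

@[simp] theorem cross_self_zero (u : Plane) : cross u u = 0 := by
  simp [cross]; ring

@[simp] theorem cross_zero_left (u : Plane) : cross 0 u = 0 := by
  simp [cross]

@[simp] theorem cross_zero_right (u : Plane) : cross u 0 = 0 := by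
  simp [cross]

/-- The linear map with columns `A` and `B`. -/
noncomputable def colMap (A B : Plane) : Plane →L[ℝ] Plane :=
  (EuclideanSpace.proj (0 : Fin 2) : Plane →L[ℝ] ℝ).smulRight A +
    (EuclideanSpace.proj (1 : Fin 2) : Plane →L[ℝ] ℝ).smulRight B

theorem colMap_apply (A B x : Plane) : colMap A B x = x 0 • A + x 1 • B := by
  simp [colMap]

theorem det_colMap (A B : Plane) : (colMap A B).det = cross A B := by
  rw [ContinuousLinearMap.det,
    ← LinearMap.det_toMatrix (EuclideanSpace.basisFun (Fin 2) ℝ).toBasis, Matrix.det_fin_two]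
  simp [LinearMap.toMatrix_apply, colMap_apply, cross]
  ring

/-- Taking `cross` with each column recovers the coordinates, so the map is injective. The resulting
lower bound is what makes transverse crossings isolated. -/
theorem exists_antilipschitz_colMap {A B : Plane} (h : cross A B ≠ 0) :
    ∃ C, AntilipschitzWith C (colMap A B) := by
  have hinj : Function.Injective (colMap A B) := by
    rw [injective_iff_map_eq_zero]
    intro x hx
    rw [colMap_apply] at hx
    have h0 := congrArg (fun v => cross v B) hx
    have h1 := congrArg (fun v => cross A v) hx
    simp only [cross_add_left, cross_add_right, cross_smul_left, cross_smul_right, cross_self_zero,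
      cross_zero_left, cross_zero_right, mul_zero, add_zero, zero_add, mul_eq_zero, h,
      or_false] at h0 h1
    ext i
    fin_cases i
    · simpa using h0
    · simpa using h1
  obtain ⟨C, -, hC⟩ := (colMap A B : Plane →ₗ[ℝ] Plane).exists_antilipschitzWith
    (LinearMap.ker_eq_bot.mpr hinj)
  exact ⟨C, hC⟩

end Cross

/-! ### Sard's theorem and transversality for almost every translation -/

section Sard

/-- The derivative of `(t, s) ↦ a t • (δ s - γ t)`. -/
theorem hasFDerivAt_smul_sub {a : ℝ → ℝ} {γ δ : ℝ → Plane} {a' : ℝ} {γ' δ' : Plane} {x : Plane}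
    (ha : HasDerivAt a a' (x 0)) (hγ : HasDerivAt γ γ' (x 0)) (hδ : HasDerivAt δ δ' (x 1)) :
    HasFDerivAt (fun y : Plane => a (y 0) • (δ (y 1) - γ (y 0)))
      (colMap (a' • (δ (x 1) - γ (x 0)) - a (x 0) • γ') (a (x 0) • δ')) x := by
  have p0 : HasFDerivAt (fun y : Plane => y 0)
      (EuclideanSpace.proj (0 : Fin 2) : Plane →L[ℝ] ℝ) x :=
    (EuclideanSpace.proj (0 : Fin 2) : Plane →L[ℝ] ℝ).hasFDerivAt
  have p1 : HasFDerivAt (fun y : Plane => y 1)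
      (EuclideanSpace.proj (1 : Fin 2) : Plane →L[ℝ] ℝ) x :=
    (EuclideanSpace.proj (1 : Fin 2) : Plane →L[ℝ] ℝ).hasFDerivAt
  have h1 := ha.hasFDerivAt.comp x p0
  have h2 := hγ.hasFDerivAt.comp x p0
  have h3 := hδ.hasFDerivAt.comp x p1
  refine (h1.smul (h3.sub h2)).congr_fderiv ?_
  refine ContinuousLinearMap.ext fun v => ?_
  simp only [colMap_apply]
  simp [smul_sub, mul_smul]
  module

/-- For almost every translation vector `v`, the curve `γ + χ v` is transverse to `δ` at
parameters where `χ` does not vanish. -/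
theorem ae_transverse {χ : ℝ → ℝ} {γ δ : ℝ → Plane} (hχ : Differentiable ℝ χ)
    (hγ : Differentiable ℝ γ) (hδ : Differentiable ℝ δ) :
    ∀ᵐ v : Plane, ∀ t s, χ t ≠ 0 → γ t + χ t • v = δ s →
      cross (deriv γ t + deriv χ t • v) (deriv δ s) ≠ 0 := by
  -- Solving `γ t + χ t • v = δ s` for `v` gives `v = f (t, s)`. Up to nonzero factors, the columns
  -- of the derivative of `f` are the two tangent vectors at this meeting point. So bad vectors `v`
  -- are critical values of `f`, a null set.
  let f : Plane → Plane := fun y => (χ (y 0))⁻¹ • (δ (y 1) - γ (y 0))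
  let S : Set Plane := {x | χ (x 0) ≠ 0 ∧
    cross (deriv γ (x 0) + deriv χ (x 0) • f x) (deriv δ (x 1)) = 0}
  let f' : Plane → Plane →L[ℝ] Plane := fun x =>
    colMap ((-deriv χ (x 0) / χ (x 0) ^ 2) • (δ (x 1) - γ (x 0)) - (χ (x 0))⁻¹ • deriv γ (x 0))
      ((χ (x 0))⁻¹ • deriv δ (x 1))
  have hf' : ∀ x ∈ S, HasFDerivWithinAt f (f' x) S x := by
    intro x hx
    exact (hasFDerivAt_smul_sub (a := fun t => (χ t)⁻¹) ((hχ _).hasDerivAt.fun_inv hx.1)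
      (hγ _).hasDerivAt (hδ _).hasDerivAt).hasFDerivWithinAt
  have hdet : ∀ x ∈ S, (f' x).det = 0 := by
    rintro x ⟨hx0, hx⟩
    have : (-deriv χ (x 0) / χ (x 0) ^ 2) • (δ (x 1) - γ (x 0)) - (χ (x 0))⁻¹ • deriv γ (x 0) =
        (-(χ (x 0))⁻¹) • (deriv γ (x 0) + deriv χ (x 0) • f x) := by
      simp only [f, smul_add, smul_smul]
      rw [sub_eq_add_neg, add_comm, neg_smul]
      congr 2
      field_simp
    rw [det_colMap, this, cross_smul_left, cross_smul_right, hx]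
    simp
  have hnull := addHaar_image_eq_zero_of_det_fderivWithin_eq_zero volume hf' hdet
  rw [ae_iff]
  refine measure_mono_null ?_ hnull
  intro v hv
  simp only [Set.mem_ofPred_eq, not_forall, not_not] at hv
  obtain ⟨t, s, ht, hts, hc⟩ := hv
  have hfx : f !₂[t, s] = v := by
    simp [f, ← hts, ht]
  refine ⟨!₂[t, s], ⟨by simpa using ht, ?_⟩, hfx⟩
  rw [hfx]
  simpa using hc

/-- For almost every `v`, the curve `γ + χ v` avoids a given point where `χ` does not vanish. -/
theorem ae_avoid_point {χ : ℝ → ℝ} {γ : ℝ → Plane} (hχ : Differentiable ℝ χ)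
    (hγ : Differentiable ℝ γ) (q : Plane) :
    ∀ᵐ v : Plane, ∀ t, χ t ≠ 0 → γ t + χ t • v ≠ q := by
  -- Nothing is transverse to a constant curve, so transversality to it means avoiding the point.
  filter_upwards [ae_transverse hχ hγ (δ := fun _ => q) (differentiable_const q)] with v hv t ht h
  exact hv t 0 ht h (by simp)

theorem ae_avoid_countable {χ : ℝ → ℝ} {γ : ℝ → Plane} (hχ : Differentiable ℝ χ)
    (hγ : Differentiable ℝ γ) {Q : Set Plane} (hQ : Q.Countable) :
    ∀ᵐ v : Plane, ∀ t, χ t ≠ 0 → γ t + χ t • v ∉ Q := by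
  have := (ae_ball_iff hQ).mpr (fun q _ => ae_avoid_point hχ hγ q)
  filter_upwards [this] with v hv t ht h
  exact hv _ h t ht rfl

/-- For almost every `v`, the curve `γ + χ v` is immersed where `χ'` does not vanish. -/
theorem ae_immersed {χ : ℝ → ℝ} {γ : ℝ → Plane} (hχ : ContDiff ℝ ∞ χ) (hγ : ContDiff ℝ ∞ γ) :
    ∀ᵐ v : Plane, ∀ t, deriv χ t ≠ 0 → deriv γ t + deriv χ t • v ≠ 0 :=
  -- The velocity is itself a curve translated along `deriv χ`; it has to avoid the origin.
  ae_avoid_point ((hχ.iterate_deriv 1).differentiable (by simp))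
    ((hγ.iterate_deriv 1).differentiable (by simp)) 0

/-- There are only countably many transverse crossings of two curves. -/
theorem countable_transverse_crossings {γ δ : ℝ → Plane} (hγ : Differentiable ℝ γ)
    (hδ : Differentiable ℝ δ) :
    {q | ∃ t s, γ t = q ∧ δ s = q ∧ cross (deriv γ t) (deriv δ s) ≠ 0}.Countable := by
  let S : Set Plane := {x | γ (x 0) = δ (x 1) ∧ cross (deriv γ (x 0)) (deriv δ (x 1)) ≠ 0}
  have hS : S.Countable := by
    -- At a transverse crossing the map `(t, s) ↦ δ s - γ t` has an invertible derivative, so its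
    -- zero there is isolated. A discrete subset of the plane is countable.
    have hd : DiscreteTopology S := by
      rw [discreteTopology_subtype_iff]
      rintro x ⟨hx, hc⟩
      have h1 := hasFDerivAt_smul_sub (x := x) (hasDerivAt_const _ (1 : ℝ))
        (hγ (x 0)).hasDerivAt (hδ (x 1)).hasDerivAt
      have h2 := h1.eventually_ne (c := 0) (exists_antilipschitz_colMap (by
        simpa [sub_eq_add_neg, cross_neg_left] using hc))
      rw [← disjoint_iff, disjoint_principal_right]
      filter_upwards [h2] with y hy hyS
      exact hy (by simp [hyS.1])
    exact (isLindelof_univ.countable_of_discrete).mono (fun x hx => hx) |> fun h =>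
      Set.countable_coe_iff.mp (Set.countable_univ_iff.mp h)
  refine (hS.image (fun x => γ (x 0))).mono ?_
  rintro q ⟨t, s, rfl, h1, h2⟩
  exact ⟨!₂[t, s], ⟨by simpa using h1.symm, by simpa using h2⟩, by simp⟩

end Sard

/-! ### Generic perturbation of one embedded arc -/

/-- A smooth closed curve, parametrized by `ℝ / ℤ`. -/
structure ClosedCurve (γ : ℝ → Plane) : Prop where
  smooth : ContDiff ℝ ∞ γ
  periodic : Function.Periodic γ 1

theorem ClosedCurve.differentiable {γ : ℝ → Plane} (h : ClosedCurve γ) : Differentiable ℝ γ :=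
  h.smooth.differentiable (by simp)

theorem ContDiff.continuous_deriv_infty {E : Type*} [NormedAddCommGroup E] [NormedSpace ℝ E]
    {f : ℝ → E} (h : ContDiff ℝ ∞ f) : Continuous (deriv f) :=
  h.continuous_deriv (by simp)

/-- The parameters in `G` only give rise to transverse double points. -/
structure GenericOn (γ : ℝ → Plane) (G : Set ℝ) : Prop where
  transverse : ∀ s ∈ G, ∀ t ∈ G, γ s = γ t → ¬ SamePoint s t → cross (deriv γ s) (deriv γ t) ≠ 0
  double : ∀ s ∈ G, ∀ t ∈ G, ∀ u ∈ G, γ s = γ t → γ t = γ u →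
    SamePoint s t ∨ SamePoint t u ∨ SamePoint s u

/-- The arcs of `γ` with parameters in `K` are transverse to `δ`, and avoid the transverse double
points of `δ`; the double points of these arcs are not on `δ`. -/
structure MutGenericOn (γ δ : ℝ → Plane) (K : Set ℝ) : Prop where
  transverse : ∀ t ∈ K, ∀ s, γ t = δ s → cross (deriv γ t) (deriv δ s) ≠ 0
  avoid : ∀ t ∈ K, ∀ s u, γ t = δ s → δ s = δ u → cross (deriv δ s) (deriv δ u) = 0
  double : ∀ t ∈ K, ∀ s ∈ K, ∀ u, γ t = γ s → γ s = δ u → SamePoint t s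

/-- A parameter interval with a direction; a curve progresses along the piece if it moves in this
direction during this interval. -/
structure Piece where
  a : ℝ
  b : ℝ
  e : Plane

def Piece.Progress (p : Piece) (γ : ℝ → Plane) : Prop :=
  ∀ t ∈ Set.Icc p.a p.b, 0 < inner ℝ (deriv γ t) p.e

/-- The component of the curve along `p.e` is strictly increasing on the piece. A perturbed piece
therefore has no crossings with itself, a case that translations cannot control. -/
theorem Piece.Progress.injOn {p : Piece} {γ : ℝ → Plane} (h : p.Progress γ)
    (hγ : Differentiable ℝ γ) : Set.InjOn γ (Set.Icc p.a p.b) := by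
  have hd : ∀ t, HasDerivAt (fun t => inner ℝ (γ t) p.e) (inner ℝ (deriv γ t) p.e) t := fun t => by
    simpa using (hγ t).hasDerivAt.inner ℝ (hasDerivAt_const t p.e)
  have hm : StrictMonoOn (fun t => inner ℝ (γ t) p.e) (Set.Icc p.a p.b) := by
    refine strictMonoOn_of_deriv_pos (convex_Icc _ _)
      (fun t _ => (hd t).continuousAt.continuousWithinAt) fun t ht => ?_
    rw [(hd t).deriv]
    exact h t (interior_subset ht)
  intro s hs t ht hst
  exact hm.injOn hs ht (by simp [hst])

theorem deriv_add_smul_const {χ : ℝ → ℝ} {γ : ℝ → Plane} (hχ : Differentiable ℝ χ)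
    (hγ : Differentiable ℝ γ) (v : Plane) (t : ℝ) :
    deriv (fun t => γ t + χ t • v) t = deriv γ t + deriv χ t • v :=
  ((hγ t).hasDerivAt.add ((hχ t).hasDerivAt.smul_const v)).deriv

/-- Positivity on a compact interval is an open condition on `v`. -/
theorem eventually_progress {χ : ℝ → ℝ} {γ : ℝ → Plane} (hχ : ContDiff ℝ ∞ χ)
    (hγ : ContDiff ℝ ∞ γ) {p : Piece} (hp : p.Progress γ) :
    ∀ᶠ v : Plane in 𝓝 0, p.Progress (fun t => γ t + χ t • v) := by
  have key : ∀ᶠ v : Plane in 𝓝 0, ∀ t ∈ Set.Icc p.a p.b,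
      0 < inner ℝ (deriv γ t + deriv χ t • v) p.e := by
    refine isCompact_Icc.eventually_forall_of_forall_eventually fun t ht => ?_
    have hc : Continuous fun z : Plane × ℝ =>
        (inner ℝ (deriv γ z.2 + deriv χ z.2 • z.1) p.e : ℝ) := by
      have h1 := hγ.continuous_deriv_infty
      have h2 := hχ.continuous_deriv_infty
      fun_prop
    exact continuousAt_const.eventually_lt hc.continuousAt (by simpa using hp t ht)
  filter_upwards [key] with v hv t ht
  rw [deriv_add_smul_const (hχ.differentiable (by simp)) (hγ.differentiable (by simp))]
  exact hv t ht

/-- Such a zero is a minimum. Hence pushing by a nonnegative bump keeps the tangent vector at every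
parameter whose point does not move. -/
theorem deriv_eq_zero_of_nonneg {χ : ℝ → ℝ} (hχ0 : ∀ t, 0 ≤ χ t) {t : ℝ} (ht : χ t = 0) :
    deriv χ t = 0 :=
  IsLocalMin.deriv_eq_zero (Filter.Eventually.of_forall fun s => by rw [ht]; exact hχ0 s)

/-- A conull set is dense, so a generic translation vector can be taken arbitrarily small. -/
theorem exists_of_ae_of_eventually {p q : Plane → Prop} (hp : ∀ᵐ v, p v)
    (hq : ∀ᶠ v in 𝓝 0, q v) : ∃ v, p v ∧ q v := by
  obtain ⟨v, hv, hv'⟩ := (Measure.dense_of_ae hp).inter_nhds_nonempty hq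
  exact ⟨v, hv, hv'⟩

/-- A small generic translation of an embedded arc makes it generic. -/
theorem exists_generic_translation {γ δ : ℝ → Plane} {χ : ℝ → ℝ} (hγ : ContDiff ℝ ∞ γ)
    (hγp : Function.Periodic γ 1) (hδ : Differentiable ℝ δ) (hχ : ContDiff ℝ ∞ χ)
    (hχp : Function.Periodic χ 1) (hχ0 : ∀ t, 0 ≤ χ t) {P : Set Piece} (hPfin : P.Finite)
    (hP : ∀ p ∈ P, p.Progress γ) {p : Piece} (hp : p ∈ P)
    (hχp' : ∀ t, χ t ≠ 0 → ∃ k : ℤ, t + k ∈ Set.Icc p.a p.b) {G K : Set ℝ}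
    (hG : GenericOn γ G) (hK : MutGenericOn γ δ K) :
    ∃ v : Plane, (∀ p ∈ P, p.Progress (fun t => γ t + χ t • v)) ∧
      GenericOn (fun t => γ t + χ t • v) (G ∪ {t | χ t ≠ 0}) ∧
      MutGenericOn (fun t => γ t + χ t • v) δ (K ∪ {t | χ t ≠ 0}) := by
  have hγd : Differentiable ℝ γ := hγ.differentiable (by simp)
  have hχd : Differentiable ℝ χ := hχ.differentiable (by simp)
  have e1 : ∀ᶠ v : Plane in 𝓝 0, ∀ p ∈ P, p.Progress (fun t => γ t + χ t • v) := by
    rw [Filter.eventually_all_finite hPfin]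
    exact fun p hp => eventually_progress hχ hγ (hP p hp)
  -- The moved arc is to be transverse to `γ` and to `δ`, and to miss three countable sets: the
  -- transverse double points of `γ`, those of `δ`, and the transverse crossings of `γ` with `δ`.
  have e2 := ae_transverse hχd hγd hγd
  have e3 := ae_transverse hχd hγd hδ
  have e4 := ae_avoid_countable hχd hγd (countable_transverse_crossings hγd hγd)
  have e5 := ae_avoid_countable hχd hγd (countable_transverse_crossings hδ hδ)
  have e6 := ae_avoid_countable hχd hγd (countable_transverse_crossings hγd hδ)
  obtain ⟨v, ⟨⟨⟨⟨h2, h3⟩, h4⟩, h5⟩, h6⟩, h1⟩ :=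
    exists_of_ae_of_eventually (e2.and e3 |>.and e4 |>.and e5 |>.and e6) e1
  have hγv : ClosedCurve (fun t => γ t + χ t • v) :=
    ⟨hγ.add (hχ.smul contDiff_const), fun t => by simp only [hγp t, hχp t]⟩
  have hd := deriv_add_smul_const hχd hγd v
  have hder : ∀ t, χ t = 0 → deriv γ t + deriv χ t • v = deriv γ t := fun t ht => by
    simp [deriv_eq_zero_of_nonneg hχ0 ht]
  -- Two moved parameters lie, modulo 1, in the piece `p`, which is still embedded.
  have hinj : ∀ s t, χ s ≠ 0 → χ t ≠ 0 → γ s + χ s • v = γ t + χ t • v → SamePoint s t := by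
    intro s t hs ht hst
    obtain ⟨k, hk⟩ := hχp' s hs
    obtain ⟨l, hl⟩ := hχp' t ht
    have h := (h1 p hp).injOn hγv.differentiable hk hl
      ((hγv.periodic.eq_of_samePoint (SamePoint.add_int s k)).trans
        (hst.trans (hγv.periodic.eq_of_samePoint (SamePoint.add_int t l)).symm))
    exact ⟨l - k, by push_cast; linarith⟩
  have hmem : ∀ {H : Set ℝ} {t}, t ∈ H ∪ {t | χ t ≠ 0} → χ t = 0 → t ∈ H :=
    fun h h0 => h.resolve_right (fun h' => h' h0)
  -- No triple point arises: the moved arc misses the old double points.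
  have hcr : ∀ s t u, χ s ≠ 0 → t ∈ G → u ∈ G → γ s + χ s • v = γ t → γ t = γ u →
      SamePoint t u := by
    intro s t u hs ht hu hst htu
    by_contra hn
    exact h4 s hs ⟨t, u, hst.symm, (hst.trans htu).symm, hG.transverse t ht u hu htu hn⟩
  refine ⟨v, h1, ⟨?_, ?_⟩, ⟨?_, ?_, ?_⟩⟩
  · intro s hs t ht hst hn
    simp only [hd]
    by_cases hs0 : χ s = 0 <;> by_cases ht0 : χ t = 0
    · rw [hder s hs0, hder t ht0]
      exact hG.transverse s (hmem hs hs0) t (hmem ht ht0) (by simpa [hs0, ht0] using hst) hn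
    · rw [hder s hs0, cross_swap, neg_ne_zero]
      exact h2 t s ht0 (by simpa [hs0] using hst.symm)
    · rw [hder t ht0]
      exact h2 s t hs0 (by simpa [ht0] using hst)
    · exact absurd (hinj s t hs0 ht0 hst) hn
  · intro s hs t ht u hu hst htu
    by_cases hs0 : χ s = 0 <;> by_cases ht0 : χ t = 0 <;> by_cases hu0 : χ u = 0
    · exact hG.double s (hmem hs hs0) t (hmem ht ht0) u (hmem hu hu0)
        (by simpa [hs0, ht0] using hst) (by simpa [hu0, ht0] using htu)
    · exact Or.inl (hcr u s t hu0 (hmem hs hs0) (hmem ht ht0)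
        (by simpa [hs0] using (hst.trans htu).symm) (by simpa [hs0, ht0] using hst))
    · exact Or.inr (Or.inr (hcr t s u ht0 (hmem hs hs0) (hmem hu hu0)
        (by simpa [hs0] using hst.symm) (by simpa [hs0, hu0] using hst.trans htu)))
    · exact Or.inr (Or.inl (hinj t u ht0 hu0 htu))
    · exact Or.inr (Or.inl (hcr s t u hs0 (hmem ht ht0) (hmem hu hu0)
        (by simpa [ht0] using hst) (by simpa [hu0, ht0] using htu)))
    · exact Or.inr (Or.inr (hinj s u hs0 hu0 (hst.trans htu)))
    · exact Or.inl (hinj s t hs0 ht0 hst)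
    · exact Or.inl (hinj s t hs0 ht0 hst)
  · intro t ht s hts
    rw [hd]
    by_cases ht0 : χ t = 0
    · rw [hder t ht0]
      exact hK.transverse t (hmem ht ht0) s (by simpa [ht0] using hts)
    · exact h3 t s ht0 hts
  · intro t ht s u hts hsu
    by_cases ht0 : χ t = 0
    · exact hK.avoid t (hmem ht ht0) s u (by simpa [ht0] using hts) hsu
    · by_contra hn
      exact h5 t ht0 ⟨s, u, hts.symm, (hts.trans hsu).symm, hn⟩
  · intro t ht s hs u hts hsu
    by_cases ht0 : χ t = 0 <;> by_cases hs0 : χ s = 0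
    · exact hK.double t (hmem ht ht0) s (hmem hs hs0) u (by simpa [hs0, ht0] using hts)
        (by simpa [hs0] using hsu)
    · have h : γ t = δ u := by simpa [ht0] using hts.trans hsu
      exact absurd ⟨t, u, by simpa [ht0] using hts, hsu.symm,
        hK.transverse t (hmem ht ht0) u h⟩ (h6 s hs0)
    · have h : γ s = δ u := by simpa [hs0] using hsu
      exact absurd ⟨s, u, by simpa [hs0] using hts.symm, (hts.trans hsu).symm,
        hK.transverse s (hmem hs hs0) u h⟩ (h6 t ht0)
    · exact hinj t s ht0 hs0 hts

/-! ### Smooth periodic bump functions -/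

section Bumps

/-- The cosine is a smooth, strictly decreasing function of the distance to the nearest integer, so
bumps can be built from it with periodicity for free. -/
theorem cos_two_pi_eq_round (x : ℝ) :
    Real.cos (2 * Real.pi * x) = Real.cos (2 * Real.pi * |x - round x|) := by
  rw [← abs_of_pos Real.two_pi_pos, ← abs_mul, Real.cos_abs, abs_of_pos Real.two_pi_pos, mul_sub,
    mul_comm _ (round x : ℝ), Real.cos_sub_int_mul_two_pi]

theorem cos_two_pi_lt_iff {x r : ℝ} (h0 : 0 ≤ r) (h1 : r ≤ 1 / 2) :
    Real.cos (2 * Real.pi * x) < Real.cos (2 * Real.pi * r) ↔ r < |x - round x| := by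
  have hp := Real.pi_pos
  have hr := abs_sub_round x
  rw [cos_two_pi_eq_round, Real.strictAntiOn_cos.lt_iff_gt, mul_lt_mul_iff_right₀ Real.two_pi_pos]
  · exact ⟨by positivity, by nlinarith⟩
  · exact ⟨by positivity, by nlinarith⟩

/-- A smooth nonnegative periodic function that is positive exactly at a given distance from
the translates by `1 / N` of a point. -/
theorem exists_periodic_gap (N : ℕ) (c : ℝ) {r : ℝ} (h0 : 0 ≤ r) (h1 : r ≤ 1 / 2) :
    ∃ χ : ℝ → ℝ, ContDiff ℝ ∞ χ ∧ Function.Periodic χ 1 ∧ (∀ t, 0 ≤ χ t) ∧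
      ∀ t, χ t ≠ 0 ↔ r < |N * (t - c) - round (N * (t - c))| := by
  refine ⟨fun t => expNegInvGlue
    (Real.cos (2 * Real.pi * r) - Real.cos (2 * Real.pi * (N * (t - c)))), ?_, ?_, ?_, ?_⟩
  · exact expNegInvGlue.contDiff.comp (by fun_prop)
  · intro t
    have : 2 * Real.pi * (N * (t + 1 - c)) = 2 * Real.pi * (N * (t - c)) + N * (2 * Real.pi) := by
      ring
    simp only [this, Real.cos_add_nat_mul_two_pi]
  · intro t
    exact expNegInvGlue.nonneg _
  · intro t
    rw [← cos_two_pi_lt_iff h0 h1, Ne, expNegInvGlue.zero_iff_nonpos, not_le, sub_pos]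

theorem lt_abs_sub_round_iff {x r : ℝ} : r < |x - round x| ↔ ∀ k : ℤ, r < |x - k| :=
  ⟨fun h k => h.trans_le (round_le x k), fun h => h _⟩

/-- The parameters in an open interval, modulo `1`. -/
def arcSet (a b : ℝ) : Set ℝ := {t | ∃ k : ℤ, t + k ∈ Set.Ioo a b}

/-- The arc consists of the points at distance more than `1/2 - (b - a)/2` from the point of the
circle opposite its midpoint. -/
theorem exists_periodic_bump {a b : ℝ} (hab : a < b) (hb : b < a + 1) :
    ∃ χ : ℝ → ℝ, ContDiff ℝ ∞ χ ∧ Function.Periodic χ 1 ∧ (∀ t, 0 ≤ χ t) ∧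
      ∀ t, χ t ≠ 0 ↔ t ∈ arcSet a b := by
  obtain ⟨χ, h1, h2, h3, h4⟩ := exists_periodic_gap 1 ((a + b) / 2 + 1 / 2)
    (r := 1 / 2 - (b - a) / 2) (by linarith) (by linarith)
  refine ⟨χ, h1, h2, h3, fun t => ?_⟩
  rw [h4, lt_abs_sub_round_iff]
  simp only [Nat.cast_one, one_mul]
  constructor
  · intro h
    set x := t - ((a + b) / 2 + 1 / 2) with hx
    refine ⟨-⌊x⌋ - 1, ?_⟩
    have e1 := h ⌊x⌋
    have e2 := h (⌊x⌋ + 1)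
    have f1 := Int.floor_le x
    have f2 := Int.lt_floor_add_one x
    push_cast at e2 ⊢
    rw [abs_of_nonneg (by linarith)] at e1
    rw [abs_of_nonpos (by linarith)] at e2
    constructor <;> linarith
  · rintro ⟨k, hk1, hk2⟩ l
    rcases le_or_gt (-k) l with h | h
    · have : (-k : ℝ) ≤ l := by exact_mod_cast h
      refine lt_of_lt_of_le ?_ (neg_le_abs _)
      linarith
    · have : (l : ℝ) + 1 ≤ -k := by exact_mod_cast h
      refine lt_of_lt_of_le ?_ (le_abs_self _)
      linarith

end Bumps

/-! ### Diagrams from generic curves -/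

namespace VirtualDiagram

theorem periodic' (D : VirtualDiagram) : Function.Periodic D.curve 1 := D.periodic

theorem closedCurve (D : VirtualDiagram) : ClosedCurve D.curve := ⟨D.smooth, D.periodic⟩

theorem genericOn (D : VirtualDiagram) (G : Set ℝ) : GenericOn D.curve G :=
  ⟨fun s _ t _ => D.transverse s t, fun s _ t _ u _ => D.double s t u⟩

/-- The diagram given by a generic closed curve. -/
def ofGeneric {γ : ℝ → Plane} (h : ClosedCurve γ) (him : ∀ t, deriv γ t ≠ 0)
    (hg : GenericOn γ Set.univ) (R : Finset Plane)
    (hR : ∀ p ∈ R, ∃ s t, ¬ SamePoint s t ∧ γ s = p ∧ γ t = p) : VirtualDiagram where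
  curve := γ
  smooth := h.smooth
  periodic := h.periodic
  immersed := him
  transverse s t := hg.transverse s trivial t trivial
  double s t u := hg.double s trivial t trivial u trivial
  real := R
  real_crossing := hR

end VirtualDiagram

/-! ### Generic perturbation of whole curves, piece by piece -/

section Pieces

/-- Pieces shorter than the circle. -/
def Piece.Short (p : Piece) : Prop := p.a < p.b ∧ p.b < p.a + 1

/-- The parameters within distance `η` of a multiple of `1 / N`. -/
def nearMarks (N : ℕ) (η : ℝ) : Set ℝ := {t | ∃ k : ℤ, |t - k / N| < η}

theorem isOpen_nearMarks (N : ℕ) (η : ℝ) : IsOpen (nearMarks N η) := by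
  have : nearMarks N η = ⋃ k : ℤ, {t : ℝ | |t - k / N| < η} := by
    ext t; simp [nearMarks]
  rw [this]
  exact isOpen_iUnion fun k => isOpen_lt (by fun_prop) (by fun_prop)

theorem add_int_mem_nearMarks {N : ℕ} (hN : N ≠ 0) {η t : ℝ} (k : ℤ) (h : t ∈ nearMarks N η) :
    t + k ∈ nearMarks N η := by
  obtain ⟨l, hl⟩ := h
  refine ⟨l + k * N, ?_⟩
  have : t + k - ((l + k * N : ℤ) : ℝ) / N = t - l / N := by
    push_cast
    field_simp
    ring
  rwa [this]

theorem nearMarks_mono {N : ℕ} {η η' : ℝ} (h : η ≤ η') : nearMarks N η ⊆ nearMarks N η' :=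
  fun _ ⟨k, hk⟩ => ⟨k, hk.trans_le h⟩

/-- An immersed closed curve can be covered by finitely many pieces, away from the marks. -/
theorem exists_pieces {γ : ℝ → Plane} (hγ : ClosedCurve γ) (him : ∀ t, deriv γ t ≠ 0) {N : ℕ}
    (hN : N ≠ 0) {η : ℝ} (hη : 0 < η) :
    ∃ P : Set Piece, P.Finite ∧ (∀ p ∈ P, p.Short ∧ p.Progress γ ∧
      ∀ t ∈ Set.Icc p.a p.b, t ∉ nearMarks N (η / 2)) ∧
      ∀ t, t ∉ nearMarks N η → ∃ p ∈ P, t ∈ arcSet p.a p.b := by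
  -- Near `t` the curve progresses in the direction of its velocity at `t`. The bound `1/2` makes
  -- the piece shorter than the circle; `η / 2` keeps it off the smaller neighbourhoods of the marks
  -- when `t` is outside the larger ones.
  have hr : ∀ t : ℝ, ∃ r > 0, r < 1 / 2 ∧ r ≤ η / 2 ∧
      ∀ s, |s - t| ≤ r → 0 < inner ℝ (deriv γ s) (deriv γ t) := by
    intro t
    have hc : Continuous fun s => (inner ℝ (deriv γ s) (deriv γ t) : ℝ) := by
      have := hγ.smooth.continuous_deriv_infty
      fun_prop
    have h0 : 0 < (inner ℝ (deriv γ t) (deriv γ t) : ℝ) := by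
      rw [real_inner_self_pos]; exact him t
    obtain ⟨r, hr, hr'⟩ := Metric.eventually_nhds_iff.mp
      (continuousAt_const.eventually_lt (hc.continuousAt (x := t)) h0)
    refine ⟨min (r / 2) (min (1 / 4) (η / 2)), by positivity, ?_, ?_, fun s hs => hr' ?_⟩
    · exact lt_of_le_of_lt ((min_le_right _ _).trans (min_le_left _ _)) (by norm_num)
    · exact (min_le_right _ _).trans (min_le_right _ _)
    · rw [Real.dist_eq]
      exact lt_of_le_of_lt (hs.trans (min_le_left _ _)) (by linarith)
  choose r hr0 hr1 hr2 hr3 using hr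
  have hK : IsCompact (Set.Icc (0 : ℝ) 1 \ nearMarks N η) :=
    isCompact_Icc.diff (isOpen_nearMarks N η)
  obtain ⟨F, hF, hcov⟩ := hK.elim_nhds_subcover (fun t => Set.Ioo (t - r t) (t + r t))
    (fun t _ => Ioo_mem_nhds (by linarith [hr0 t]) (by linarith [hr0 t]))
  refine ⟨(fun t => ⟨t - r t, t + r t, deriv γ t⟩) '' F, F.finite_toSet.image _, ?_, ?_⟩
  · rintro _ ⟨t, ht, rfl⟩
    refine ⟨⟨by simp only; linarith [hr0 t], by simp only; linarith [hr1 t]⟩, fun s hs => ?_,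
      fun s hs => ?_⟩
    · exact hr3 t s (abs_sub_le_iff.mpr ⟨by linarith [hs.2], by linarith [hs.1]⟩)
    · rintro ⟨k, hk⟩
      refine (hF t ht).2 ⟨k, ?_⟩
      have h1 : |t - s| ≤ η / 2 :=
        (abs_sub_le_iff.mpr ⟨by linarith [hs.1], by linarith [hs.2]⟩).trans (hr2 t)
      have := abs_sub_le t s (k / N)
      linarith
  · intro t ht
    have hft : Int.fract t ∈ Set.Icc (0 : ℝ) 1 \ nearMarks N η := by
      refine ⟨⟨Int.fract_nonneg t, (Int.fract_lt_one t).le⟩, fun h => ht ?_⟩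
      have := add_int_mem_nearMarks hN ⌊t⌋ h
      rwa [Int.fract_add_floor] at this
    obtain ⟨s, hs, hs'⟩ := Set.mem_iUnion₂.mp (hcov hft)
    refine ⟨_, ⟨s, hs, rfl⟩, -⌊t⌋, ?_⟩
    have : t + ((-⌊t⌋ : ℤ) : ℝ) = Int.fract t := by
      rw [Int.fract]; push_cast; ring
    rw [this]
    exact hs'

/-- The parameters covered by a set of pieces. -/
def coveredSet (P : Set Piece) : Set ℝ := {t | ∃ p ∈ P, t ∈ arcSet p.a p.b}

theorem coveredSet_insert (p : Piece) (S : Set Piece) :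
    coveredSet (insert p S) = coveredSet S ∪ arcSet p.a p.b := by
  ext t
  simp [coveredSet, or_comm]

theorem GenericOn.mono {γ : ℝ → Plane} {G H : Set ℝ} (h : GenericOn γ G) (hs : H ⊆ G) :
    GenericOn γ H :=
  ⟨fun s hs' t ht => h.transverse s (hs hs') t (hs ht),
    fun s hs' t ht u hu => h.double s (hs hs') t (hs ht) u (hs hu)⟩

/-- One generic perturbation, supported in a piece. -/
theorem exists_perturbation {γ δ : ℝ → Plane} (hγ : ClosedCurve γ) (him : ∀ t, deriv γ t ≠ 0)
    (hδ : Differentiable ℝ δ) {P : Set Piece} (hPfin : P.Finite)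
    (hP : ∀ p ∈ P, p.Progress γ) {p : Piece} (hp : p ∈ P) (hps : p.Short) {G K : Set ℝ}
    (hG : GenericOn γ G) (hK : MutGenericOn γ δ K) :
    ∃ γ' : ℝ → Plane, ClosedCurve γ' ∧ (∀ t, deriv γ' t ≠ 0) ∧ (∀ p ∈ P, p.Progress γ') ∧
      GenericOn γ' (G ∪ arcSet p.a p.b) ∧ MutGenericOn γ' δ (K ∪ arcSet p.a p.b) ∧
      ∀ t, t ∉ arcSet p.a p.b → γ' t = γ t ∧ deriv γ' t = deriv γ t := by
  obtain ⟨χ, hχ, hχp, hχ0, hχs⟩ := exists_periodic_bump hps.1 hps.2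
  have hset : {t | χ t ≠ 0} = arcSet p.a p.b := Set.ext hχs
  obtain ⟨v, h1, h2, h3⟩ := exists_generic_translation hγ.smooth hγ.periodic hδ hχ hχp hχ0 hPfin hP
    hp (fun t ht => by
      obtain ⟨k, hk⟩ := (hχs t).mp ht
      exact ⟨k, Set.Ioo_subset_Icc_self hk⟩) hG hK
  rw [hset] at h2 h3
  have hγv : ClosedCurve (fun t => γ t + χ t • v) :=
    ⟨hγ.smooth.add (hχ.smul contDiff_const), fun t => by simp only [hγ.periodic t, hχp t]⟩
  have hoff : ∀ t, t ∉ arcSet p.a p.b → γ t + χ t • v = γ t ∧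
      deriv (fun t => γ t + χ t • v) t = deriv γ t := by
    intro t ht
    have h0 : χ t = 0 := by
      by_contra h
      exact ht ((hχs t).mp h)
    rw [deriv_add_smul_const (hχ.differentiable (by simp)) hγ.differentiable]
    simp [h0, deriv_eq_zero_of_nonneg hχ0 h0]
  refine ⟨_, hγv, fun t => ?_, h1, h2, h3, hoff⟩
  by_cases ht : t ∈ arcSet p.a p.b
  · obtain ⟨k, hk⟩ := ht
    have h := h1 p hp _ (Set.Ioo_subset_Icc_self hk)
    rw [hγv.periodic.deriv.eq_of_samePoint (SamePoint.add_int t k)] at h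
    intro h0
    rw [h0, inner_zero_left] at h
    exact lt_irrefl _ h
  · rw [(hoff t ht).2]
    exact him t

/-- An immersed closed curve that is generic on `G` can be made generic on `G` and the covered
parameters, without changing the rest. -/
theorem exists_generic_curve {γ : ℝ → Plane} (hγ : ClosedCurve γ) (him : ∀ t, deriv γ t ≠ 0)
    {P : Set Piece} (hPfin : P.Finite) (hP : ∀ p ∈ P, p.Short ∧ p.Progress γ) {G : Set ℝ}
    (hG : GenericOn γ G) :
    ∃ γ' : ℝ → Plane, ClosedCurve γ' ∧ (∀ t, deriv γ' t ≠ 0) ∧ GenericOn γ' (G ∪ coveredSet P) ∧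
      ∀ t, t ∉ coveredSet P → γ' t = γ t ∧ deriv γ' t = deriv γ t := by
  -- Pieces are treated one at a time. Progress is carried along for all of `P`, so that the pieces
  -- still to come remain embedded.
  suffices H : ∀ S : Set Piece, S.Finite → S ⊆ P → ∃ γ' : ℝ → Plane, ClosedCurve γ' ∧
      (∀ t, deriv γ' t ≠ 0) ∧ (∀ p ∈ P, p.Progress γ') ∧ GenericOn γ' (G ∪ coveredSet S) ∧
      ∀ t, t ∉ coveredSet S → γ' t = γ t ∧ deriv γ' t = deriv γ t by
    obtain ⟨γ', h1, h2, -, h3⟩ := H P hPfin subset_rfl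
    exact ⟨γ', h1, h2, h3⟩
  intro S hS
  induction S, hS using Set.Finite.induction_on with
  | empty =>
    intro _
    exact ⟨γ, hγ, him, fun p hp => (hP p hp).2, by simpa [coveredSet] using hG,
      fun t _ => ⟨rfl, rfl⟩⟩
  | @insert p S _ _ ih =>
    intro hS
    obtain ⟨γ₁, h1, h2, h3, h4, h5⟩ := ih ((Set.subset_insert _ _).trans hS)
    have hp := hS (Set.mem_insert _ _)
    -- No second curve matters here; with `K = ∅` the mutual condition is void.
    obtain ⟨γ₂, k1, k2, k3, k4, -, k5⟩ := exists_perturbation (δ := fun _ => 0) (K := ∅) h1 h2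
      (by fun_prop) hPfin h3 hp (hP p hp).1 h4 ⟨by simp, by simp, by simp⟩
    refine ⟨γ₂, k1, k2, k3, ?_, fun t ht => ?_⟩
    · rwa [coveredSet_insert, ← Set.union_assoc]
    · rw [coveredSet_insert, Set.mem_union, not_or] at ht
      rw [(k5 t ht.2).1, (k5 t ht.2).2]
      exact h5 t ht.1

open VirtualDiagram in
/-- By detour moves, a diagram can be made mutually generic with a given curve. -/
theorem exists_strictEquiv_mutGeneric (D : VirtualDiagram) {δ : ℝ → Plane}
    (hδ : Differentiable ℝ δ) {P : Set Piece} (hPfin : P.Finite)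
    (hP : ∀ p ∈ P, p.Short ∧ p.Progress D.curve)
    (hR : ∀ t, D.curve t ∈ D.real → ∀ p ∈ P, ∀ k : ℤ, t + k ∉ Set.Icc p.a p.b) :
    ∃ D' : VirtualDiagram, StrictEquiv D D' ∧ D'.real = D.real ∧
      MutGenericOn D'.curve δ (coveredSet P) ∧
      ∀ t, t ∉ coveredSet P → D'.curve t = D.curve t ∧ deriv D'.curve t = deriv D.curve t := by
  -- The last clause of the induction keeps real crossings off all pieces, so that each perturbation
  -- is a detour.
  suffices H : ∀ S : Set Piece, S.Finite → S ⊆ P → ∃ D' : VirtualDiagram, StrictEquiv D D' ∧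
      D'.real = D.real ∧ MutGenericOn D'.curve δ (coveredSet S) ∧
      (∀ t, t ∉ coveredSet S → D'.curve t = D.curve t ∧ deriv D'.curve t = deriv D.curve t) ∧
      (∀ p ∈ P, p.Progress D'.curve) ∧
      ∀ t, D'.curve t ∈ D'.real → ∀ p ∈ P, ∀ k : ℤ, t + k ∉ Set.Icc p.a p.b by
    obtain ⟨D', h1, h2, h3, h4, -⟩ := H P hPfin subset_rfl
    exact ⟨D', h1, h2, h3, h4⟩
  intro S hS
  induction S, hS using Set.Finite.induction_on with
  | empty =>
    intro _
    refine ⟨D, .refl _, rfl, ?_, fun t _ => ⟨rfl, rfl⟩, fun p hp => (hP p hp).2, hR⟩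
    simp only [coveredSet, Set.mem_empty_iff_false, false_and, exists_false]
    exact ⟨by simp, by simp, by simp⟩
  | @insert p S _ _ ih =>
    intro hS
    obtain ⟨D₁, h1, h2, h3, h4, h5, h6⟩ := ih ((Set.subset_insert _ _).trans hS)
    have hp := hS (Set.mem_insert _ _)
    have hps := (hP p hp).1
    obtain ⟨γ₂, k1, k2, k3, k4, k5, k6⟩ := exists_perturbation D₁.closedCurve D₁.immersed hδ hPfin
      h5 hp hps (D₁.genericOn Set.univ) h3
    have hfix : ∀ t, D₁.curve t ∈ D₁.real → γ₂ t = D₁.curve t := by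
      intro t ht
      refine (k6 t ?_).1
      rintro ⟨k, hk⟩
      exact h6 t ht p hp k (Set.Ioo_subset_Icc_self hk)
    let D₂ : VirtualDiagram := ofGeneric k1 k2 (k4.mono (by simp)) D₁.real (by
      intro q hq
      obtain ⟨s, t, hst, hs, ht⟩ := D₁.real_crossing q hq
      exact ⟨s, t, hst, by rw [hfix s (hs ▸ hq), hs], by rw [hfix t (ht ▸ hq), ht]⟩)
    -- Both old branches at a real crossing are unmoved. A moved arc through it would create a
    -- triple point, so `t` is one of the old two parameters modulo 1.
    have hR₂ : ∀ t, D₂.curve t ∈ D₂.real → ∀ p ∈ P, ∀ k : ℤ, t + k ∉ Set.Icc p.a p.b := by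
      intro t ht q hq k hk
      obtain ⟨s, u, hsu, hs, hu⟩ := D₁.real_crossing _ ht
      have hs' : D₁.curve s ∈ D₁.real := hs ▸ ht
      have hu' : D₁.curve u ∈ D₁.real := hu ▸ ht
      have es : D₂.curve t = D₂.curve s := ((hfix s hs').trans hs).symm
      have eu : D₂.curve s = D₂.curve u :=
        ((hfix s hs').trans hs).trans ((hfix u hu').trans hu).symm
      rcases D₂.double t s u es eu with ⟨l, h⟩ | h | ⟨l, h⟩
      · refine h6 s hs' q hq (l + k) ?_
        rw [h] at hk
        convert hk using 1
        push_cast; ring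
      · exact hsu h
      · refine h6 u hu' q hq (l + k) ?_
        rw [h] at hk
        convert hk using 1
        push_cast; ring
    refine ⟨D₂, h1.trans _ _ _ (.rel _ _ (Or.inr (Or.inr ⟨rfl, p.a, p.b, hps.1, hps.2, ?_, ?_⟩))),
      h2, ?_, ?_, k3, hR₂⟩
    · intro t ht
      constructor
      · intro h
        exact h6 t h p hp 0 (by simpa using ht)
      · intro h
        exact hR₂ t h p hp 0 (by simpa using ht)
    · intro t ht
      refine (k6 t ?_).1
      rintro ⟨k, hk1, hk2⟩
      rcases le_or_gt 0 k with h | h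
      · have : (0 : ℝ) ≤ k := by exact_mod_cast h
        linarith [ht.1]
      · have : (k : ℝ) ≤ -1 := by exact_mod_cast Int.le_sub_one_of_lt h
        linarith [ht.2]
    · rwa [coveredSet_insert]
    · intro t ht
      rw [coveredSet_insert, Set.mem_union, not_or] at ht
      have e1 := k6 t ht.2
      have e2 := h4 t ht.1
      exact ⟨e1.1.trans e2.1, e1.2.trans e2.2⟩

end Pieces

theorem VirtualDiagram.ext' {D D' : VirtualDiagram} (h : D.curve = D'.curve)
    (h' : D.real = D'.real) : D = D' := by
  cases D; cases D'
  simp only at h h'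
  subst h h'
  rfl

/-! ### Exchanging arcs of two curves -/

section Mixture

/-- Interchanging arcs of two mutually generic curves gives a generic curve. -/
theorem genericOn_of_mutGeneric {γ δ M : ℝ → Plane} (hγ : GenericOn γ Set.univ)
    (hδ : GenericOn δ Set.univ) {K : Set ℝ} (hK : MutGenericOn γ δ K)
    (hoff : ∀ t, t ∉ K → γ t = δ t ∧ deriv γ t = deriv δ t)
    (hM : ∀ t, (M t = γ t ∧ deriv M t = deriv γ t) ∨ (M t = δ t ∧ deriv M t = deriv δ t)) :
    GenericOn M Set.univ := by
  -- Outside `K` the curves agree and the point is counted as one of `δ`. So points counted for `γ`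
  -- always have parameters in `K`, where mutual genericity applies.
  have hM' : ∀ t, (t ∈ K ∧ M t = γ t ∧ deriv M t = deriv γ t) ∨
      (M t = δ t ∧ deriv M t = deriv δ t) := by
    intro t
    by_cases ht : t ∈ K
    · exact (hM t).imp (fun h => ⟨ht, h⟩) id
    · rcases hM t with h | h
      · exact Or.inr ⟨h.1.trans (hoff t ht).1, h.2.trans (hoff t ht).2⟩
      · exact Or.inr h
  -- A double point of `δ` is transverse, and these are avoided by the arcs in `K`.
  have h2 : ∀ t s u, t ∈ K → γ t = δ s → δ s = δ u → SamePoint s u := by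
    intro t s u ht hts hsu
    by_contra hn
    exact hδ.transverse s trivial u trivial hsu hn (hK.avoid t ht s u hts hsu)
  refine ⟨fun s _ t _ => ?_, fun s _ t _ u _ => ?_⟩
  · rcases hM' s with ⟨ks, hs, hs'⟩ | ⟨hs, hs'⟩ <;> rcases hM' t with ⟨kt, ht, ht'⟩ | ⟨ht, ht'⟩ <;>
      rw [hs, ht, hs', ht']
    · exact hγ.transverse s trivial t trivial
    · exact fun h _ => hK.transverse s ks t h
    · intro h _
      rw [cross_swap, neg_ne_zero]
      exact hK.transverse t kt s h.symm
    · exact hδ.transverse s trivial t trivial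
  · rcases hM' s with ⟨ks, hs, -⟩ | ⟨hs, -⟩ <;> rcases hM' t with ⟨kt, ht, -⟩ | ⟨ht, -⟩ <;>
      rcases hM' u with ⟨ku, hu, -⟩ | ⟨hu, -⟩ <;> rw [hs, ht, hu] <;> intro hst htu
    · exact hγ.double s trivial t trivial u trivial hst htu
    · exact Or.inl (hK.double s ks t kt u hst htu)
    · exact Or.inr (Or.inr (hK.double s ks u ku t (hst.trans htu) htu.symm))
    · exact Or.inr (Or.inl (h2 s t u ks hst htu))
    · exact Or.inr (Or.inl (hK.double t kt u ku s htu (htu.symm.trans hst.symm)))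
    · exact Or.inr (Or.inr (h2 t s u kt hst.symm (hst.trans htu)))
    · exact Or.inl (h2 u s t ku (htu.symm.trans hst.symm) hst)
    · exact hδ.double s trivial t trivial u trivial hst htu

open Classical in
/-- The curve that is `δ` on `A` and `γ` elsewhere. -/
noncomputable def mixture (A : Set ℝ) (γ δ : ℝ → Plane) (t : ℝ) : Plane :=
  if t ∈ A then δ t else γ t

theorem mixture_eventuallyEq {A : Set ℝ} {γ δ : ℝ → Plane} {t : ℝ}
    (h : A ∈ 𝓝 t ∨ Aᶜ ∈ 𝓝 t ∨ γ =ᶠ[𝓝 t] δ) :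
    mixture A γ δ =ᶠ[𝓝 t] γ ∨ mixture A γ δ =ᶠ[𝓝 t] δ := by
  rcases h with h | h | h
  · right
    filter_upwards [h] with s hs
    simp [mixture, hs]
  · left
    filter_upwards [h] with s hs
    simp [mixture, show s ∉ A from hs]
  · left
    filter_upwards [h] with s hs
    simp [mixture, hs]

/-- Smoothness is local, and `h` says that the curves are switched only where they agree on a
neighbourhood. -/
theorem closedCurve_mixture {A : Set ℝ} {γ δ : ℝ → Plane} (hγ : ClosedCurve γ)
    (hδ : ClosedCurve δ) (hA : ∀ t, t + 1 ∈ A ↔ t ∈ A)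
    (h : ∀ t, A ∈ 𝓝 t ∨ Aᶜ ∈ 𝓝 t ∨ γ =ᶠ[𝓝 t] δ) : ClosedCurve (mixture A γ δ) := by
  refine ⟨contDiff_iff_contDiffAt.mpr fun t => ?_, fun t => ?_⟩
  · rcases mixture_eventuallyEq (h t) with h' | h'
    · exact hγ.smooth.contDiffAt.congr_of_eventuallyEq h'
    · exact hδ.smooth.contDiffAt.congr_of_eventuallyEq h'
  · have h1 := hA t
    by_cases ht : t ∈ A <;> simp [mixture, h1, ht, hγ.periodic t, hδ.periodic t]

end Mixture

/-! ### Diagrams that agree near the marks are strictly equivalent -/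

section Marks

theorem div_mem_nearMarks {N : ℕ} {η : ℝ} (hη : 0 < η) (k : ℤ) : (k / N : ℝ) ∈ nearMarks N η :=
  ⟨k, by simpa using hη⟩

/-- The boundary of this set consists of marks: the integers and the translates of `k / N`. -/
theorem fract_lt_mem_nhds {N : ℕ} (hN : N ≠ 0) (k : ℕ) {η : ℝ} (hη : 0 < η) (t : ℝ) :
    {t : ℝ | Int.fract t < k / N} ∈ 𝓝 t ∨ {t : ℝ | Int.fract t < k / N}ᶜ ∈ 𝓝 t ∨
      nearMarks N η ∈ 𝓝 t := by
  by_cases ht : t ∈ nearMarks N η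
  · exact Or.inr (Or.inr ((isOpen_nearMarks N η).mem_nhds ht))
  · have hmark : ∀ l : ℤ, t ≠ l / N := by
      rintro l rfl
      exact ht (div_mem_nearMarks hη l)
    have hc : ContinuousAt (Int.fract : ℝ → ℝ) t := continuousAt_fract fun h => by
      refine hmark (⌊t⌋ * N) ?_
      push_cast
      rw [mul_div_cancel_right₀ _ (by positivity)]
      have := Int.self_sub_floor t
      linarith
    rcases lt_trichotomy (Int.fract t) (k / N) with h | h | h
    · exact Or.inl (hc.eventually_lt continuousAt_const h)
    · refine absurd ?_ (hmark (⌊t⌋ * N + k))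
      have := Int.self_sub_floor t
      push_cast
      rw [add_div, mul_div_cancel_right₀ _ (by positivity)]
      linarith
    · right; left
      filter_upwards [continuousAt_const.eventually_lt hc h] with s hs
      exact not_lt.mpr hs.le

open VirtualDiagram

/-- At a real crossing both branches of `D` sit at marks, where `E` passes through the same point.
Since `E` has no triple points, it has no further branch there. -/
theorem VirtualDiagram.mark_of_mem_real {D E : VirtualDiagram} {N : ℕ} (hN : N ≠ 0)
    (hE : E.real = D.real) (hDE : ∀ k : ℤ, E.curve (k / N) = D.curve (k / N))
    (hD : ∀ t, D.curve t ∈ D.real → ∃ k : ℤ, t = k / N) :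
    ∀ t, E.curve t ∈ E.real → ∃ k : ℤ, t = k / N := by
  intro t ht
  rw [hE] at ht
  obtain ⟨s, u, hsu, hs, hu⟩ := D.real_crossing _ ht
  obtain ⟨k, hk⟩ := hD s (hs ▸ ht)
  obtain ⟨l, hl⟩ := hD u (hu ▸ ht)
  have hsE : E.curve s = E.curve t := by rw [← hs, hk, hDE]
  have huE : E.curve u = E.curve t := by rw [← hu, hl, hDE]
  have key : ∀ (s : ℝ) (k : ℤ), s = k / N → SamePoint t s → ∃ k : ℤ, t = k / N := by
    rintro s k rfl ⟨m, hm⟩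
    refine ⟨k + m * N, ?_⟩
    rw [hm]
    push_cast
    field_simp
  rcases E.double s t u hsE huE.symm with h | h | h
  · exact key s k hk h.symm
  · exact key u l hl h
  · exact absurd h hsu

/-- Two diagrams with the same real crossings that agree near finitely many parameters, among which
are those of the real crossings, are strictly equivalent. -/
theorem strictEquiv_of_eqOn_nearMarks {D D' : VirtualDiagram} {N : ℕ} (hN : N ≠ 0) {η : ℝ}
    (hη : 0 < η) (hreal : D'.real = D.real)
    (hagree : ∀ t ∈ nearMarks N η, D'.curve t = D.curve t)
    (hD : ∀ t, D.curve t ∈ D.real → ∃ k : ℤ, t = k / N) : StrictEquiv D D' := by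
  have hN' : (0 : ℝ) < N := by positivity
  obtain ⟨P, hPfin, hP, hcov⟩ := exists_pieces D.closedCurve D.immersed hN hη
  -- `D` is first replaced by a diagram `E` in general position to `D'`, so that all mixtures of `E`
  -- and `D'` below are diagrams.
  obtain ⟨E, hDE, hEr, hmut, hoff⟩ := exists_strictEquiv_mutGeneric D
    D'.closedCurve.differentiable hPfin (fun p hp => ⟨(hP p hp).1, (hP p hp).2.1⟩) (by
      intro t ht p hp k hk
      obtain ⟨l, rfl⟩ := hD t ht
      exact (hP p hp).2.2 _ hk (add_int_mem_nearMarks hN k (div_mem_nearMarks (by positivity) l)))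
  refine hDE.trans _ _ _ ?_
  have hderiv : ∀ t ∈ nearMarks N η, deriv D'.curve t = deriv D.curve t := by
    intro t ht
    refine Filter.EventuallyEq.deriv_eq ?_
    filter_upwards [(isOpen_nearMarks N η).mem_nhds ht] with s hs using hagree s hs
  have hnear : ∀ t ∈ nearMarks N (η / 2), D'.curve t = E.curve t := by
    intro t ht
    rw [hagree t (nearMarks_mono (by linarith) ht), (hoff t _).1]
    rintro ⟨p, hp, k, hk⟩
    exact (hP p hp).2.2 _ (Set.Ioo_subset_Icc_self hk) (add_int_mem_nearMarks hN k ht)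
  have hED : ∀ t, t ∉ coveredSet P → E.curve t = D'.curve t ∧ deriv E.curve t = deriv D'.curve t := by
    intro t ht
    have ht' : t ∈ nearMarks N η := by
      by_contra h
      exact ht (hcov t h)
    rw [(hoff t ht).1, (hoff t ht).2, hagree t ht', hderiv t ht']
    exact ⟨rfl, rfl⟩
  have hmarkE := mark_of_mem_real hN hEr (fun k => by
    rw [← hnear _ (div_mem_nearMarks (by positivity) k),
      hagree _ (div_mem_nearMarks (by positivity) k)]) hD
  have hA : ∀ (k : ℕ) (t : ℝ), t + 1 ∈ {t : ℝ | Int.fract t < k / N} ↔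
      t ∈ {t : ℝ | Int.fract t < k / N} := by
    intro k t
    simp
  have hA' : ∀ (k : ℕ) (t : ℝ), {t : ℝ | Int.fract t < k / N} ∈ 𝓝 t ∨
      {t : ℝ | Int.fract t < k / N}ᶜ ∈ 𝓝 t ∨ E.curve =ᶠ[𝓝 t] D'.curve := by
    intro k t
    refine (fract_lt_mem_nhds hN k (half_pos hη) t).imp_right (Or.imp_right fun h => ?_)
    filter_upwards [h] with s hs using (hnear s hs).symm
  have hmixnear : ∀ (k : ℕ), ∀ t ∈ nearMarks N (η / 2),
      mixture {t : ℝ | Int.fract t < k / N} E.curve D'.curve t = E.curve t := by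
    intro k t ht
    simp [mixture, hnear t ht]
  -- After `k` detours the first `k` arcs between successive marks follow `D'`, the others `E`.
  have H : ∀ k : ℕ, k ≤ N → ∃ F : VirtualDiagram, StrictEquiv E F ∧ F.real = E.real ∧
      F.curve = mixture {t : ℝ | Int.fract t < k / N} E.curve D'.curve := by
    intro k
    induction k with
    | zero =>
      intro _
      refine ⟨E, .refl _, rfl, funext fun t => ?_⟩
      simp [mixture, not_lt.mpr (Int.fract_nonneg t)]
    | succ k ih =>
      intro hk
      obtain ⟨F, hF1, hF2, hF3⟩ := ih (by omega)
      set A := {t : ℝ | Int.fract t < (k + 1 : ℕ) / N} with hAdef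
      have hev := fun t => mixture_eventuallyEq (hA' (k + 1) t)
      have hval : ∀ t, (mixture A E.curve D'.curve t = E.curve t ∧
          deriv (mixture A E.curve D'.curve) t = deriv E.curve t) ∨
          (mixture A E.curve D'.curve t = D'.curve t ∧
          deriv (mixture A E.curve D'.curve) t = deriv D'.curve t) := fun t =>
        (hev t).imp (fun h => ⟨h.eq_of_nhds, h.deriv_eq⟩) (fun h => ⟨h.eq_of_nhds, h.deriv_eq⟩)
      have hFm : ∀ m : ℤ, F.curve (m / N) = E.curve (m / N) := fun m => by
        rw [hF3, hmixnear k _ (div_mem_nearMarks (by positivity) m)]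
      let F' : VirtualDiagram := ofGeneric
        (closedCurve_mixture E.closedCurve D'.closedCurve (hA (k + 1)) (hA' (k + 1)))
        (fun t => by
          rcases hval t with h | h
          · rw [h.2]; exact E.immersed t
          · rw [h.2]; exact D'.immersed t)
        (genericOn_of_mutGeneric (E.genericOn _) (D'.genericOn _) hmut hED hval) E.real (by
          intro q hq
          obtain ⟨s, u, hsu, hs, hu⟩ := E.real_crossing q hq
          obtain ⟨l, hl⟩ := hmarkE s (hs ▸ hq)
          obtain ⟨m, hm⟩ := hmarkE u (hu ▸ hq)
          refine ⟨s, u, hsu, ?_, ?_⟩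
          · rw [hmixnear (k + 1) s (hl ▸ div_mem_nearMarks (by positivity) l), hs]
          · rw [hmixnear (k + 1) u (hm ▸ div_mem_nearMarks (by positivity) m), hu])
      have hFm' : ∀ m : ℤ, F'.curve (m / N) = E.curve (m / N) := fun m =>
        hmixnear (k + 1) _ (div_mem_nearMarks (by positivity) m)
      have hmF := mark_of_mem_real hN hF2 hFm hmarkE
      have hmF' := mark_of_mem_real (D := E) (E := F') hN rfl hFm' hmarkE
      refine ⟨F', hF1.trans _ _ _ (.rel _ _ (Or.inr (Or.inr ⟨hF2.symm, ?_⟩))), rfl, rfl⟩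
      -- The detour arc is the interval between two marks, shortened by `ρ` at both ends. It must be
      -- nondegenerate, and the omitted ends must lie where `E` and `D'` agree.
      obtain ⟨ρ, hρ, hρη, hρN⟩ : ∃ ρ > 0, 2 * ρ ≤ η / 2 ∧ 4 * ρ ≤ 1 / N :=
        ⟨min (η / 4) (1 / (4 * N)), by positivity, by
          linarith [min_le_left (η / 4) (1 / (4 * (N : ℝ)))], by
          have := min_le_right (η / 4) (1 / (4 * (N : ℝ)))
          have e : 4 * (1 / (4 * (N : ℝ))) = 1 / N := by field_simp
          linarith⟩
      have hk1 : ((k + 1 : ℕ) : ℝ) / N = k / N + 1 / N := by push_cast; ring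
      have hk2 : ((k + 1 : ℕ) : ℝ) / N ≤ 1 := by
        rw [div_le_one hN']; exact_mod_cast hk
      have hk0 : (0 : ℝ) ≤ k / N := by positivity
      refine ⟨k / N + ρ, (k + 1 : ℕ) / N - ρ, by linarith, by linarith, ?_, ?_⟩
      · intro t ht
        have : ¬ ∃ l : ℤ, t = l / N := by
          rintro ⟨l, rfl⟩
          have h1 : ((k : ℤ) : ℝ) < l := by
            have := ht.1
            have h : (k : ℝ) / N < l / N := by linarith
            rwa [div_lt_div_iff_of_pos_right hN'] at h
          have h2 : (l : ℝ) < ((k + 1 : ℤ) : ℝ) := by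
            have := ht.2
            have h : (l : ℝ) / N < (k + 1 : ℕ) / N := by linarith
            rw [div_lt_div_iff_of_pos_right hN'] at h
            exact_mod_cast h
          have h1' : (k : ℤ) < l := by exact_mod_cast h1
          have h2' : l < (k : ℤ) + 1 := by exact_mod_cast h2
          omega
        exact ⟨fun h => this (hmF t h), fun h => this (hmF' t h)⟩
      · intro t ht
        change mixture A E.curve D'.curve t = F.curve t
        rw [hF3]
        by_cases h1 : t ∈ nearMarks N (η / 2)
        · rw [hmixnear k t h1, hmixnear (k + 1) t h1]
        · have hff := Int.self_sub_floor t
          by_cases h2 : Int.fract t < k / N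
          · have h3 : Int.fract t < (k + 1 : ℕ) / N := by linarith [one_div_pos.mpr hN']
            have m1 : t ∈ {t : ℝ | Int.fract t < k / N} := h2
            have m2 : t ∈ A := h3
            simp only [mixture, m1, m2, if_true]
          · by_cases h3 : Int.fract t < (k + 1 : ℕ) / N
            · exfalso
              have hft : Int.fract t ∉ nearMarks N (η / 2) := by
                intro h
                refine h1 ?_
                have := add_int_mem_nearMarks hN ⌊t⌋ h
                rwa [Int.fract_add_floor] at this
              have g1 : η / 2 ≤ |Int.fract t - k / N| := by
                by_contra h
                exact hft ⟨k, by simpa using h⟩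
              have g2 : η / 2 ≤ |Int.fract t - (k + 1 : ℕ) / N| := by
                by_contra h
                exact hft ⟨(k + 1 : ℕ), by simpa using h⟩
              rw [abs_of_nonneg (by linarith)] at g1
              rw [abs_of_nonpos (by linarith)] at g2
              rcases le_or_gt ⌊t⌋ 0 with h | h
              · have : (⌊t⌋ : ℝ) ≤ 0 := by exact_mod_cast h
                linarith [ht.1]
              · have : (1 : ℝ) ≤ ⌊t⌋ := by exact_mod_cast h
                linarith [ht.2]
            · have m1 : t ∉ {t : ℝ | Int.fract t < k / N} := h2
              have m2 : t ∉ A := h3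
              simp only [mixture, m1, m2, if_false]
  -- Fractional parts are below 1, so the last mixture is `D'` itself.
  obtain ⟨F, hF1, hF2, hF3⟩ := H N le_rfl
  have hFD : F = D' := by
    refine ext' (funext fun t => ?_) (by rw [hF2, hEr, hreal])
    rw [hF3, mixture, if_pos]
    simp only [Set.mem_ofPred_eq, div_self hN'.ne']
    exact Int.fract_lt_one t
  rwa [← hFD]

end Marks

/-! ### Counting the letters of a Gauss code -/

section Codes

theorem Side.eq_of_ne {a b c : Side} (h : a ≠ b) (h' : b ≠ c) : a = c := by
  cases a <;> cases b <;> cases c <;> simp_all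

def Side.equivBool : Side ≃ Bool where
  toFun s := match s with | .L => true | .R => false
  invFun b := match b with | true => .L | false => .R
  left_inv s := by cases s <;> rfl
  right_inv b := by cases b <;> rfl

instance : Fintype Side := Fintype.ofEquiv Bool Side.equivBool.symm

theorem GaussCode.card_prod_side (n : ℕ) : Fintype.card (Fin n × Side) = 2 * n := by
  rw [Fintype.card_prod, Fintype.card_congr Side.equivBool, Fintype.card_bool, Fintype.card_fin,
    mul_comm]

theorem GaussCode.bijective {n : ℕ} (w : GaussCode n) : Function.Bijective w.seq := by
  rw [Fintype.bijective_iff_surjective_and_card]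
  exact ⟨w.surj, by rw [card_prod_side, Fintype.card_fin]⟩

end Codes

/-! ### The normal form of a diagram and its uniqueness -/

section NormalForm

variable {n : ℕ}

/-- The direction of the branch of each side at a crossing in normal form. -/
noncomputable def sideDir : Side → Plane
  | .L => !₂[1, 0]
  | .R => !₂[0, -1]

/-- On the diagonal both coordinates distinguish the points, so that shears in either direction can
treat them independently. -/
noncomputable def diagPoint (j : ℕ) : Plane := !₂[(j : ℝ), (j : ℝ)]

/-- The label at a mark; the mark `0` is the base point, with the extra label `n`. -/
def GaussCode.markLabel (w : GaussCode n) : Fin (2 * n + 1) → ℕ :=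
  Fin.cases n (fun i => (w.seq i).1)

/-- Since the base point counts as a left branch, every label has exactly one left mark, and left
marks index the marked points. The base point is also a mark for `n = 0`, where it cuts the circle
into an arc that a detour can handle. -/
def GaussCode.markSide (w : GaussCode n) : Fin (2 * n + 1) → Side :=
  Fin.cases .L (fun i => (w.seq i).2)

theorem GaussCode.mark_injective (w : GaussCode n) {i j : Fin (2 * n + 1)}
    (h : w.markLabel i = w.markLabel j) (h' : w.markSide i = w.markSide j) : i = j := by
  induction i using Fin.cases with
  | zero =>
    induction j using Fin.cases with
    | zero => rfl
    | succ j =>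
      simp only [markLabel, Fin.cases_zero, Fin.cases_succ] at h
      exact absurd h (w.seq j).1.2.ne'
  | succ i =>
    induction j using Fin.cases with
    | zero =>
      simp only [markLabel, Fin.cases_zero, Fin.cases_succ] at h
      exact absurd h (w.seq i).1.2.ne
    | succ j =>
      simp only [markLabel, markSide, Fin.cases_succ] at h h'
      rw [w.bijective.1 (Prod.ext (Fin.ext h) h')]

theorem GaussCode.exists_mark (w : GaussCode n) (j : Fin n) (s : Side) :
    ∃ i : Fin (2 * n), w.seq i = (j, s) := w.surj (j, s)

theorem diagPoint_injective : Function.Injective diagPoint := by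
  intro i j h
  have := congrArg (fun p : Plane => p 0) h
  simpa [diagPoint] using this

/-- The parameter of a mark. -/
noncomputable def markParam (n : ℕ) (i : Fin (2 * n + 1)) : ℝ := (i : ℕ) / (2 * n + 1 : ℕ)

/-- Near the marks, the curve is straight and has the prescribed position and direction. -/
def HasNormalGerms (w : GaussCode n) (κ ε : ℝ) (γ : ℝ → Plane) : Prop :=
  ∀ (i : Fin (2 * n + 1)) (x : ℝ), |x| < ε →
    γ (markParam n i + x) = diagPoint (w.markLabel i) + (κ * x) • sideDir (w.markSide i)

/-- The normal form of a diagram with Gauss code `w`. -/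
structure IsNormal (w : GaussCode n) (κ ε : ℝ) (D : VirtualDiagram) : Prop where
  germs : HasNormalGerms w κ ε D.curve
  real_eq : (D.real : Set Plane) = Set.range fun j : Fin n => diagPoint j

theorem exists_mark_of_mem_nearMarks {η t : ℝ} (h : t ∈ nearMarks (2 * n + 1) η) :
    ∃ (i : Fin (2 * n + 1)) (x : ℝ), |x| < η ∧ SamePoint t (markParam n i + x) := by
  obtain ⟨k, hk⟩ := h
  have hN : (0 : ℤ) < (2 * n + 1 : ℕ) := by positivity
  have h0 := Int.emod_nonneg k hN.ne'
  have h1 := Int.emod_lt_of_pos k hN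
  have hcast : ((k % ((2 * n + 1 : ℕ) : ℤ)).toNat : ℤ) = k % ((2 * n + 1 : ℕ) : ℤ) :=
    Int.toNat_of_nonneg h0
  refine ⟨⟨(k % ((2 * n + 1 : ℕ) : ℤ)).toNat, by omega⟩, t - k / (2 * n + 1 : ℕ), hk,
    k / ((2 * n + 1 : ℕ) : ℤ), ?_⟩
  have e := Int.emod_add_mul_ediv k ((2 * n + 1 : ℕ) : ℤ)
  have e' : (((k % ((2 * n + 1 : ℕ) : ℤ)).toNat : ℕ) : ℝ) +
      (2 * n + 1 : ℕ) * ((k / ((2 * n + 1 : ℕ) : ℤ) : ℤ) : ℝ) = k := by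
    rw [← hcast] at e
    exact_mod_cast e
  have hN' : ((2 * n + 1 : ℕ) : ℝ) ≠ 0 := by positivity
  simp only [markParam]
  rw [← e', add_div, mul_div_cancel_left₀ _ hN']
  ring

theorem markParam_samePoint {i j : Fin (2 * n + 1)}
    (h : SamePoint (markParam n i) (markParam n j)) : i = j := by
  obtain ⟨k, hk⟩ := h
  have hN' : (0 : ℝ) < (2 * n + 1 : ℕ) := by positivity
  simp only [markParam] at hk
  rw [div_eq_iff hN'.ne', add_mul, div_mul_cancel₀ _ hN'.ne'] at hk
  have hk' : (i : ℤ) = j + k * (2 * n + 1 : ℕ) := by exact_mod_cast hk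
  have hi : ((i : ℕ) : ℤ) < (2 * n + 1 : ℕ) := by exact_mod_cast i.2
  have hj : ((j : ℕ) : ℤ) < (2 * n + 1 : ℕ) := by exact_mod_cast j.2
  have hi0 : (0 : ℤ) ≤ ((i : ℕ) : ℤ) := by positivity
  have hj0 : (0 : ℤ) ≤ ((j : ℕ) : ℤ) := by positivity
  have : k = 0 := by
    rcases lt_trichotomy k 0 with h | h | h
    · nlinarith
    · exact h
    · nlinarith
  rw [this] at hk'
  exact Fin.ext (by omega)

theorem HasNormalGerms.hasDerivAt {w : GaussCode n} {κ ε : ℝ} {γ : ℝ → Plane}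
    (h : HasNormalGerms w κ ε γ) (i : Fin (2 * n + 1)) {x : ℝ} (hx : |x| < ε) :
    HasDerivAt γ (κ • sideDir (w.markSide i)) (markParam n i + x) := by
  have h1 : HasDerivAt (fun s : ℝ => diagPoint (w.markLabel i) +
      (κ * (s - markParam n i)) • sideDir (w.markSide i)) (κ • sideDir (w.markSide i))
      (markParam n i + x) := by
    have := (((hasDerivAt_id (markParam n i + x)).sub_const (markParam n i)).const_mul
      κ).smul_const (sideDir (w.markSide i)) |>.const_add (diagPoint (w.markLabel i))
    simpa using this
  refine h1.congr_of_eventuallyEq ?_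
  have ho : ∀ᶠ s in 𝓝 (markParam n i + x), |s - markParam n i| < ε := by
    refine (isOpen_lt (f := fun s : ℝ => |s - markParam n i|) (by fun_prop) continuous_const).mem_nhds ?_
    simpa using hx
  filter_upwards [ho] with s hs
  have := h i (s - markParam n i) hs
  rwa [add_sub_cancel] at this

theorem IsNormal.curve_mark {w : GaussCode n} {κ ε : ℝ} {D : VirtualDiagram}
    (h : IsNormal w κ ε D) (hε : 0 < ε) (i : Fin (2 * n + 1)) :
    D.curve (markParam n i) = diagPoint (w.markLabel i) := by
  simpa using h.germs i 0 (by simpa using hε)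

theorem IsNormal.deriv_mark {w : GaussCode n} {κ ε : ℝ} {D : VirtualDiagram}
    (h : IsNormal w κ ε D) (hε : 0 < ε) (i : Fin (2 * n + 1)) :
    deriv D.curve (markParam n i) = κ • sideDir (w.markSide i) := by
  simpa using (h.germs.hasDerivAt i (x := 0) (by simpa using hε)).deriv

/-- The left and the right mark of the label already pass through the crossing, and there are no
triple points. -/
theorem IsNormal.exists_of_mem_real {w : GaussCode n} {κ ε : ℝ} {D : VirtualDiagram}
    (h : IsNormal w κ ε D) (hε : 0 < ε) {t : ℝ} (ht : D.curve t ∈ D.real) :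
    ∃ i : Fin (2 * n), SamePoint t (markParam n i.succ) := by
  have h' : D.curve t ∈ (D.real : Set Plane) := ht
  rw [h.real_eq] at h'
  obtain ⟨j, hj⟩ := h'
  obtain ⟨i, hi⟩ := w.exists_mark j .L
  obtain ⟨i', hi'⟩ := w.exists_mark j .R
  have hl : D.curve (markParam n i.succ) = D.curve t := by
    rw [h.curve_mark hε, ← hj]; simp [GaussCode.markLabel, hi]
  have hl' : D.curve (markParam n i'.succ) = D.curve t := by
    rw [h.curve_mark hε, ← hj]; simp [GaussCode.markLabel, hi']
  rcases D.double _ t _ hl hl'.symm with h1 | h1 | h1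
  · exact ⟨i, h1.symm⟩
  · exact ⟨i', h1⟩
  · have := Fin.succ_injective _ (markParam_samePoint h1)
    rw [this, hi'] at hi
    simp at hi

open VirtualDiagram in
/-- The normal form is unique up to strict equivalence. -/
theorem IsNormal.strictEquiv {w : GaussCode n} {κ ε ε' : ℝ} {D D' : VirtualDiagram}
    (h : IsNormal w κ ε D) (hε : 0 < ε) (h' : IsNormal w κ ε' D') (hε' : 0 < ε') :
    StrictEquiv D D' := by
  refine strictEquiv_of_eqOn_nearMarks (N := 2 * n + 1) (by omega) (lt_min hε hε') ?_ ?_ ?_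
  · rw [← Finset.coe_inj, h.real_eq, h'.real_eq]
  · intro t ht
    obtain ⟨i, x, hx, htx⟩ := exists_mark_of_mem_nearMarks ht
    rw [D.periodic'.eq_of_samePoint htx, D'.periodic'.eq_of_samePoint htx,
      h.germs i x (hx.trans_le (min_le_left _ _)), h'.germs i x (hx.trans_le (min_le_right _ _))]
  · intro t ht
    obtain ⟨i, k, hk⟩ := h.exists_of_mem_real hε ht
    refine ⟨i.succ + k * (2 * n + 1 : ℕ), ?_⟩
    have hN' : ((2 * n + 1 : ℕ) : ℝ) ≠ 0 := by positivity
    rw [hk, markParam]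
    push_cast
    field_simp

/-- The sign matches `HasSide`: seen from the rightward branch, the downward one crosses from left
to right. -/
theorem cross_sideDir : cross (sideDir .L) (sideDir .R) = -1 := by
  simp [cross, sideDir]

theorem markParam_pos (i : Fin (2 * n)) : 0 < markParam n i.succ := by
  simp only [markParam]
  have : 0 < ((i.succ : Fin (2 * n + 1)) : ℕ) := by simp
  positivity

theorem markParam_lt_one (i : Fin (2 * n + 1)) : markParam n i < 1 := by
  simp only [markParam]
  rw [div_lt_one (by positivity)]
  exact_mod_cast i.2

theorem markParam_strictMono : StrictMono (markParam n) := by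
  intro i j hij
  simp only [markParam]
  rw [div_lt_div_iff_of_pos_right (by positivity)]
  exact_mod_cast hij

theorem IsNormal.isGaussCode {w : GaussCode n} {κ ε : ℝ} {D : VirtualDiagram}
    (h : IsNormal w κ ε D) (hε : 0 < ε) (hκ : 0 < κ) : D.IsGaussCode w := by
  have hmem : ∀ p, p ∈ D.real ↔ ∃ j : Fin n, diagPoint j = p := by
    intro p
    rw [← Finset.mem_coe, h.real_eq, Set.mem_range]
  have hinj : Function.Injective fun j : Fin n => (⟨diagPoint j, (hmem _).mpr ⟨j, rfl⟩⟩ :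
      {p // p ∈ D.real}) := by
    intro i j hij
    exact Fin.ext (diagPoint_injective (congrArg Subtype.val hij))
  let g : Fin n ≃ {p // p ∈ D.real} := Equiv.ofBijective _ ⟨hinj, fun p => by
    obtain ⟨j, hj⟩ := (hmem p).mp p.2
    exact ⟨j, Subtype.ext hj⟩⟩
  have hlab : ∀ i : Fin (2 * n), D.curve (markParam n i.succ) = diagPoint (w.seq i).1 := fun i => by
    rw [h.curve_mark hε]; simp [GaussCode.markLabel]
  have hder : ∀ i : Fin (2 * n), deriv D.curve (markParam n i.succ) =
      κ • sideDir (w.seq i).2 := fun i => by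
    rw [h.deriv_mark hε]; simp [GaussCode.markSide]
  refine ⟨0, g.symm, ?_, fun i => markParam n i.succ, ?_, ?_, ?_⟩
  · intro h0
    obtain ⟨i, hi⟩ := h.exists_of_mem_real hε h0
    have e : (0 : ℝ) = markParam n (0 : Fin (2 * n + 1)) := by simp [markParam]
    rw [e] at hi
    exact absurd (markParam_samePoint hi).symm (Fin.succ_ne_zero i)
  · exact markParam_strictMono.comp (Fin.strictMono_succ)
  · ext t
    constructor
    · rintro ⟨i, rfl⟩
      refine ⟨⟨markParam_pos i, by simpa using markParam_lt_one i.succ⟩, ?_⟩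
      rw [hlab, hmem]
      exact ⟨_, rfl⟩
    · rintro ⟨⟨h0, h1⟩, ht⟩
      obtain ⟨i, k, hk⟩ := h.exists_of_mem_real hε ht
      have p0 := markParam_pos i
      have p1 := markParam_lt_one i.succ
      have : k = 0 := by
        have a1 : (-1 : ℝ) < k := by linarith
        have a2 : (k : ℝ) < 1 := by linarith
        have a1' : -1 < k := by exact_mod_cast a1
        have a2' : k < 1 := by exact_mod_cast a2
        omega
      exact ⟨i, by rw [hk, this]; simp⟩
  · intro i hi
    constructor
    · rw [Equiv.eq_symm_apply]
      exact Subtype.ext (hlab i).symm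
    · rcases hs : (w.seq i).2 with _ | _
      · obtain ⟨i', hi'⟩ := w.exists_mark (w.seq i).1 .R
        refine ⟨markParam n i'.succ, ?_, by rw [hlab, hlab, hi'], ?_⟩
        · intro hsame
          have := Fin.succ_injective _ (markParam_samePoint hsame)
          rw [this, hi'] at hs
          simp at hs
        · rw [hder, hder, hs, hi', cross_smul_left, cross_smul_right, cross_sideDir]
          nlinarith
      · obtain ⟨i', hi'⟩ := w.exists_mark (w.seq i).1 .L
        refine ⟨markParam n i'.succ, ?_, by rw [hlab, hlab, hi'], ?_⟩
        · intro hsame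
          have := Fin.succ_injective _ (markParam_samePoint hsame)
          rw [this, hi'] at hs
          simp at hs
        · rw [hder, hder, hs, hi', cross_smul_left, cross_smul_right, cross_swap, cross_sideDir]
          nlinarith

theorem IsNormal.card_real {w : GaussCode n} {κ ε : ℝ} {D : VirtualDiagram}
    (h : IsNormal w κ ε D) : D.real.card = n := by
  rw [← Set.ncard_coe_finset, h.real_eq, ← Set.image_univ, Set.ncard_image_of_injective, Set.ncard_univ]
  · simp
  · exact fun i j hij => Fin.ext (diagPoint_injective hij)

end NormalForm

/-! ### Realization of every Gauss code -/

section Existence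

/-- A smooth periodic function that is `1` near the integers and vanishes away from them. -/
theorem exists_periodic_plateau {r s : ℝ} (h0 : 0 ≤ r) (hrs : r < s) (h1 : s ≤ 1 / 2) :
    ∃ B : ℝ → ℝ, ContDiff ℝ ∞ B ∧ Function.Periodic B 1 ∧
      (∀ t : ℝ, |t - round t| ≤ r → B t = 1) ∧ ∀ t : ℝ, s ≤ |t - round t| → B t = 0 := by
  have hpi := Real.pi_pos
  have hpos : 0 < Real.cos (2 * Real.pi * r) - Real.cos (2 * Real.pi * s) := by
    rw [sub_pos]
    exact Real.cos_lt_cos_of_nonneg_of_le_pi (by positivity) (by nlinarith) (by nlinarith)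
  refine ⟨fun t => Real.smoothTransition ((Real.cos (2 * Real.pi * t) - Real.cos (2 * Real.pi * s))
    / (Real.cos (2 * Real.pi * r) - Real.cos (2 * Real.pi * s))), ?_, ?_, ?_, ?_⟩
  · exact Real.smoothTransition.contDiff.comp (by fun_prop)
  · intro t
    simp only [mul_add, mul_one, Real.cos_add_two_pi]
  · intro t ht
    refine Real.smoothTransition.one_of_one_le ?_
    rw [one_le_div hpos]
    have := (cos_two_pi_lt_iff (x := t) h0 (by linarith)).not.mpr (not_lt.mpr ht)
    linarith
  · intro t ht
    refine Real.smoothTransition.zero_of_nonpos (div_nonpos_of_nonpos_of_nonneg ?_ hpos.le)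
    rw [sub_nonpos, cos_two_pi_eq_round]
    have := abs_sub_round t
    have hs0 : 0 ≤ s := by linarith
    exact Real.cos_le_cos_of_nonneg_of_le_pi (by positivity) (by nlinarith) (by nlinarith)

/-- The jumps of `t - round t` are at half-integers, where `B` vanishes. The product is a smooth
stand-in for the local coordinate at the integers. -/
theorem contDiff_plateau_mul {s : ℝ} (hs : s < 1 / 2) {B : ℝ → ℝ} (hB : ContDiff ℝ ∞ B)
    (hB0 : ∀ t : ℝ, s ≤ |t - round t| → B t = 0) :
    ContDiff ℝ ∞ (fun t : ℝ => B t * (t - round t)) := by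
  refine contDiff_iff_contDiffAt.mpr fun t => ?_
  rcases lt_or_ge |t - round t| (1 / 2) with h | h
  · have h1 : ContDiff ℝ ∞ (fun u : ℝ => B u * (u - (round t : ℤ))) := by fun_prop
    refine h1.contDiffAt.congr_of_eventuallyEq ?_
    have ho : ∀ᶠ u : ℝ in 𝓝 t, |u - round t| < 1 / 2 :=
      (isOpen_lt (f := fun u : ℝ => |u - round t|) (by fun_prop) continuous_const).mem_nhds h
    filter_upwards [ho] with u hu
    have : round u = round t := by
      rw [abs_lt] at hu
      rw [round_eq, Int.floor_eq_iff]
      constructor <;> linarith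
    simp only [this]
  · refine (contDiffAt_const (c := (0 : ℝ))).congr_of_eventuallyEq ?_
    filter_upwards [Metric.ball_mem_nhds t (sub_pos.mpr hs)] with u hu
    rw [Metric.mem_ball, Real.dist_eq, abs_sub_comm] at hu
    rw [hB0 u, zero_mul]
    have h1 := round_le t (round u)
    have h2 := abs_sub_le t u (round u)
    linarith

/-- Immersions are generic. -/
theorem exists_immersed_perturbation {χ : ℝ → ℝ} {γ : ℝ → Plane} (hχ : ContDiff ℝ ∞ χ)
    (hγ : ContDiff ℝ ∞ γ) : ∃ v : Plane, ∀ t, (deriv χ t ≠ 0 ∨ deriv γ t ≠ 0) →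
      deriv (fun t => γ t + χ t • v) t ≠ 0 := by
  obtain ⟨v, hv⟩ := (ae_immersed hχ hγ).exists
  refine ⟨v, fun t ht => ?_⟩
  rw [deriv_add_smul_const (hχ.differentiable (by simp)) (hγ.differentiable (by simp))]
  by_cases h : deriv χ t = 0
  · simpa [h] using ht
  · exact hv t h


variable {n : ℕ}

theorem markParam_sep {i j : Fin (2 * n + 1)} {k : ℤ}
    (h : |markParam n i - markParam n j - k| < 1 / (2 * n + 1 : ℕ)) : i = j := by
  have hN : (0 : ℝ) < (2 * n + 1 : ℕ) := by positivity
  have e : (markParam n i - markParam n j - k) * (2 * n + 1 : ℕ) =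
      ((i - j - k * (2 * n + 1 : ℕ) : ℤ) : ℝ) := by
    simp only [markParam]
    push_cast
    field_simp
  have h' : |(markParam n i - markParam n j - k) * (2 * n + 1 : ℕ)| < 1 := by
    rwa [abs_mul, abs_of_pos hN, ← lt_div_iff₀ hN]
  rw [e, ← Int.cast_abs] at h'
  have h' : |(i - j - k * (2 * n + 1 : ℕ) : ℤ)| < 1 := by exact_mod_cast h'
  have h0 := Int.abs_lt_one_iff.mp h'
  refine markParam_samePoint ⟨k, ?_⟩
  have e2 : (markParam n i - markParam n j - k) * (2 * n + 1 : ℕ) = 0 := by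
    rw [e, h0]; simp
  have := (mul_eq_zero.mp e2).resolve_right hN.ne'
  linarith

/-- A closed curve with the prescribed germs. -/
theorem exists_closedCurve_hasNormalGerms (w : GaussCode n) :
    ∃ γ, ClosedCurve γ ∧ HasNormalGerms w 1 (1 / (8 * (2 * n + 1 : ℕ))) γ := by
  have hN : (1 : ℝ) ≤ (2 * n + 1 : ℕ) := by exact_mod_cast Nat.le_add_left 1 (2 * n)
  set N : ℝ := ((2 * n + 1 : ℕ) : ℝ) with hNdef
  have hN0 : 0 < N := by linarith
  have h4 : 1 / (4 * N) ≤ 1 / 4 := one_div_le_one_div_of_le (by norm_num) (by linarith)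
  have h84 : 1 / (4 * N) = 2 * (1 / (8 * N)) := by field_simp; norm_num
  have h1N : 1 / N = 8 * (1 / (8 * N)) := by field_simp
  have h8 : 0 < 1 / (8 * N) := by positivity
  obtain ⟨B, hB, hBp, hB1, hB0⟩ := exists_periodic_plateau h8.le
    (s := 1 / (4 * N)) (by linarith) (by linarith)
  have hS := contDiff_plateau_mul (by linarith) hB hB0
  have hround : ∀ t : ℝ, t + 1 - (round (t + 1) : ℤ) = t - (round t : ℤ) := fun t => by
    rw [round_add_one]; push_cast; ring
  -- `T i` carries the germ at the `i`-th mark. Marks are at least `1 / N` apart and `1 / (8N) + 1 /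
  -- (4N) < 1 / N`, so the other summands vanish near it. The inner factor `B u` only serves
  -- smoothness.
  let T : Fin (2 * n + 1) → ℝ → Plane := fun i u => B u • (diagPoint (w.markLabel i) +
    (B u * (u - round u)) • sideDir (w.markSide i))
  have hT : ∀ i, ContDiff ℝ ∞ (T i) := fun i =>
    hB.smul (contDiff_const.add (hS.smul contDiff_const))
  have hTp : ∀ i u, T i (u + 1) = T i u := fun i u => by simp only [T, hround, hBp u]
  refine ⟨fun t => ∑ i, T i (t - markParam n i), ⟨?_, ?_⟩, ?_⟩
  · exact ContDiff.sum fun i _ => (hT i).comp (contDiff_id.sub contDiff_const)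
  · intro t
    refine Finset.sum_congr rfl fun i _ => ?_
    rw [add_sub_right_comm, hTp]
  · intro i x hx
    have hx' : |x| < 1 / 8 :=
      hx.trans_le (one_div_le_one_div_of_le (by norm_num) (by linarith))
    have hrx : round x = 0 := by
      rw [abs_lt] at hx'
      rw [round_eq, Int.floor_eq_iff]
      push_cast
      constructor <;> linarith
    beta_reduce
    rw [Finset.sum_eq_single i]
    · rw [add_sub_cancel_left]
      simp only [T]
      rw [hB1 x (by rw [hrx]; simpa using hx.le), hrx]
      simp
    · intro j _ hj
      simp only [T]
      rw [hB0, zero_smul]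
      by_contra hlt
      push Not at hlt
      set k := round (markParam n i + x - markParam n j)
      refine hj (markParam_sep (k := k) ?_).symm
      have h1 := abs_sub (markParam n i + x - markParam n j - k) x
      have e : markParam n i + x - markParam n j - k - x = markParam n i - markParam n j - k := by
        ring
      rw [e] at h1
      rw [← hNdef]
      linarith
    · intro h
      exact absurd (Finset.mem_univ i) h

theorem sideDir_ne_zero (s : Side) : sideDir s ≠ 0 := by
  intro h
  cases s
  · have := congrArg (fun p : Plane => p 0) h
    simp [sideDir] at this
  · have := congrArg (fun p : Plane => p 1) h
    simp [sideDir] at this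

/-- Near the marks, a curve in normal form is generic. -/
theorem HasNormalGerms.genericOn {w : GaussCode n} {ε η : ℝ} {γ : ℝ → Plane}
    (hγ : Function.Periodic γ 1) (h : HasNormalGerms w 1 ε γ) (hε : ε ≤ 1 / 8) (hη : η ≤ ε) :
    GenericOn γ (nearMarks (2 * n + 1) η) := by
  have hdata : ∀ t ∈ nearMarks (2 * n + 1) η, ∃ i x, SamePoint t (markParam n i + x) ∧
      |x| < 1 / 8 ∧ γ t = diagPoint (w.markLabel i) + x • sideDir (w.markSide i) ∧
      deriv γ t = sideDir (w.markSide i) := by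
    intro t ht
    obtain ⟨i, x, hx, htx⟩ := exists_mark_of_mem_nearMarks ht
    refine ⟨i, x, htx, by linarith, ?_, ?_⟩
    · rw [hγ.eq_of_samePoint htx, h i x (by linarith), one_mul]
    · rw [hγ.deriv.eq_of_samePoint htx, (h.hasDerivAt i (by linarith)).deriv, one_smul]
  -- Germs stay within `1/8` of their marked points, so germs that meet have the same label. If the
  -- sides agree as well, they are the same germ, which is injective.
  have hcoord : ∀ (j : ℕ) (s : Side) (x : ℝ), |x| < 1 / 8 → ∀ c : Fin 2,
      |(diagPoint j + x • sideDir s) c - j| < 1 / 8 := by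
    intro j s x hx c
    cases s <;> fin_cases c <;> simp [diagPoint, sideDir] <;> simpa using hx
  have hlab : ∀ (i j : ℕ) (s s' : Side) (x y : ℝ), |x| < 1 / 8 → |y| < 1 / 8 →
      diagPoint i + x • sideDir s = diagPoint j + y • sideDir s' → i = j := by
    intro i j s s' x y hx hy he
    have h1 := abs_lt.mp (hcoord i s x hx 0)
    have h2 := abs_lt.mp (hcoord j s' y hy 0)
    rw [he] at h1
    have h3 : (i : ℝ) < j + 1 := by linarith
    have h4 : (j : ℝ) < i + 1 := by linarith
    have h3' : i < j + 1 := by exact_mod_cast h3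
    have h4' : j < i + 1 := by exact_mod_cast h4
    omega
  have hsame : ∀ s t i j x y, SamePoint s (markParam n i + x) → SamePoint t (markParam n j + y) →
      |x| < 1 / 8 → |y| < 1 / 8 →
      diagPoint (w.markLabel i) + x • sideDir (w.markSide i) =
        diagPoint (w.markLabel j) + y • sideDir (w.markSide j) →
      w.markSide i = w.markSide j → SamePoint s t := by
    intro s t i j x y hs ht hx hy he hside
    have hl := hlab _ _ _ _ x y hx hy he
    have hij := w.mark_injective hl hside
    subst hij
    have : x = y := smul_left_injective ℝ (sideDir_ne_zero _) (add_left_cancel he)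
    subst this
    exact hs.trans ht.symm
  refine ⟨fun s hs t ht hst hn => ?_, fun s hs t ht u hu hst htu => ?_⟩
  · obtain ⟨i, x, his, hx, hi1, hi2⟩ := hdata s hs
    obtain ⟨j, y, hjt, hy, hj1, hj2⟩ := hdata t ht
    rw [hi2, hj2]
    have hside : w.markSide i ≠ w.markSide j := fun hside =>
      hn (hsame s t i j x y his hjt hx hy (by rw [← hi1, ← hj1, hst]) hside)
    revert hside
    cases w.markSide i <;> cases w.markSide j <;> intro hside
    · exact absurd rfl hside
    · rw [cross_sideDir]; norm_num
    · rw [cross_swap, cross_sideDir]; norm_num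
    · exact absurd rfl hside
  · obtain ⟨i, x, his, hx, hi1, -⟩ := hdata s hs
    obtain ⟨j, y, hjt, hy, hj1, -⟩ := hdata t ht
    obtain ⟨k, z, hku, hz, hk1, -⟩ := hdata u hu
    by_cases h1 : w.markSide i = w.markSide j
    · exact Or.inl (hsame s t i j x y his hjt hx hy (by rw [← hi1, ← hj1, hst]) h1)
    by_cases h2 : w.markSide j = w.markSide k
    · exact Or.inr (Or.inl (hsame t u j k y z hjt hku hy hz (by rw [← hj1, ← hk1, htu]) h2))
    · exact Or.inr (Or.inr (hsame s u i k x z his hku hx hz (by rw [← hi1, ← hk1, hst, htu])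
        (Side.eq_of_ne h1 h2)))

/-- A closed curve can be made immersed without changing it near the marks. -/
theorem exists_immersed_hasNormalGerms (w : GaussCode n) :
    ∃ ε > 0, ε ≤ 1 / 8 ∧ ∃ γ, ClosedCurve γ ∧ (∀ t, deriv γ t ≠ 0) ∧ HasNormalGerms w 1 ε γ := by
  obtain ⟨γ, hγ, hgerm⟩ := exists_closedCurve_hasNormalGerms w
  have hN : (1 : ℝ) ≤ (2 * n + 1 : ℕ) := by exact_mod_cast Nat.le_add_left 1 (2 * n)
  obtain ⟨m, hm, hmp, hm0, hms⟩ := exists_periodic_gap (2 * n + 1) 0 (r := 1 / 16) (by norm_num)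
    (by norm_num)
  simp only [sub_zero] at hms
  set N : ℝ := ((2 * n + 1 : ℕ) : ℝ) with hNdef
  have hN0 : 0 < N := by linarith
  have h16 : 1 / (8 * N) = 2 * (1 / (16 * N)) := by field_simp; norm_num
  have h16' : 0 < 1 / (16 * N) := by positivity
  have hmd : Differentiable ℝ m := hm.differentiable (by simp)
  -- A perturbation along one periodic function fails at its critical points, so three are used:
  -- `m`, `f` and `g`. Where `m ≠ 0` their derivatives do not vanish simultaneously, since sine and
  -- cosine do not. Where `m = 0`, within `1 / (16N)` of a mark, the curve is straight and already
  -- immersed.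
  let f : ℝ → ℝ := fun t => m t * Real.sin (2 * Real.pi * t)
  let g : ℝ → ℝ := fun t => m t * Real.cos (2 * Real.pi * t)
  have hf : ContDiff ℝ ∞ f := hm.mul (by fun_prop)
  have hg : ContDiff ℝ ∞ g := hm.mul (by fun_prop)
  have hfp : ∀ t, f (t + 1) = f t := fun t => by
    simp only [f, hmp t, mul_add, mul_one, Real.sin_add_two_pi]
  have hgp : ∀ t, g (t + 1) = g t := fun t => by
    simp only [g, hmp t, mul_add, mul_one, Real.cos_add_two_pi]
  have hmz : ∀ (i : Fin (2 * n + 1)) (x : ℝ), |x| < 1 / (16 * N) → m (markParam n i + x) = 0 := by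
    intro i x hx
    by_contra h
    have h1 := lt_abs_sub_round_iff.mp ((hms _).mp h) i
    have e : N * (markParam n i + x) - ((i : ℕ) : ℤ) = N * x := by
      simp only [markParam, ← hNdef]
      push_cast
      field_simp
      ring
    rw [e, abs_mul, abs_of_pos hN0] at h1
    have := mul_lt_mul_of_pos_left hx hN0
    rw [show N * (1 / (16 * N)) = 1 / 16 by field_simp] at this
    linarith
  obtain ⟨v₁, h1⟩ := exists_immersed_perturbation hm hγ.smooth
  have s1 : ContDiff ℝ ∞ (fun t => γ t + m t • v₁) := hγ.smooth.add (hm.smul contDiff_const)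
  obtain ⟨v₂, h2⟩ := exists_immersed_perturbation hf s1
  have s2 : ContDiff ℝ ∞ (fun t => (γ t + m t • v₁) + f t • v₂) := s1.add (hf.smul contDiff_const)
  obtain ⟨v₃, h3⟩ := exists_immersed_perturbation hg s2
  have s3 : ContDiff ℝ ∞ (fun t => ((γ t + m t • v₁) + f t • v₂) + g t • v₃) :=
    s2.add (hg.smul contDiff_const)
  refine ⟨1 / (16 * N), h16', ?_, _, ⟨s3, fun t => ?_⟩, fun t => ?_, fun i x hx => ?_⟩
  · exact one_div_le_one_div_of_le (by norm_num) (by linarith)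
  · simp only [hγ.periodic t, hmp t, hfp, hgp]
  · apply h3
    by_cases hmt : m t = 0
    · right; apply h2; right; apply h1; right
      have hnear : t ∈ nearMarks (2 * n + 1) (1 / (8 * N)) := by
        refine ⟨round (N * t), ?_⟩
        have := not_lt.mp ((hms t).not.mp (not_not.mpr hmt))
        have e : N * t - round (N * t) = N * (t - round (N * t) / N) := by field_simp
        rw [e, abs_mul, abs_of_pos hN0, mul_comm, ← le_div_iff₀ hN0] at this
        rw [← hNdef]
        have e2 : (1 / 16) / N = 1 / (16 * N) := by field_simp
        linarith
      obtain ⟨i, x, hx, htx⟩ := exists_mark_of_mem_nearMarks hnear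
      rw [hγ.periodic.deriv.eq_of_samePoint htx, (hgerm.hasDerivAt i hx).deriv, one_smul]
      exact sideDir_ne_zero _
    · by_cases hm' : deriv m t = 0
      · have hlin : HasDerivAt (fun t : ℝ => 2 * Real.pi * t) (2 * Real.pi) t := by
          simpa using (hasDerivAt_id t).const_mul (2 * Real.pi)
        have hf' : deriv f t = m t * (Real.cos (2 * Real.pi * t) * (2 * Real.pi)) := by
          have := ((hmd t).hasDerivAt.mul hlin.sin).deriv
          rw [hm', zero_mul, zero_add] at this
          exact this
        have hg' : deriv g t = m t * (-Real.sin (2 * Real.pi * t) * (2 * Real.pi)) := by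
          have := ((hmd t).hasDerivAt.mul hlin.cos).deriv
          rw [hm', zero_mul, zero_add] at this
          exact this
        by_cases hc : Real.cos (2 * Real.pi * t) = 0
        · left
          rw [hg']
          have hs : Real.sin (2 * Real.pi * t) ≠ 0 := by
            intro hs
            have := Real.sin_sq_add_cos_sq (2 * Real.pi * t)
            rw [hs, hc] at this
            norm_num at this
          exact mul_ne_zero hmt (mul_ne_zero (neg_ne_zero.mpr hs) Real.two_pi_pos.ne')
        · right; apply h2; left
          rw [hf']
          exact mul_ne_zero hmt (mul_ne_zero hc Real.two_pi_pos.ne')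
      · right; apply h2; right; apply h1; left
        exact hm'
  · simp only [f, g, hmz i x hx, zero_mul, zero_smul, add_zero]
    exact hgerm i x (by linarith)

open VirtualDiagram in
/-- Every Gauss code is realized by a diagram in normal form. -/
theorem exists_isNormal (w : GaussCode n) :
    ∃ (D : VirtualDiagram) (ε : ℝ), 0 < ε ∧ IsNormal w 1 ε D := by
  obtain ⟨ε, hε, hε8, γ, hγ, him, hgerm⟩ := exists_immersed_hasNormalGerms w
  -- The pieces cover all parameters outside the germs of radius `ε`, which are generic already, and
  -- leave the germs of radius `ε / 2` untouched.
  obtain ⟨P, hPfin, hP, hcov⟩ := exists_pieces hγ him (N := 2 * n + 1) (by omega) hε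
  obtain ⟨γ', h1, h2, h3, h4⟩ := exists_generic_curve hγ him hPfin
    (fun p hp => ⟨(hP p hp).1, (hP p hp).2.1⟩) (hgerm.genericOn hγ.periodic hε8 le_rfl)
  have hgerm' : HasNormalGerms w 1 (ε / 2) γ' := by
    intro i x hx
    rw [(h4 _ _).1, hgerm i x (by linarith)]
    rintro ⟨p, hp, k, hk⟩
    refine (hP p hp).2.2 _ (Set.Ioo_subset_Icc_self hk) (add_int_mem_nearMarks (by omega) k ⟨i, ?_⟩)
    simpa [markParam] using hx
  have hall : nearMarks (2 * n + 1) ε ∪ coveredSet P = Set.univ := by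
    rw [Set.eq_univ_iff_forall]
    intro t
    by_cases ht : t ∈ nearMarks (2 * n + 1) ε
    · exact Or.inl ht
    · exact Or.inr (hcov t ht)
  rw [hall] at h3
  have hmark : ∀ i, γ' (markParam n i) = diagPoint (w.markLabel i) := fun i => by
    simpa using hgerm' i 0 (by simpa using hε)
  refine ⟨ofGeneric h1 h2 h3 (Finset.univ.image fun j : Fin n => diagPoint j) ?_, ε / 2,
    by positivity, hgerm', by simp [ofGeneric]⟩
  intro p hp
  obtain ⟨j, -, rfl⟩ := Finset.mem_image.mp hp
  obtain ⟨i, hi⟩ := w.exists_mark j .L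
  obtain ⟨i', hi'⟩ := w.exists_mark j .R
  refine ⟨markParam n i.succ, markParam n i'.succ, fun h => ?_, ?_, ?_⟩
  · have := Fin.succ_injective _ (markParam_samePoint h)
    rw [this, hi'] at hi
    simp at hi
  · rw [hmark]; simp [GaussCode.markLabel, hi]
  · rw [hmark]; simp [GaussCode.markLabel, hi']

end Existence

/-! ### Diffeomorphisms of the line and functions with given germs -/

section RealLine

theorem exists_smooth_inverse {F : ℝ → ℝ} (hF : ContDiff ℝ ∞ F) (hF' : ∀ t, 0 < deriv F t)
    (hs : Function.Surjective F) :
    ∃ G : ℝ → ℝ, ContDiff ℝ ∞ G ∧ (∀ x, F (G x) = x) ∧ (∀ t, G (F t) = t) ∧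
      ∀ x, 0 < deriv G x := by
  have hd := hF.differentiable (by simp)
  let e : ℝ ≃ₜ ℝ := ((strictMono_of_deriv_pos hF').orderIsoOfSurjective F hs).toHomeomorph
  have he : ∀ t, e t = F t := fun _ => rfl
  have hG : ContDiff ℝ ∞ e.symm :=
    e.contDiff_symm_deriv (f' := deriv F) (fun x => (hF' x).ne') (fun x => (hd x).hasDerivAt) hF
  have h1 : ∀ x, F (e.symm x) = x := fun x => e.apply_symm_apply x
  refine ⟨e.symm, hG, h1, fun t => e.symm_apply_apply t, fun x => ?_⟩
  have hc := ((hd (e.symm x)).hasDerivAt.comp x (hG.differentiable (by simp) x).hasDerivAt)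
  have hid : F ∘ e.symm = id := funext h1
  rw [hid] at hc
  have := hc.unique (hasDerivAt_id x)
  by_contra hn
  have h2 := mul_nonpos_of_nonneg_of_nonpos (hF' (e.symm x)).le (not_lt.mp hn)
  linarith

theorem contDiff_integral {f : ℝ → ℝ} (hf : ContDiff ℝ ∞ f) (a : ℝ) :
    ContDiff ℝ ∞ (fun t => ∫ s in a..t, f s) := by
  rw [show (∞ : WithTop ℕ∞) = ((⊤ : ℕ∞) : WithTop ℕ∞) from rfl, contDiff_infty_iff_deriv]
  refine ⟨fun t => (hf.continuous.integral_hasStrictDerivAt a t).hasDerivAt.differentiableAt, ?_⟩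
  rwa [show deriv (fun t => ∫ s in a..t, f s) = f from
    funext fun t => hf.continuous.deriv_integral f a t]

/-- A germ of a local diffeomorphism of the line extends to a diffeomorphism. -/
theorem exists_diffeo_of_germ {f : ℝ → ℝ} (hf : ContDiff ℝ ∞ f) {a : ℝ} (ha : 0 < deriv f a) :
    ∃ F : ℝ → ℝ, ContDiff ℝ ∞ F ∧ (∀ t, 0 < deriv F t) ∧ Function.Surjective F ∧
      F =ᶠ[𝓝 a] f := by
  have hc : Continuous (deriv f) := hf.continuous_deriv_infty
  have hd := hf.differentiable (by simp)
  obtain ⟨r, hr, hr'⟩ := Metric.eventually_nhds_iff.mp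
    (continuousAt_const.eventually_lt hc.continuousAt (half_lt_self ha))
  let b : ContDiffBump a := ⟨r / 2, r, by positivity, by linarith⟩
  -- The derivative is interpolated instead of `f`: a convex combination of `deriv f` and 1 stays
  -- above a positive `c`. Its integral is then strictly increasing and onto.
  let ρ : ℝ → ℝ := fun t => b t * deriv f t + (1 - b t)
  have hρ : ContDiff ℝ ∞ ρ := (b.contDiff.mul (hf.iterate_deriv 1)).add
    (contDiff_const.sub b.contDiff)
  set c := min 1 (deriv f a / 2) with hcdef
  have hcpos : 0 < c := by positivity
  have hρc : ∀ t, c ≤ ρ t := by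
    intro t
    have h0 := b.nonneg (x := t)
    have h1 := b.le_one (x := t)
    rcases lt_or_ge (dist t a) r with h | h
    · have h2 := hr' h
      have h3 : c ≤ deriv f t := (min_le_right _ _).trans h2.le
      have h4 : c ≤ 1 := min_le_left _ _
      calc c = b t * c + (1 - b t) * c := by ring
        _ ≤ b t * deriv f t + (1 - b t) * 1 := by gcongr
        _ = ρ t := by simp [ρ]
    · have : b t = 0 := b.zero_of_le_dist h
      simp only [ρ, this]
      simp [hcdef]
  let F : ℝ → ℝ := fun t => f a + ∫ s in a..t, ρ s
  have hF : ContDiff ℝ ∞ F := contDiff_const.add (contDiff_integral hρ a)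
  have hFd : ∀ t, HasDerivAt F (ρ t) t := fun t =>
    (hρ.continuous.integral_hasStrictDerivAt a t).hasDerivAt.const_add _
  have hmono : Monotone fun t => F t - c * t := by
    refine monotone_of_deriv_nonneg ((hF.differentiable (by simp)).sub (by fun_prop)) fun t => ?_
    have : HasDerivAt (fun t => F t - c * t) (ρ t - c) t := by
      have h := (hFd t).sub ((hasDerivAt_id t).const_mul c)
      rw [mul_one] at h
      exact h
    rw [this.deriv]
    linarith [hρc t]
  refine ⟨F, hF, fun t => by rw [(hFd t).deriv]; exact hcpos.trans_le (hρc t), fun y => ?_, ?_⟩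
  · refine mem_range_of_exists_le_of_exists_ge hF.continuous ?_ ?_
    · refine ⟨min 0 ((y - F 0) / c), ?_⟩
      have h1 := hmono (min_le_left 0 ((y - F 0) / c))
      have h2 := mul_le_mul_of_nonneg_left (min_le_right 0 ((y - F 0) / c)) hcpos.le
      rw [mul_div_cancel₀ _ hcpos.ne'] at h2
      simp only [mul_zero, sub_zero] at h1
      linarith
    · refine ⟨max 0 ((y - F 0) / c), ?_⟩
      have h1 := hmono (le_max_left 0 ((y - F 0) / c))
      have h2 := mul_le_mul_of_nonneg_left (le_max_right 0 ((y - F 0) / c)) hcpos.le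
      rw [mul_div_cancel₀ _ hcpos.ne'] at h2
      simp only [mul_zero, sub_zero] at h1
      linarith
  · filter_upwards [Metric.ball_mem_nhds a (half_pos hr)] with t ht
    have : ∫ s in a..t, ρ s = ∫ s in a..t, deriv f s := by
      refine intervalIntegral.integral_congr fun s hs => ?_
      have hs' : s ∈ Metric.closedBall a (r / 2) := by
        have hconv := (convex_closedBall a (r / 2)).segment_subset
          (Metric.mem_closedBall_self (by positivity)) (Metric.ball_subset_closedBall ht)
        rw [segment_eq_uIcc] at hconv
        exact hconv hs
      simp [ρ, b.one_of_mem_closedBall hs']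
    simp only [F, this]
    rw [intervalIntegral.integral_deriv_eq_sub (fun s _ => hd s) (hc.intervalIntegrable _ _)]
    ring

/-- A plane curve is locally a graph where its first coordinate is increasing. -/
theorem exists_graph {x y : ℝ → ℝ} (hx : ContDiff ℝ ∞ x) (hy : ContDiff ℝ ∞ y) {a : ℝ}
    (ha : 0 < deriv x a) : ∃ h : ℝ → ℝ, ContDiff ℝ ∞ h ∧ ∀ᶠ t in 𝓝 a, h (x t) = y t := by
  -- Extending the germ of `x` to a diffeomorphism makes `y ∘ x⁻¹` a smooth function on the whole
  -- line.
  obtain ⟨F, hF, hF', hs, hFx⟩ := exists_diffeo_of_germ hx ha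
  obtain ⟨G, hG, -, hGF, -⟩ := exists_smooth_inverse hF hF' hs
  refine ⟨y ∘ G, hy.comp hG, ?_⟩
  filter_upwards [hFx] with t ht
  rw [Function.comp_apply, ← ht, hGF]

/-- Smooth functions with prescribed germs at finitely many points. -/
theorem exists_smooth_of_germs {ι : Type*} [Finite ι] {x : ι → ℝ} (hx : Function.Injective x)
    {h : ι → ℝ → ℝ} (hh : ∀ i, ContDiff ℝ ∞ (h i)) :
    ∃ g : ℝ → ℝ, ContDiff ℝ ∞ g ∧ ∀ i, g =ᶠ[𝓝 (x i)] h i := by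
  cases nonempty_fintype ι
  have hr : ∀ᶠ r in 𝓝[>] (0 : ℝ), 0 < r ∧ ∀ i j, i ≠ j → 2 * r < |x i - x j| := by
    refine eventually_mem_nhdsWithin.and ?_
    rw [Filter.eventually_all]
    intro i
    rw [Filter.eventually_all]
    intro j
    by_cases hij : i = j
    · exact Filter.Eventually.of_forall fun r h => absurd hij h
    · have h0 : 2 * (0 : ℝ) < |x i - x j| := by
        rw [mul_zero, abs_pos, sub_ne_zero]
        exact fun h => hij (hx h)
      have hc : ContinuousAt (fun r : ℝ => 2 * r) 0 := by fun_prop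
      exact ((hc.eventually_lt continuousAt_const h0).filter_mono nhdsWithin_le_nhds).mono
        fun r hr _ => hr
  obtain ⟨r, hr, hsep⟩ := hr.exists
  let b : ∀ i, ContDiffBump (x i) := fun i => ⟨r / 2, r, by positivity, by linarith⟩
  refine ⟨fun t => ∑ i, b i t * h i t, ContDiff.sum fun i _ => (b i).contDiff.mul (hh i),
    fun i => ?_⟩
  filter_upwards [Metric.ball_mem_nhds (x i) (half_pos hr)] with t ht
  rw [Finset.sum_eq_single i]
  · rw [(b i).one_of_mem_closedBall (Metric.ball_subset_closedBall ht), one_mul]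
  · intro j _ hji
    rw [(b j).zero_of_le_dist, zero_mul]
    have h1 := hsep i j hji.symm
    rw [← Real.dist_eq] at h1
    have h2 := dist_triangle (x i) t (x j)
    rw [Metric.mem_ball, dist_comm] at ht
    change r ≤ dist t (x j)
    linarith
  · intro hi
    exact absurd (Finset.mem_univ i) hi

end RealLine

/-! ### Shears of the plane -/

section Shear

/-- The shear that fixes the coordinate `c` and adds a function of it to the other one. -/
noncomputable def shear (c : Fin 2) (g : ℝ → ℝ) (x : Plane) : Plane :=
  x + g (x c) • EuclideanSpace.single (1 - c) (1 : ℝ)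

theorem one_sub_ne (c : Fin 2) : 1 - c ≠ c := by
  fin_cases c <;> simp

@[simp] theorem shear_apply_self (c : Fin 2) (g : ℝ → ℝ) (x : Plane) : shear c g x c = x c := by
  simp [shear, (one_sub_ne c).symm]

theorem shear_apply_other (c : Fin 2) (g : ℝ → ℝ) (x : Plane) :
    shear c g x (1 - c) = x (1 - c) + g (x c) := by
  simp [shear]

theorem shear_neg_shear (c : Fin 2) (g : ℝ → ℝ) (x : Plane) :
    shear c (fun s => -g s) (shear c g x) = x := by
  rw [shear, shear_apply_self, shear]
  module

theorem shear_shear_neg (c : Fin 2) (g : ℝ → ℝ) (x : Plane) :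
    shear c g (shear c (fun s => -g s) x) = x := by
  rw [shear, shear_apply_self, shear]
  module

theorem shear_injective (c : Fin 2) (g : ℝ → ℝ) : Function.Injective (shear c g) :=
  Function.LeftInverse.injective (shear_neg_shear c g)

theorem contDiff_shear (c : Fin 2) {g : ℝ → ℝ} (hg : ContDiff ℝ ∞ g) :
    ContDiff ℝ ∞ (shear c g) := by
  have h : ContDiff ℝ ∞ fun x : Plane => x c := contDiff_euclidean.mp contDiff_id c
  exact contDiff_id.add ((hg.comp h).smul contDiff_const)

noncomputable def shearDiffeo (c : Fin 2) {g : ℝ → ℝ} (hg : ContDiff ℝ ∞ g) :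
    Plane ≃ₘ^∞⟮𝓘(ℝ, Plane), 𝓘(ℝ, Plane)⟯ Plane where
  toFun := shear c g
  invFun := shear c fun s => -g s
  left_inv := shear_neg_shear c g
  right_inv := shear_shear_neg c g
  contMDiff_toFun := (contDiff_shear c hg).contMDiff
  contMDiff_invFun := (contDiff_shear c hg.neg).contMDiff

theorem hasDerivAt_coord {γ : ℝ → Plane} (hγ : Differentiable ℝ γ) (c : Fin 2) (t : ℝ) :
    HasDerivAt (fun t => γ t c) (deriv γ t c) t := by
  exact ((EuclideanSpace.proj c : Plane →L[ℝ] ℝ).hasFDerivAt.comp_hasDerivAt t (hγ t).hasDerivAt)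

theorem deriv_shear_comp {γ : ℝ → Plane} (hγ : Differentiable ℝ γ) (c : Fin 2) {g : ℝ → ℝ}
    (hg : Differentiable ℝ g) (t : ℝ) :
    deriv (fun t => shear c g (γ t)) t = deriv γ t +
      (deriv g (γ t c) * deriv γ t c) • EuclideanSpace.single (1 - c) (1 : ℝ) := by
  have h1 := (hg (γ t c)).hasDerivAt.comp t (hasDerivAt_coord hγ c t)
  exact ((hγ t).hasDerivAt.add (h1.smul_const _)).deriv

/-- The derivative of a shear has determinant 1, so crossings keep their signs. -/
theorem cross_shear (c : Fin 2) (α : ℝ) (u v : Plane) :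
    cross (u + (α * u c) • EuclideanSpace.single (1 - c) (1 : ℝ))
      (v + (α * v c) • EuclideanSpace.single (1 - c) (1 : ℝ)) = cross u v := by
  fin_cases c
  · simp [cross]; ring
  · simp [cross]; ring

theorem ContDiff.curve_coord {γ : ℝ → Plane} (hγ : ContDiff ℝ ∞ γ) (c : Fin 2) :
    ContDiff ℝ ∞ (fun t => γ t c) := contDiff_euclidean.mp hγ c

namespace VirtualDiagram

/-- The image of a diagram under a shear. -/
noncomputable def shear (D : VirtualDiagram) (c : Fin 2) {g : ℝ → ℝ} (hg : ContDiff ℝ ∞ g) :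
    VirtualDiagram where
  curve t := _root_.shear c g (D.curve t)
  smooth := (contDiff_shear c hg).comp D.smooth
  periodic t := by rw [D.periodic]
  immersed t := by
    rw [deriv_shear_comp D.closedCurve.differentiable c (hg.differentiable (by simp))]
    intro h
    refine D.immersed t ?_
    have hc := congrArg (fun v : Plane => v c) h
    simp [(one_sub_ne c).symm] at hc
    rwa [hc, mul_zero, zero_smul, add_zero] at h
  transverse s t h hst := by
    have h' := shear_injective c g h
    rw [deriv_shear_comp D.closedCurve.differentiable c (hg.differentiable (by simp)),
      deriv_shear_comp D.closedCurve.differentiable c (hg.differentiable (by simp)), h',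
      cross_shear]
    exact D.transverse s t h' hst
  double s t u hst htu := D.double s t u (shear_injective c g hst) (shear_injective c g htu)
  real := D.real.map ⟨_root_.shear c g, shear_injective c g⟩
  real_crossing p hp := by
    obtain ⟨q, hq, rfl⟩ := Finset.mem_map.mp hp
    obtain ⟨s, t, hst, hs, ht⟩ := D.real_crossing q hq
    exact ⟨s, t, hst, by rw [hs]; rfl, by rw [ht]; rfl⟩

/-- The shears by `t * g` run from the identity to the given shear. -/
theorem isotopic_shear (D : VirtualDiagram) (c : Fin 2) {g : ℝ → ℝ} (hg : ContDiff ℝ ∞ g) :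
    Isotopic D (D.shear c hg) := by
  refine ⟨fun t => _root_.shear c fun s => t * g s, ?_, fun t _ => ⟨shearDiffeo c
    (contDiff_const.mul hg), fun x => rfl⟩, fun x => ?_, fun t => ?_, ?_⟩
  · have h : ContDiff ℝ ∞ fun p : ℝ × Plane => p.2 c := contDiff_euclidean.mp contDiff_snd c
    exact contDiff_snd.add ((contDiff_fst.mul (hg.comp h)).smul contDiff_const)
  · simp [_root_.shear]
  · simp [shear]
  · simp [shear]

theorem strictEquiv_shear (D : VirtualDiagram) (c : Fin 2) {g : ℝ → ℝ} (hg : ContDiff ℝ ∞ g) :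
    StrictEquiv D (D.shear c hg) :=
  .rel _ _ (Or.inr (Or.inl (D.isotopic_shear c hg)))

end VirtualDiagram

end Shear

/-! ### Straightening the branches at the marks by shears -/

section Straightening

variable {n : ℕ}

/-- `μ` lists the parameters of a base point and of the real crossings of `D`, in the order
given by the Gauss code `w`. -/
structure HasMarks (w : GaussCode n) (D : VirtualDiagram) (μ : Fin (2 * n + 1) → ℝ) : Prop where
  strictMono : StrictMono μ
  lt_add_one : ∀ i, μ i < μ 0 + 1
  eq_iff : ∀ i j, D.curve (μ i) = D.curve (μ j) ↔ w.markLabel i = w.markLabel j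
  real_eq : (D.real : Set Plane) = Set.range fun i : Fin (2 * n) => D.curve (μ i.succ)
  cross_neg : ∀ i j, w.markLabel i = w.markLabel j → w.markSide i = .L → w.markSide j = .R →
    cross (deriv D.curve (μ i)) (deriv D.curve (μ j)) < 0

theorem HasMarks.shear {w : GaussCode n} {D : VirtualDiagram} {μ : Fin (2 * n + 1) → ℝ}
    (h : HasMarks w D μ) (c : Fin 2) {g : ℝ → ℝ} (hg : ContDiff ℝ ∞ g) :
    HasMarks w (D.shear c hg) μ where
  strictMono := h.strictMono
  lt_add_one := h.lt_add_one
  eq_iff i j := by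
    rw [← h.eq_iff]
    exact (shear_injective c g).eq_iff
  real_eq := by
    simp only [VirtualDiagram.shear, Finset.coe_map, Function.Embedding.coeFn_mk, h.real_eq,
      ← Set.range_comp]
    rfl
  cross_neg i j hij hi hj := by
    have e : D.curve (μ i) = D.curve (μ j) := (h.eq_iff i j).mpr hij
    simp only [VirtualDiagram.shear]
    rw [deriv_shear_comp D.closedCurve.differentiable c (hg.differentiable (by simp)),
      deriv_shear_comp D.closedCurve.differentiable c (hg.differentiable (by simp)), e,
      cross_shear]
    exact h.cross_neg i j hij hi hj

theorem GaussCode.exists_left_mark (w : GaussCode n) (i : Fin (2 * n + 1)) :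
    ∃ j, w.markLabel j = w.markLabel i ∧ w.markSide j = .L := by
  induction i using Fin.cases with
  | zero => exact ⟨0, rfl, rfl⟩
  | succ i =>
    obtain ⟨j, hj⟩ := w.exists_mark (w.seq i).1 .L
    exact ⟨j.succ, by simp [markLabel, hj], by simp [markSide, hj]⟩

open VirtualDiagram

/-- The coordinate `c` distinguishes the marked points. -/
def SeparatesMarks (w : GaussCode n) (D : VirtualDiagram) (μ : Fin (2 * n + 1) → ℝ) (c : Fin 2) :
    Prop :=
  ∀ i j, D.curve (μ i) c = D.curve (μ j) c → w.markLabel i = w.markLabel j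

/-- A linear shear does it: two distinct marked points get the same first coordinate for at most one
slope. -/
theorem HasMarks.exists_separatesMarks {w : GaussCode n} {D : VirtualDiagram}
    {μ : Fin (2 * n + 1) → ℝ} (h : HasMarks w D μ) :
    ∃ D', StrictEquiv D D' ∧ HasMarks w D' μ ∧ SeparatesMarks w D' μ 0 := by
  have hfin : (⋃ i, ⋃ j, {a : ℝ | w.markLabel i ≠ w.markLabel j ∧
      D.curve (μ i) 0 + a * D.curve (μ i) 1 = D.curve (μ j) 0 + a * D.curve (μ j) 1}).Finite := by
    refine Set.finite_iUnion fun i => Set.finite_iUnion fun j => Set.Subsingleton.finite ?_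
    rintro a ⟨hij, ha⟩ b ⟨-, hb⟩
    by_contra hab
    refine hij ((h.eq_iff i j).mp ?_)
    have h1 : (a - b) * (D.curve (μ i) 1 - D.curve (μ j) 1) = 0 := by linarith
    have h1' := (mul_eq_zero.mp h1).resolve_left (sub_ne_zero.mpr hab)
    have e1 : D.curve (μ i) 1 = D.curve (μ j) 1 := by linarith
    rw [e1] at ha
    ext c
    fin_cases c
    · simpa using ha
    · exact e1
  obtain ⟨a, ha⟩ := hfin.exists_notMem
  simp only [Set.mem_iUnion, not_exists] at ha
  have hg : ContDiff ℝ ∞ fun s : ℝ => a * s := by fun_prop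
  refine ⟨D.shear 1 hg, D.strictEquiv_shear 1 hg, h.shear 1 hg, fun i j hij => ?_⟩
  by_contra hne
  refine ha i j ⟨hne, ?_⟩
  have e : ∀ i, (D.shear 1 hg).curve (μ i) 0 = D.curve (μ i) 0 + a * D.curve (μ i) 1 :=
    fun i => shear_apply_other 1 _ _
  rw [← e, ← e, hij]

/-- A shear with prescribed `1`-jets at the marked points. -/
theorem HasMarks.exists_shear_jets {w : GaussCode n} {D : VirtualDiagram}
    {μ : Fin (2 * n + 1) → ℝ} (h : HasMarks w D μ) {c : Fin 2} (hc : SeparatesMarks w D μ c)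
    (α β : Fin (2 * n + 1) → ℝ) :
    ∃ D', StrictEquiv D D' ∧ HasMarks w D' μ ∧ (∀ i, D'.curve (μ i) c = D.curve (μ i) c) ∧
      ∀ i, w.markSide i = .L → D'.curve (μ i) (1 - c) = α i ∧
        deriv D'.curve (μ i) c = deriv D.curve (μ i) c ∧
        deriv D'.curve (μ i) (1 - c) = deriv D.curve (μ i) (1 - c) +
          β i * deriv D.curve (μ i) c := by
  have hinj : Function.Injective fun i : {i // w.markSide i = .L} => D.curve (μ i) c :=
    fun i j hij => Subtype.ext (w.mark_injective (hc i j hij) (i.2.trans j.2.symm))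
  -- Near the `c`-coordinate of each marked point, `g` is affine. Its value moves the other
  -- coordinate to `α i`, its slope is `β i`.
  obtain ⟨g, hg, hgi⟩ := exists_smooth_of_germs hinj
    (h := fun i s => (α i - D.curve (μ i) (1 - c)) + β i * (s - D.curve (μ i) c))
    (fun i => by fun_prop)
  refine ⟨D.shear c hg, D.strictEquiv_shear c hg, h.shear c hg,
    fun i => shear_apply_self c g _, fun i hi => ?_⟩
  have hgi' := hgi ⟨i, hi⟩
  have hd : deriv g (D.curve (μ i) c) = β i := by
    rw [hgi'.deriv_eq]
    have : HasDerivAt (fun s => (α i - D.curve (μ i) (1 - c)) + β i * (s - D.curve (μ i) c))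
        (β i * 1) (D.curve (μ i) c) :=
      (((hasDerivAt_id _).sub_const _).const_mul _).const_add _
    rw [this.deriv, mul_one]
  have hdc := deriv_shear_comp D.closedCurve.differentiable c (hg.differentiable (by simp)) (μ i)
  refine ⟨?_, ?_, ?_⟩
  · have := shear_apply_other c g (D.curve (μ i))
    rw [hgi'.eq_of_nhds] at this
    refine this.trans ?_
    simp
  · change deriv (fun t => _root_.shear c g (D.curve t)) (μ i) c = _
    rw [hdc]
    simp [(one_sub_ne c).symm]
  · change deriv (fun t => _root_.shear c g (D.curve t)) (μ i) (1 - c) = _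
    rw [hdc, hd]
    simp

/-- The marked points are in standard position, and the left branches move to the right. -/
theorem HasMarks.exists_positioned {w : GaussCode n} {D : VirtualDiagram}
    {μ : Fin (2 * n + 1) → ℝ} (h : HasMarks w D μ) :
    ∃ D', StrictEquiv D D' ∧ HasMarks w D' μ ∧
      (∀ i, D'.curve (μ i) = diagPoint (w.markLabel i)) ∧
      ∀ i, w.markSide i = .L → 0 < deriv D'.curve (μ i) 0 := by
  obtain ⟨D₁, e1, m1, s1⟩ := h.exists_separatesMarks
  -- The first shear has to leave a nonzero vertical velocity, for the second one to adjust the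
  -- horizontal velocity with.
  have hβ : ∀ i, ∃ β : ℝ, deriv D₁.curve (μ i) 1 + β * deriv D₁.curve (μ i) 0 ≠ 0 := by
    intro i
    by_cases h0 : deriv D₁.curve (μ i) 1 = 0
    · refine ⟨1, fun h1 => D₁.immersed (μ i) ?_⟩
      rw [h0, zero_add, one_mul] at h1
      ext c
      fin_cases c
      · exact h1
      · exact h0
    · exact ⟨0, by simpa using h0⟩
  choose β hβ using hβ
  obtain ⟨D₂, e2, m2, -, l2⟩ := m1.exists_shear_jets s1 (fun i => w.markLabel i) β
  have v2 : ∀ i, D₂.curve (μ i) 1 = w.markLabel i := by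
    intro i
    obtain ⟨j, hj, hjL⟩ := w.exists_left_mark i
    rw [(m2.eq_iff i j).mpr hj.symm, ← hj]
    exact (l2 j hjL).1
  have s2 : SeparatesMarks w D₂ μ 1 := by
    intro i j hij
    rw [v2, v2] at hij
    exact Nat.cast_injective hij
  -- The heights are the labels by now; this shear does the same for the abscissae. The slope solves
  -- `x' + β y' = 1`, so left branches get horizontal velocity 1.
  obtain ⟨D₃, e3, m3, c3, l3⟩ := m2.exists_shear_jets s2 (fun i => w.markLabel i)
    (fun i => (1 - deriv D₂.curve (μ i) 0) / deriv D₂.curve (μ i) 1)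
  refine ⟨D₃, (e1.trans _ _ _ e2).trans _ _ _ e3, m3, fun i => ?_, fun i hi => ?_⟩
  · obtain ⟨j, hj, hjL⟩ := w.exists_left_mark i
    rw [(m3.eq_iff i j).mpr hj.symm, ← hj]
    ext c
    fin_cases c
    · exact (l3 j hjL).1
    · exact (c3 j).trans (v2 j)
  · have h1 : deriv D₃.curve (μ i) 0 = _ := (l3 i hi).2.2
    have h2 : deriv D₂.curve (μ i) 1 = _ := (l2 i hi).2.2
    have h3 : deriv D₂.curve (μ i) 1 ≠ 0 := by rw [h2]; exact hβ i
    rw [h1, div_mul_cancel₀ _ h3]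
    simp

/-- The left branches are straightened. -/
theorem HasMarks.exists_left_straight {w : GaussCode n} {D : VirtualDiagram}
    {μ : Fin (2 * n + 1) → ℝ} (h : HasMarks w D μ)
    (hpos : ∀ i, D.curve (μ i) = diagPoint (w.markLabel i))
    (hL : ∀ i, w.markSide i = .L → 0 < deriv D.curve (μ i) 0) :
    ∃ D', StrictEquiv D D' ∧ HasMarks w D' μ ∧
      (∀ i, D'.curve (μ i) = diagPoint (w.markLabel i)) ∧
      ∀ i, w.markSide i = .L → 0 < deriv D'.curve (μ i) 0 ∧
        ∀ᶠ t in 𝓝 (μ i), D'.curve t 1 = w.markLabel i := by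
  have hx := D.smooth.curve_coord 0
  have hy := D.smooth.curve_coord 1
  -- A left branch is locally a graph over the horizontal axis, and a vertical shear flattens it.
  have hgr : ∀ i : {i // w.markSide i = .L}, ∃ h : ℝ → ℝ, ContDiff ℝ ∞ h ∧
      ∀ᶠ t in 𝓝 (μ i), h (D.curve t 0) = w.markLabel i - D.curve t 1 := fun i =>
    exists_graph hx (contDiff_const.sub hy) (by
      rw [(hasDerivAt_coord D.closedCurve.differentiable 0 _).deriv]; exact hL i i.2)
  choose f hf hf' using hgr
  have hinj : Function.Injective fun i : {i // w.markSide i = .L} => (w.markLabel i : ℝ) :=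
    fun i j hij => Subtype.ext (w.mark_injective (Nat.cast_injective (R := ℝ) hij) (i.2.trans j.2.symm))
  obtain ⟨g, hg, hgi⟩ := exists_smooth_of_germs hinj hf
  have hx0 : ∀ i, D.curve (μ i) 0 = w.markLabel i := fun i => by rw [hpos]; simp [diagPoint]
  have hst : ∀ i, w.markSide i = .L →
      ∀ᶠ t in 𝓝 (μ i), (D.shear 0 hg).curve t 1 = w.markLabel i := by
    intro i hi
    have hc : Tendsto (fun t => D.curve t 0) (𝓝 (μ i)) (𝓝 (w.markLabel i : ℝ)) := by
      rw [← hx0 i]; exact hx.continuous.continuousAt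
    filter_upwards [hf' ⟨i, hi⟩, hc.eventually (hgi ⟨i, hi⟩)] with t h1 h2
    have : (D.shear 0 hg).curve t 1 = D.curve t 1 + g (D.curve t 0) := shear_apply_other 0 g _
    rw [this, h2, h1]
    ring
  have m' := h.shear 0 hg
  refine ⟨D.shear 0 hg, D.strictEquiv_shear 0 hg, m', fun i => ?_, fun i hi => ⟨?_, hst i hi⟩⟩
  · obtain ⟨j, hj, hjL⟩ := w.exists_left_mark i
    rw [(m'.eq_iff i j).mpr hj.symm, ← hj]
    ext c
    fin_cases c
    · exact (shear_apply_self 0 g _).trans (hx0 j)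
    · exact (hst j hjL).self_of_nhds
  · have := deriv_shear_comp D.closedCurve.differentiable 0 (hg.differentiable (by simp)) (μ i)
    change 0 < deriv (fun t => _root_.shear 0 g (D.curve t)) (μ i) 0
    rw [this]
    simpa using hL i hi

/-- Near its marks, the curve is straight, with the standard positions and directions. -/
def StraightMarks (w : GaussCode n) (μ : Fin (2 * n + 1) → ℝ) (γ : ℝ → Plane) : Prop :=
  ∀ i, ∃ l : ℝ → ℝ, ContDiff ℝ ∞ l ∧ l (μ i) = 0 ∧ 0 < deriv l (μ i) ∧
    ∀ᶠ t in 𝓝 (μ i), γ t = diagPoint (w.markLabel i) + l t • sideDir (w.markSide i)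

theorem deriv_coord_eq_zero {γ : ℝ → Plane} (hγ : Differentiable ℝ γ) {c : Fin 2} {t a : ℝ}
    (h : ∀ᶠ s in 𝓝 t, γ s c = a) : deriv γ t c = 0 := by
  have h1 := hasDerivAt_coord hγ c t
  have h2 : (fun s => γ s c) =ᶠ[𝓝 t] fun _ => a := h
  rw [← h1.deriv, h2.deriv_eq, deriv_const]

/-- All branches at the real crossings are straightened. -/
theorem HasMarks.exists_straight {w : GaussCode n} {D : VirtualDiagram}
    {μ : Fin (2 * n + 1) → ℝ} (h : HasMarks w D μ) :
    ∃ D', StrictEquiv D D' ∧ HasMarks w D' μ ∧ StraightMarks w μ D'.curve := by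
  obtain ⟨D₁, e1, m1, p1, l1⟩ := h.exists_positioned
  obtain ⟨D₂, e2, m2, p2, l2⟩ := m1.exists_left_straight p1 l1
  have hx := D₂.smooth.curve_coord 0
  have hy := D₂.smooth.curve_coord 1
  -- The left branch runs horizontally to the right, so the sign of the crossing forces the right
  -- branch to go down.
  have hneg : ∀ {E : VirtualDiagram}, HasMarks w E μ →
      (∀ i, w.markSide i = .L → 0 < deriv E.curve (μ i) 0 ∧
        ∀ᶠ t in 𝓝 (μ i), E.curve t 1 = w.markLabel i) →
      ∀ j, w.markSide j = .R → deriv E.curve (μ j) 1 < 0 := by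
    intro E hE hl j hj
    obtain ⟨i, hi, hiL⟩ := w.exists_left_mark j
    have hcr := hE.cross_neg i j hi hiL hj
    rw [cross, deriv_coord_eq_zero E.closedCurve.differentiable (hl i hiL).2, zero_mul,
      sub_zero] at hcr
    by_contra hn
    exact absurd hcr (not_lt.mpr (mul_nonneg (hl i hiL).1.le (not_lt.mp hn)))
  -- The horizontal shear that makes right branches vertical vanishes at the heights of the marked
  -- points. Left branches have these constant heights near their marks and are not disturbed. The
  -- base point has no right branch, and `f = 0` serves there.
  have hgr : ∀ i : {i // w.markSide i = .L}, ∃ f : ℝ → ℝ, ContDiff ℝ ∞ f ∧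
      f (w.markLabel i) = 0 ∧ ∀ j, w.markLabel j = w.markLabel i → w.markSide j = .R →
        ∀ᶠ t in 𝓝 (μ j), f (D₂.curve t 1) = w.markLabel j - D₂.curve t 0 := by
    intro i
    by_cases hj : ∃ j, w.markLabel j = w.markLabel i ∧ w.markSide j = .R
    · obtain ⟨j, hj, hjR⟩ := hj
      obtain ⟨f, hf, hf'⟩ := exists_graph hy.neg (contDiff_const.sub hx :
        ContDiff ℝ ∞ fun t => (w.markLabel j : ℝ) - D₂.curve t 0) (a := μ j) (by
          rw [(hasDerivAt_coord D₂.closedCurve.differentiable 1 _).fun_neg.deriv]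
          exact neg_pos.mpr (hneg m2 l2 j hjR))
      refine ⟨fun s => f (-s), hf.comp contDiff_neg, ?_, fun k hk hkR => ?_⟩
      · have := hf'.self_of_nhds
        rw [p2 j, hj] at this
        simpa [diagPoint] using this
      · rw [w.mark_injective (hk.trans hj.symm) (hkR.trans hjR.symm)]
        exact hf'
    · push Not at hj
      exact ⟨fun _ => 0, contDiff_const, rfl, fun j h1 h2 => absurd h2 (hj j h1)⟩
  choose f hf hf0 hf' using hgr
  have hinj : Function.Injective fun i : {i // w.markSide i = .L} => (w.markLabel i : ℝ) :=
    fun i j hij => Subtype.ext (w.mark_injective (Nat.cast_injective (R := ℝ) hij) (i.2.trans j.2.symm))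
  obtain ⟨g, hg, hgi⟩ := exists_smooth_of_germs hinj hf
  have m3 := m2.shear 1 hg
  have c3 : ∀ t, (D₂.shear 1 hg).curve t 0 = D₂.curve t 0 + g (D₂.curve t 1) := fun t =>
    shear_apply_other 1 g _
  have c3' : ∀ t, (D₂.shear 1 hg).curve t 1 = D₂.curve t 1 := fun t => shear_apply_self 1 g _
  have hLnear : ∀ i, w.markSide i = .L →
      ∀ᶠ t in 𝓝 (μ i), (D₂.shear 1 hg).curve t = D₂.curve t := by
    intro i hi
    filter_upwards [(l2 i hi).2] with t ht
    ext c
    fin_cases c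
    · refine (c3 t).trans ?_
      rw [ht, (hgi ⟨i, hi⟩).eq_of_nhds, hf0, add_zero]
      rfl
    · exact c3' t
  have l3 : ∀ i, w.markSide i = .L → 0 < deriv (D₂.shear 1 hg).curve (μ i) 0 ∧
      ∀ᶠ t in 𝓝 (μ i), (D₂.shear 1 hg).curve t 1 = w.markLabel i := by
    intro i hi
    have hev : (D₂.shear 1 hg).curve =ᶠ[𝓝 (μ i)] D₂.curve := hLnear i hi
    rw [hev.deriv_eq]
    exact ⟨(l2 i hi).1, (l2 i hi).2.mono fun t ht => (c3' t).trans ht⟩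
  refine ⟨D₂.shear 1 hg, (e1.trans _ _ _ e2).trans _ _ _ (D₂.strictEquiv_shear 1 hg), m3,
    fun i => ?_⟩
  have hx3 := (D₂.shear 1 hg).smooth.curve_coord 0
  have hy3 := (D₂.shear 1 hg).smooth.curve_coord 1
  have hdiff := (D₂.shear 1 hg).closedCurve.differentiable
  rcases hs : w.markSide i with _ | _
  · refine ⟨fun t => (D₂.shear 1 hg).curve t 0 - w.markLabel i, hx3.sub contDiff_const, ?_, ?_, ?_⟩
    · beta_reduce
      rw [(hLnear i hs).self_of_nhds, p2]
      simp [diagPoint]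
    · rw [((hasDerivAt_coord hdiff 0 _).sub_const _).deriv]
      exact (l3 i hs).1
    · filter_upwards [(l3 i hs).2] with t ht
      ext c
      fin_cases c
      · simp [diagPoint, sideDir]
      · simpa [diagPoint, sideDir] using ht
  · refine ⟨fun t => w.markLabel i - (D₂.shear 1 hg).curve t 1, contDiff_const.sub hy3, ?_, ?_, ?_⟩
    · beta_reduce
      rw [c3', p2]
      simp [diagPoint]
    · rw [((hasDerivAt_coord hdiff 1 _).const_sub _).deriv]
      exact neg_pos.mpr (hneg m3 l3 i hs)
    · obtain ⟨j, hj, hjL⟩ := w.exists_left_mark i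
      have hc : Tendsto (fun t => D₂.curve t 1) (𝓝 (μ i)) (𝓝 (w.markLabel j : ℝ)) := by
        have e : D₂.curve (μ i) 1 = w.markLabel j := by rw [p2, hj]; simp [diagPoint]
        rw [← e]; exact hy.continuous.continuousAt
      filter_upwards [hf' ⟨j, hjL⟩ i hj.symm hs, hc.eventually (hgi ⟨j, hjL⟩)] with t h1 h2
      ext c
      fin_cases c
      · refine (c3 t).trans ?_
        rw [h2, h1]
        simp [diagPoint, sideDir]
      · simp [diagPoint, sideDir]

end Straightening

/-! ### Reparametrization to normal form -/

section Reparametrization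

variable {n : ℕ}

theorem map_add_int_of_map_add_one {F : ℝ → ℝ} (hF : ∀ t, F (t + 1) = F t + 1) (t : ℝ) (k : ℤ) :
    F (t + k) = F t + k := by
  have h : Function.Periodic (fun t => F t - t) 1 := fun t => by simp only [hF]; ring
  have := h.int_mul k t
  simp only [mul_one] at this
  linarith

theorem surjective_of_map_add_one {F : ℝ → ℝ} (hc : Continuous F)
    (hF : ∀ t, F (t + 1) = F t + 1) : Function.Surjective F := by
  intro y
  refine mem_range_of_exists_le_of_exists_ge hc ⟨(0 : ℝ) + ⌊y - F 0⌋, ?_⟩ ⟨(0 : ℝ) + ⌈y - F 0⌉, ?_⟩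
  · rw [map_add_int_of_map_add_one hF]
    linarith [Int.floor_le (y - F 0)]
  · rw [map_add_int_of_map_add_one hF]
    linarith [Int.le_ceil (y - F 0)]

namespace VirtualDiagram

/-- The diagram with another parametrization, given by a diffeomorphism `G` of the circle with
inverse `F`. -/
noncomputable def reparam (D : VirtualDiagram) {F G : ℝ → ℝ} (hG : ContDiff ℝ ∞ G)
    (hG' : ∀ t, 0 < deriv G t) (hGp : ∀ t, G (t + 1) = G t + 1) (hFp : ∀ t, F (t + 1) = F t + 1)
    (hFG : ∀ x, F (G x) = x) (hGF : ∀ t, G (F t) = t) : VirtualDiagram :=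
  have hder : ∀ t, deriv (fun t => D.curve (G t)) t = deriv G t • deriv D.curve (G t) := fun t =>
    ((D.closedCurve.differentiable (G t)).hasDerivAt.scomp t
      (hG.differentiable (by simp) t).hasDerivAt).deriv
  have hsame : ∀ {s t}, SamePoint (G s) (G t) → SamePoint s t := by
    rintro s t ⟨k, hk⟩
    refine ⟨k, ?_⟩
    rw [← hFG s, hk, map_add_int_of_map_add_one hFp, hFG]
  { curve := fun t => D.curve (G t)
    smooth := D.smooth.comp hG
    periodic := fun t => by rw [hGp, D.periodic]
    immersed := fun t => by
      rw [hder]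
      exact smul_ne_zero (hG' t).ne' (D.immersed _)
    transverse := fun s t h hst => by
      rw [hder, hder, cross_smul_left, cross_smul_right]
      exact mul_ne_zero (hG' s).ne' (mul_ne_zero (hG' t).ne'
        (D.transverse _ _ h fun h' => hst (hsame h')))
    double := fun s t u hst htu =>
      (D.double _ _ _ hst htu).imp hsame (Or.imp hsame hsame)
    real := D.real
    real_crossing := fun p hp => by
      obtain ⟨s, t, hst, hs, ht⟩ := D.real_crossing p hp
      refine ⟨F s, F t, fun h => hst ?_, by rw [hGF, hs], by rw [hGF, ht]⟩
      obtain ⟨k, hk⟩ := h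
      refine ⟨k, ?_⟩
      rw [← hGF s, hk, map_add_int_of_map_add_one hGp, hGF] }

end VirtualDiagram

/-- The subdivision of a period by the marks. -/
noncomputable def markSeq (μ : Fin (2 * n + 1) → ℝ) (i : ℕ) : ℝ :=
  if h : i < 2 * n + 1 then μ ⟨i, h⟩ else μ 0 + 1

theorem markSeq_lt {μ : Fin (2 * n + 1) → ℝ} (h : StrictMono μ) (h1 : ∀ i, μ i < μ 0 + 1)
    {i j : ℕ} (hij : i < j) (hj : j ≤ 2 * n + 1) : markSeq μ i < markSeq μ j := by
  have hi : i < 2 * n + 1 := by omega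
  simp only [markSeq, hi, dif_pos]
  split_ifs with hj'
  · exact h (by simpa using hij)
  · exact h1 _

theorem markSeq_le {μ : Fin (2 * n + 1) → ℝ} (h : StrictMono μ) (h1 : ∀ i, μ i < μ 0 + 1)
    {i j : ℕ} (hij : i ≤ j) (hj : j ≤ 2 * n + 1) : markSeq μ i ≤ markSeq μ j := by
  rcases hij.lt_or_eq with h' | rfl
  · exact (markSeq_lt h h1 h' hj).le
  · exact le_rfl

theorem markSeq_zero (μ : Fin (2 * n + 1) → ℝ) : markSeq μ 0 = μ 0 := by
  simp [markSeq]

theorem markSeq_last (μ : Fin (2 * n + 1) → ℝ) : markSeq μ (2 * n + 1) = μ 0 + 1 := by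
  simp [markSeq]

theorem markSeq_fin (μ : Fin (2 * n + 1) → ℝ) (i : Fin (2 * n + 1)) : markSeq μ i = μ i := by
  rw [markSeq, dif_pos i.2]

/-- A bump in the gap between two consecutive marks. -/
theorem exists_gap_bump {μ : Fin (2 * n + 1) → ℝ} (h : StrictMono μ) (h1 : ∀ i, μ i < μ 0 + 1)
    {j : ℕ} (hj : j < 2 * n + 1) :
    ∃ β : ℝ → ℝ, ContDiff ℝ ∞ β ∧ Function.Periodic β 1 ∧ (∀ t, 0 ≤ β t) ∧
      (∀ i : Fin (2 * n + 1), ∀ᶠ t in 𝓝 (μ i), β t = 0) ∧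
      (∀ i < 2 * n + 1, i ≠ j → ∀ t ∈ Set.Icc (markSeq μ i) (markSeq μ (i + 1)), β t = 0) ∧
      ∃ t ∈ Set.Icc (markSeq μ j) (markSeq μ (j + 1)), 0 < β t := by
  have hlt := markSeq_lt h h1 (Nat.lt_succ_self j) hj
  have h0 := markSeq_le h h1 (Nat.zero_le j) hj.le
  have hl := markSeq_le h h1 (Nat.succ_le_of_lt hj) le_rfl
  rw [markSeq_zero] at h0
  rw [markSeq_last] at hl
  simp only [Nat.succ_eq_add_one] at hlt hl
  set p := markSeq μ j
  set q := markSeq μ (j + 1)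
  -- The middle third of the gap stays away from all marks.
  obtain ⟨β, hβ, hβp, hβ0, hβs⟩ := exists_periodic_bump (a := (2 * p + q) / 3)
    (b := (p + 2 * q) / 3) (by linarith) (by linarith)
  refine ⟨β, hβ, hβp, hβ0, fun i => ?_, fun i hi hij t ht => ?_, (p + q) / 2, ?_, ?_⟩
  · filter_upwards [Metric.ball_mem_nhds (μ i) (show 0 < (q - p) / 3 by linarith)] with t ht
    rw [Metric.mem_ball, Real.dist_eq, abs_lt] at ht
    by_contra hne
    obtain ⟨k, hk1, hk2⟩ := (hβs t).mp hne
    have hi0 := h.monotone (Fin.zero_le i)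
    have hi1 := h1 i
    have hk : k = 0 := by
      have a1 : (-1 : ℝ) < k := by linarith
      have a2 : (k : ℝ) < 1 := by linarith
      have a1' : -1 < k := by exact_mod_cast a1
      have a2' : k < 1 := by exact_mod_cast a2
      omega
    subst hk
    simp only [Int.cast_zero, add_zero] at hk1 hk2
    rcases Nat.lt_or_ge j i with hji | hji
    · have := markSeq_le h h1 (Nat.succ_le_of_lt hji) i.2.le
      rw [markSeq_fin] at this
      simp only [Nat.succ_eq_add_one] at this
      linarith
    · have := markSeq_le h h1 hji hj.le
      rw [markSeq_fin] at this
      linarith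
  · by_contra hne
    obtain ⟨k, hk1, hk2⟩ := (hβs t).mp hne
    have hi0 := markSeq_le h h1 (Nat.zero_le i) hi.le
    have hi1 := markSeq_le h h1 (Nat.succ_le_of_lt hi) le_rfl
    rw [markSeq_zero] at hi0
    rw [markSeq_last] at hi1
    simp only [Nat.succ_eq_add_one] at hi1
    have ht1 := ht.1
    have ht2 := ht.2
    have hk : k = 0 := by
      have a1 : (-1 : ℝ) < k := by linarith
      have a2 : (k : ℝ) < 1 := by linarith
      have a1' : -1 < k := by exact_mod_cast a1
      have a2' : k < 1 := by exact_mod_cast a2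
      omega
    subst hk
    simp only [Int.cast_zero, add_zero] at hk1 hk2
    rcases Nat.lt_or_ge j i with hji | hji
    · have := markSeq_le h h1 (Nat.succ_le_of_lt hji) hi.le
      simp only [Nat.succ_eq_add_one] at this
      linarith
    · have := markSeq_le h h1 (Nat.succ_le_of_lt (lt_of_le_of_ne hji hij)) hj.le
      simp only [Nat.succ_eq_add_one] at this
      linarith
  · constructor <;> linarith
  · refine lt_of_le_of_ne (hβ0 _) (Ne.symm ?_)
    rw [hβs]
    exact ⟨0, by constructor <;> push_cast <;> linarith⟩

/-- A diffeomorphism of the circle that moves the marks to their standard positions and has a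
prescribed derivative near the marks. -/
theorem exists_circle_diffeo {μ : Fin (2 * n + 1) → ℝ} (h : StrictMono μ)
    (h1 : ∀ i, μ i < μ 0 + 1) {σ : ℝ → ℝ} (hσ : ContDiff ℝ ∞ σ) (hσp : Function.Periodic σ 1)
    (hσ0 : ∀ t, 0 < σ t) :
    ∃ K₀ > 0, ∀ K, 0 < K → K ≤ K₀ → ∃ F : ℝ → ℝ, ContDiff ℝ ∞ F ∧ (∀ t, 0 < deriv F t) ∧
      (∀ t, F (t + 1) = F t + 1) ∧ (∀ i, F (μ i) = markParam n i) ∧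
      ∀ i, ∀ᶠ t in 𝓝 (μ i), deriv F t = K * σ t := by
  have hint : ∀ {f : ℝ → ℝ}, Continuous f → ∀ a b, IntervalIntegrable f volume a b :=
    fun hf a b => hf.intervalIntegrable a b
  have hN : (0 : ℝ) < ((2 * n + 1 : ℕ) : ℝ) := by positivity
  let I : Fin (2 * n + 1) → ℝ := fun j => ∫ s in markSeq μ j..markSeq μ (j + 1), σ s
  have hI : ∀ j, 0 ≤ I j := fun j =>
    intervalIntegral.integral_nonneg (markSeq_le h h1 (Nat.le_succ _) j.2) fun s _ => (hσ0 s).le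
  have hIsum : ∀ j, I j ≤ 1 + ∑ j, I j := fun j => by
    have := Finset.single_le_sum (fun j _ => hI j) (Finset.mem_univ j)
    linarith
  have hS : 0 < 1 + ∑ j, I j := by
    have := Finset.sum_nonneg fun j (_ : j ∈ Finset.univ) => hI j
    linarith
  choose β hβ hβp hβ0 hβμ hβg hβpos using
    fun j : Fin (2 * n + 1) => exists_gap_bump h h1 j.2
  let J : Fin (2 * n + 1) → ℝ := fun j => ∫ s in markSeq μ j..markSeq μ (j + 1), σ s * β j s
  have hJ : ∀ j, 0 < J j := fun j => by
    refine intervalIntegral.integral_pos (markSeq_lt h h1 (Nat.lt_succ_self _) j.2)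
      (hσ.continuous.mul (hβ j).continuous).continuousOn
      (fun s _ => mul_nonneg (hσ0 s).le (hβ0 j s)) ?_
    obtain ⟨t, ht, ht'⟩ := hβpos j
    exact ⟨t, ht, mul_pos (hσ0 t) ht'⟩
  -- For these `K` the density `K * σ` gives each gap at most the desired length `1 / (2n+1)`.
  refine ⟨1 / ((2 * n + 1 : ℕ) * (1 + ∑ j, I j)), by positivity, fun K hK hKle => ?_⟩
  have hKI : ∀ j, K * I j ≤ 1 / (2 * n + 1 : ℕ) := fun j => by
    calc K * I j ≤ 1 / ((2 * n + 1 : ℕ) * (1 + ∑ j, I j)) * (1 + ∑ j, I j) :=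
          mul_le_mul hKle (hIsum j) (hI j) (by positivity)
      _ = 1 / (2 * n + 1 : ℕ) := by field_simp
  -- The missing length is supplied by a multiple of the bump in the gap, which leaves the density
  -- near the marks alone.
  let A : Fin (2 * n + 1) → ℝ := fun j => (1 / (2 * n + 1 : ℕ) - K * I j) / (K * J j)
  have hA : ∀ j, 0 ≤ A j := fun j =>
    div_nonneg (sub_nonneg.mpr (hKI j)) (mul_pos hK (hJ j)).le
  let ρ : ℝ → ℝ := fun t => K * σ t * (1 + ∑ j, A j * β j t)
  have hρ : ContDiff ℝ ∞ ρ := (contDiff_const.mul hσ).mul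
    (contDiff_const.add (ContDiff.sum fun j _ => contDiff_const.mul (hβ j)))
  have hρ0 : ∀ t, 0 < ρ t := fun t => by
    have := Finset.sum_nonneg fun j (_ : j ∈ Finset.univ) => mul_nonneg (hA j) (hβ0 j t)
    exact mul_pos (mul_pos hK (hσ0 t)) (by linarith)
  have hρp : Function.Periodic ρ 1 := fun t => by
    simp only [ρ, hσp t, fun j => hβp j t]
  let F : ℝ → ℝ := fun t => ∫ s in μ 0..t, ρ s
  have hFd : deriv F = ρ := funext fun t => hρ.continuous.deriv_integral ρ _ t
  have hgap : ∀ j : Fin (2 * n + 1), ∫ s in markSeq μ j..markSeq μ (j + 1), ρ s =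
      1 / (2 * n + 1 : ℕ) := by
    intro j
    have e : ∫ s in markSeq μ j..markSeq μ (j + 1), ρ s =
        ∫ s in markSeq μ j..markSeq μ (j + 1), (K * σ s + K * A j * (σ s * β j s)) := by
      refine intervalIntegral.integral_congr fun s hs => ?_
      rw [Set.uIcc_of_le (markSeq_le h h1 (Nat.le_succ _) j.2)] at hs
      simp only [ρ]
      rw [Finset.sum_eq_single j]
      · ring
      · intro i _ hij
        rw [hβg i j j.2 (fun hji => hij (Fin.ext hji.symm)) s hs, mul_zero]
      · intro hj
        exact absurd (Finset.mem_univ j) hj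
    have i1 : Continuous fun s => K * σ s := continuous_const.mul hσ.continuous
    have i2 : Continuous fun s => K * A j * (σ s * β j s) :=
      continuous_const.mul (hσ.continuous.mul (hβ j).continuous)
    rw [e, intervalIntegral.integral_add (hint i1 _ _) (hint i2 _ _),
      intervalIntegral.integral_const_mul, intervalIntegral.integral_const_mul]
    change K * I j + K * A j * J j = _
    have hJ' := (hJ j).ne'
    have hK' := hK.ne'
    simp only [A]
    field_simp
    ring
  have hFseq : ∀ j, j ≤ 2 * n + 1 → F (markSeq μ j) = j / (2 * n + 1 : ℕ) := by
    intro j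
    induction j with
    | zero => intro _; simp [F, markSeq_zero]
    | succ j ih =>
      intro hj
      have e := intervalIntegral.integral_add_adjacent_intervals
        (hint hρ.continuous (μ 0) (markSeq μ j)) (hint hρ.continuous _ (markSeq μ (j + 1)))
      have e' : F (markSeq μ j) + _ = F (markSeq μ (j + 1)) := e
      rw [← e', ih (by omega), hgap ⟨j, hj⟩]
      push_cast
      ring
  refine ⟨F, contDiff_integral hρ _, fun t => by rw [hFd]; exact hρ0 t, fun t => ?_,
    fun i => ?_, fun i => ?_⟩
  · have e := intervalIntegral.integral_add_adjacent_intervals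
      (hint hρ.continuous (μ 0) t) (hint hρ.continuous t (t + 1))
    have e' : F t + _ = F (t + 1) := e
    rw [← e', hρp.intervalIntegral_add_eq t (μ 0)]
    have := hFseq (2 * n + 1) le_rfl
    rw [markSeq_last, div_self hN.ne'] at this
    exact congrArg (F t + ·) this
  · rw [← markSeq_fin μ i, hFseq i i.2.le]
    rfl
  · have hev : ∀ᶠ t in 𝓝 (μ i), ∀ j, β j t = 0 := by
      rw [Filter.eventually_all]
      exact fun j => hβμ j i
    filter_upwards [hev] with t ht
    rw [hFd]
    simp [ρ, ht]

theorem norm_sideDir (s : Side) : ‖sideDir s‖ = 1 := by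
  cases s <;> simp [sideDir, EuclideanSpace.norm_eq]

theorem eventuallyEq_of_deriv_eventuallyEq {f g : ℝ → ℝ} (hf : Differentiable ℝ f)
    (hg : Differentiable ℝ g) {a : ℝ} (h : deriv f =ᶠ[𝓝 a] deriv g) (ha : f a = g a) :
    f =ᶠ[𝓝 a] g := by
  obtain ⟨r, hr, hr'⟩ := Metric.eventually_nhds_iff_ball.mp h
  filter_upwards [Metric.ball_mem_nhds a hr] with t ht
  exact Metric.isOpen_ball.eqOn_of_deriv_eq (convex_ball a r).isPreconnected hf.differentiableOn
    hg.differentiableOn (fun s hs => hr' s hs) (Metric.mem_ball_self hr) ha ht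

open VirtualDiagram in
/-- A diagram with straight marks can be reparametrized to normal form. -/
theorem HasMarks.exists_isNormal_of_straight {w : GaussCode n} {D : VirtualDiagram}
    {μ : Fin (2 * n + 1) → ℝ} (h : HasMarks w D μ) (hs : StraightMarks w μ D.curve) :
    ∃ κ₀ : ℝ, ∀ κ ≥ κ₀, 0 < κ → ∃ D' ε, StrictEquiv D D' ∧ 0 < ε ∧ IsNormal w κ ε D' := by
  have hd := D.closedCurve.differentiable
  have hσ : ContDiff ℝ ∞ fun t => ‖deriv D.curve t‖ :=
    (D.smooth.iterate_deriv 1).norm ℝ D.immersed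
  -- With `σ` the speed of the curve and `K = 1 / κ`, the new parameter makes the speed `κ` near the
  -- marks. Small `K` means large `κ`.
  obtain ⟨K₀, hK₀, hK⟩ := exists_circle_diffeo h.strictMono h.lt_add_one hσ
    (fun t => by rw [D.periodic'.deriv t]) (fun t => norm_pos_iff.mpr (D.immersed t))
  refine ⟨1 / K₀, fun κ hκ hκ0 => ?_⟩
  obtain ⟨F, hF, hF', hFp, hFμ, hFev⟩ := hK (1 / κ) (by positivity)
    ((one_div_le hκ0 hK₀).mpr hκ)
  obtain ⟨G, hG, hFG, hGF, hG'⟩ := exists_smooth_inverse hF hF'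
    (surjective_of_map_add_one hF.continuous hFp)
  have hGp : ∀ t, G (t + 1) = G t + 1 := fun t => by
    rw [← hGF (G t + 1), hFp, hFG]
  have hgerm : ∀ i, ∀ᶠ s in 𝓝 (markParam n i), D.curve (G s) =
      diagPoint (w.markLabel i) + (κ * (s - markParam n i)) • sideDir (w.markSide i) := by
    intro i
    obtain ⟨l, hl, hl0, hl', hlev⟩ := hs i
    have hld := hl.differentiable (by simp)
    have hder : ∀ᶠ t in 𝓝 (μ i), ‖deriv D.curve t‖ = deriv l t := by
      filter_upwards [hlev.eventually_nhds, continuousAt_const.eventually_lt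
        hl.continuous_deriv_infty.continuousAt hl'] with t ht ht'
      have e : D.curve =ᶠ[𝓝 t] fun t => diagPoint (w.markLabel i) + l t • sideDir (w.markSide i) :=
        ht
      rw [e.deriv_eq, (((hld t).hasDerivAt.smul_const _).const_add _).deriv, norm_smul,
        norm_sideDir, mul_one, Real.norm_of_nonneg ht'.le]
    -- Directions are unit vectors, so the speed is the derivative of `l`, and `F` is `l / κ` up to
    -- a constant.
    have hFl : F =ᶠ[𝓝 (μ i)] fun t => markParam n i + 1 / κ * l t := by
      refine eventuallyEq_of_deriv_eventuallyEq (hF.differentiable (by simp)) (by fun_prop) ?_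
        (by rw [hFμ, hl0]; simp)
      filter_upwards [hFev i, hder] with t h1 h2
      rw [h1, h2, (((hld t).hasDerivAt.const_mul _).const_add _).deriv]
    have hGc : Tendsto G (𝓝 (markParam n i)) (𝓝 (μ i)) := by
      have : G (markParam n i) = μ i := by rw [← hFμ, hGF]
      rw [← this]
      exact hG.continuous.continuousAt
    filter_upwards [hGc.eventually hlev, hGc.eventually hFl] with s h1 h2
    rw [hFG] at h2
    have h3 : κ * (s - markParam n i) = l (G s) := by
      rw [sub_eq_iff_eq_add'.mpr h2]
      field_simp
    rw [h1, h3]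
  have hε : ∀ᶠ ε in 𝓝[>] (0 : ℝ), 0 < ε ∧ ∀ (i : Fin (2 * n + 1)) (x : ℝ), |x| < ε →
      D.curve (G (markParam n i + x)) =
        diagPoint (w.markLabel i) + (κ * x) • sideDir (w.markSide i) := by
    refine eventually_mem_nhdsWithin.and (Filter.eventually_all.mpr fun i => ?_)
    obtain ⟨r, hr, hr'⟩ := Metric.eventually_nhds_iff_ball.mp (hgerm i)
    filter_upwards [Ioo_mem_nhdsGT hr] with ε hε x hx
    have := hr' (markParam n i + x) (by
      rw [Metric.mem_ball, Real.dist_eq, add_sub_cancel_left]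
      exact hx.trans hε.2)
    rwa [add_sub_cancel_left] at this
  obtain ⟨ε, hε0, hε⟩ := hε.exists
  refine ⟨D.reparam hG hG' hGp hFp hFG hGF, ε, .symm _ _ (.rel _ _ (Or.inl ⟨⟨F, hF, hF', hFp,
    fun t => ?_⟩, rfl⟩)), hε0, hε, ?_⟩
  · simp only [reparam, hGF]
  · have hval : ∀ i, D.curve (μ i) = diagPoint (w.markLabel i) := fun i => by
      obtain ⟨l, -, hl0, -, hlev⟩ := hs i
      rw [hlev.self_of_nhds, hl0, zero_smul, add_zero]
    change (D.real : Set Plane) = _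
    rw [h.real_eq]
    ext p
    constructor
    · rintro ⟨i, rfl⟩
      exact ⟨(w.seq i).1, by simp [hval, GaussCode.markLabel]⟩
    · rintro ⟨j, rfl⟩
      obtain ⟨i, hi⟩ := w.exists_mark j .L
      exact ⟨i, by simp [hval, GaussCode.markLabel, hi]⟩

open VirtualDiagram in
/-- Every diagram can be brought to normal form. -/
theorem HasMarks.exists_isNormal {w : GaussCode n} {D : VirtualDiagram}
    {μ : Fin (2 * n + 1) → ℝ} (h : HasMarks w D μ) :
    ∃ κ₀ : ℝ, ∀ κ ≥ κ₀, 0 < κ → ∃ D' ε, StrictEquiv D D' ∧ 0 < ε ∧ IsNormal w κ ε D' := by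
  obtain ⟨D₁, h1, h2, h3⟩ := h.exists_straight
  obtain ⟨κ₀, hκ₀⟩ := h2.exists_isNormal_of_straight h3
  refine ⟨κ₀, fun κ hκ hκ0 => ?_⟩
  obtain ⟨D', ε, h4, h5⟩ := hκ₀ κ hκ hκ0
  exact ⟨D', ε, h1.trans _ _ _ h4, h5⟩

open VirtualDiagram in
-- Both diagrams have a normal form for every large speed; at a common speed the normal forms are
-- strictly equivalent.
theorem HasMarks.strictEquiv {w : GaussCode n} {D D' : VirtualDiagram}
    {μ μ' : Fin (2 * n + 1) → ℝ} (h : HasMarks w D μ) (h' : HasMarks w D' μ') :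
    StrictEquiv D D' := by
  obtain ⟨κ₁, hκ₁⟩ := h.exists_isNormal
  obtain ⟨κ₂, hκ₂⟩ := h'.exists_isNormal
  have hpos : 0 < max 1 (max κ₁ κ₂) := zero_lt_one.trans_le (le_max_left _ _)
  obtain ⟨E, ε, e1, e2, e3⟩ := hκ₁ (max 1 (max κ₁ κ₂))
    ((le_max_left _ _).trans (le_max_right _ _)) hpos
  obtain ⟨E', ε', e1', e2', e3'⟩ := hκ₂ (max 1 (max κ₁ κ₂))
    ((le_max_right _ _).trans (le_max_right _ _)) hpos
  exact (e1.trans _ _ _ (e3.strictEquiv e2 e3' e2')).trans _ _ _ (e1'.symm)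

end Reparametrization

/-! ### Reading Gauss codes off diagrams -/

theorem SamePoint.eq_of_mem_Ioo {a s t : ℝ} (h : SamePoint s t) (hs : s ∈ Set.Ioo a (a + 1))
    (ht : t ∈ Set.Ioo a (a + 1)) : s = t := by
  obtain ⟨k, hk⟩ := h
  have a1 : (-1 : ℝ) < k := by linarith [hs.1, ht.2]
  have a2 : (k : ℝ) < 1 := by linarith [hs.2, ht.1]
  have a1' : -1 < k := by exact_mod_cast a1
  have a2' : k < 1 := by exact_mod_cast a2
  have : k = 0 := by omega
  simpa [this] using hk

theorem exists_samePoint_mem_Ico (a t : ℝ) : ∃ s ∈ Set.Ico a (a + 1), SamePoint s t := by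
  refine ⟨a + Int.fract (t - a), ⟨by linarith [Int.fract_nonneg (t - a)],
    by linarith [Int.fract_lt_one (t - a)]⟩, -⌊t - a⌋, ?_⟩
  have := Int.self_sub_floor (t - a)
  push_cast
  linarith

namespace VirtualDiagram

variable {n : ℕ}

theorem deriv_eq_of_samePoint (D : VirtualDiagram) {s t : ℝ} (h : SamePoint s t) :
    deriv D.curve s = deriv D.curve t := D.periodic'.deriv.eq_of_samePoint h

theorem HasSide.congr {D : VirtualDiagram} {s t : ℝ} {c : Side} (h : D.HasSide s c)
    (hst : SamePoint s t) : D.HasSide t c := by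
  cases c <;> obtain ⟨u, h1, h2, h3⟩ := h <;>
    exact ⟨u, fun h' => h1 (hst.trans h'), h2.trans (D.periodic'.eq_of_samePoint hst),
      by rwa [← D.deriv_eq_of_samePoint hst]⟩

/-- The other branch at a crossing. -/
theorem HasSide.cross {D : VirtualDiagram} {s t : ℝ} (hst : ¬ SamePoint s t)
    (h : D.curve s = D.curve t) :
    (D.HasSide s .L ↔ cross (deriv D.curve s) (deriv D.curve t) < 0) ∧
      (D.HasSide s .R ↔ 0 < cross (deriv D.curve s) (deriv D.curve t)) := by
  have key : ∀ u, ¬ SamePoint s u → D.curve u = D.curve s → deriv D.curve u = deriv D.curve t := by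
    intro u hu hus
    refine D.deriv_eq_of_samePoint ?_
    rcases D.double u s t hus h with h' | h' | h'
    · exact absurd h'.symm hu
    · exact absurd h' hst
    · exact h'
  constructor
  · exact ⟨fun ⟨u, h1, h2, h3⟩ => by rwa [← key u h1 h2], fun h' => ⟨t, hst, h.symm, h'⟩⟩
  · exact ⟨fun ⟨u, h1, h2, h3⟩ => by rwa [← key u h1 h2], fun h' => ⟨t, hst, h.symm, h'⟩⟩

theorem HasSide.unique {D : VirtualDiagram} {t : ℝ} {c c' : Side} (h : D.HasSide t c)
    (h' : D.HasSide t c') : c = c' := by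
  have key : ∀ {t}, D.HasSide t .L → D.HasSide t .R → False := by
    rintro t ⟨u, h1, h2, h3⟩ h'
    have := (HasSide.cross h1 h2.symm).2.mp h'
    exact lt_asymm this h3
  cases c <;> cases c'
  · rfl
  · exact (key h h').elim
  · exact (key h' h).elim
  · rfl

theorem IsGaussCode.exists_hasMarks {D : VirtualDiagram} {w : GaussCode n} (h : D.IsGaussCode w) :
    ∃ μ, HasMarks w D μ := by
  obtain ⟨a, f, ha, b, hb, hrange, hcode⟩ := h
  have hmem : ∀ i, b i ∈ Set.Ioo a (a + 1) ∧ D.curve (b i) ∈ D.real := fun i => by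
    have : b i ∈ Set.range b := ⟨i, rfl⟩
    rwa [hrange] at this
  have heq : ∀ i j, D.curve (b i) = D.curve (b j) ↔ (w.seq i).1 = (w.seq j).1 := by
    intro i j
    rw [(hcode i (hmem i).2).1, (hcode j (hmem j).2).1, f.apply_eq_iff_eq, Subtype.mk.injEq]
  refine ⟨Fin.cons a b, ?_, ?_, ?_, ?_, ?_⟩
  · intro i j hij
    induction j using Fin.cases with
    | zero => exact absurd hij (Fin.not_lt_zero i)
    | succ j =>
      induction i using Fin.cases with
      | zero => simpa using (hmem j).1.1
      | succ i => simpa using hb (Fin.succ_lt_succ_iff.mp hij)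
  · intro i
    induction i using Fin.cases with
    | zero => simp
    | succ i => simpa using (hmem i).1.2
  · intro i j
    induction i using Fin.cases with
    | zero =>
      induction j using Fin.cases with
      | zero => simp
      | succ j =>
        simp only [Fin.cons_zero, Fin.cons_succ, GaussCode.markLabel, Fin.cases_zero,
          Fin.cases_succ]
        exact ⟨fun h => absurd (h ▸ (hmem j).2) ha, fun h => absurd h (w.seq j).1.2.ne'⟩
    | succ i =>
      induction j using Fin.cases with
      | zero =>
        simp only [Fin.cons_zero, Fin.cons_succ, GaussCode.markLabel, Fin.cases_zero,
          Fin.cases_succ]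
        exact ⟨fun h => absurd (h ▸ (hmem i).2) ha, fun h => absurd h (w.seq i).1.2.ne⟩
      | succ j =>
        simp only [Fin.cons_succ, GaussCode.markLabel, Fin.cases_succ]
        rw [heq, Fin.ext_iff]
  · ext p
    simp only [Fin.cons_succ, Set.mem_range, Finset.mem_coe]
    constructor
    · intro hp
      obtain ⟨s, t, -, hs, -⟩ := D.real_crossing p hp
      obtain ⟨s', hs', hss⟩ := exists_samePoint_mem_Ico a s
      have e : D.curve s' = p := (D.periodic'.eq_of_samePoint hss).trans hs
      have hne : a ≠ s' := by
        rintro rfl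
        exact ha (e ▸ hp)
      have : s' ∈ Set.range b := by
        rw [hrange]
        exact ⟨⟨lt_of_le_of_ne hs'.1 hne, hs'.2⟩, e ▸ hp⟩
      obtain ⟨i, hi⟩ := this
      exact ⟨i, by rw [hi, e]⟩
    · rintro ⟨i, rfl⟩
      exact (hmem i).2
  · intro i j hij hi hj
    induction j using Fin.cases with
    | zero => simp [GaussCode.markSide] at hj
    | succ j =>
      induction i using Fin.cases with
      | zero =>
        simp only [GaussCode.markLabel, Fin.cases_zero, Fin.cases_succ] at hij
        exact absurd hij (w.seq j).1.2.ne'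
      | succ i =>
        simp only [GaussCode.markLabel, GaussCode.markSide, Fin.cases_succ] at hij hi hj
        simp only [Fin.cons_succ]
        have hns : ¬ SamePoint (b i) (b j) := by
          intro h
          have := hb.injective (h.eq_of_mem_Ioo (hmem i).1 (hmem j).1)
          rw [this, hj] at hi
          simp at hi
        refine (HasSide.cross hns ((heq i j).mpr (Fin.ext hij))).1.mp ?_
        have := (hcode i (hmem i).2).2
        rwa [hi] at this

/-- Gauss codes determine the diagram up to strict equivalence. -/
theorem IsGaussCode.strictEquiv {D D' : VirtualDiagram} {w : GaussCode n} (h : D.IsGaussCode w)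
    (h' : D'.IsGaussCode w) : StrictEquiv D D' := by
  obtain ⟨μ, hμ⟩ := h.exists_hasMarks
  obtain ⟨μ', hμ'⟩ := h'.exists_hasMarks
  exact hμ.strictEquiv hμ'

theorem IsGaussCode.card_real {D : VirtualDiagram} {w : GaussCode n} (h : D.IsGaussCode w) :
    D.real.card = n := by
  obtain ⟨-, f, -⟩ := h
  simpa using Fintype.card_congr f

/-- Each of the finitely many real crossings has two parameters modulo 1, so only countably many
parameters are excluded. -/
theorem exists_base (D : VirtualDiagram) : ∃ a, D.curve a ∉ D.real := by
  have hc : {t | D.curve t ∈ D.real}.Countable := by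
    have h1 : ∀ p : Plane, {t | D.curve t = p ∧ p ∈ D.real}.Countable := by
      intro p
      by_cases hp : p ∈ D.real
      · obtain ⟨s, u, hsu, hs, hu⟩ := D.real_crossing p hp
        refine ((Set.countable_range fun k : ℤ => s + k).union
          (Set.countable_range fun k : ℤ => u + k)).mono ?_
        rintro t ⟨ht, -⟩
        rcases D.double t s u (ht.trans hs.symm) (hs.trans hu.symm) with ⟨k, h⟩ | h | ⟨k, h⟩
        · exact Or.inl ⟨k, h.symm⟩
        · exact absurd h hsu
        · exact Or.inr ⟨k, h.symm⟩
      · refine Set.Countable.mono ?_ (Set.countable_empty)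
        rintro t ⟨-, h⟩
        exact absurd h hp
    refine (D.real.countable_toSet.biUnion fun p _ => h1 p).mono fun t ht => ?_
    exact Set.mem_biUnion (show D.curve t ∈ (D.real : Set Plane) from ht) ⟨rfl, ht⟩
  by_contra hall
  push Not at hall
  exact Set.not_countable_univ (hc.mono fun t _ => hall t)

/-- Every diagram has a Gauss code. -/
theorem exists_isGaussCode (D : VirtualDiagram) (hn : D.real.card = n) :
    ∃ w : GaussCode n, D.IsGaussCode w := by
  obtain ⟨a, ha⟩ := D.exists_base
  have hIoo : ∀ s, D.curve s ∈ D.real → ∃ s' ∈ Set.Ioo a (a + 1), SamePoint s' s := by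
    intro s hs
    obtain ⟨s', hs', hss⟩ := exists_samePoint_mem_Ico a s
    refine ⟨s', ⟨lt_of_le_of_ne hs'.1 ?_, hs'.2⟩, hss⟩
    rintro rfl
    exact ha ((D.periodic'.eq_of_samePoint hss).symm ▸ hs)
  -- `cross` is nonzero and antisymmetric, so exactly one of the two branches is left and the other
  -- right.
  have hpair : ∀ p : {p // p ∈ D.real}, ∃ s ∈ Set.Ioo a (a + 1), ∃ t ∈ Set.Ioo a (a + 1),
      D.curve s = p ∧ D.curve t = p ∧ D.HasSide s .L ∧ D.HasSide t .R := by
    rintro ⟨p, hp⟩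
    obtain ⟨s, t, hst, hs, ht⟩ := D.real_crossing p hp
    obtain ⟨s', hs', hss⟩ := hIoo s (hs ▸ hp)
    obtain ⟨t', ht', htt⟩ := hIoo t (ht ▸ hp)
    have hst' : ¬ SamePoint s' t' := fun h => hst (hss.symm.trans (h.trans htt))
    have es := (D.periodic'.eq_of_samePoint hss).trans hs
    have et := (D.periodic'.eq_of_samePoint htt).trans ht
    have h1 := HasSide.cross hst' (es.trans et.symm)
    have h2 := HasSide.cross (fun h => hst' h.symm) (et.trans es.symm)
    rcases lt_or_gt_of_ne (D.transverse s' t' (es.trans et.symm) hst') with hc | hc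
    · exact ⟨s', hs', t', ht', es, et, h1.1.mpr hc, h2.2.mpr (by rw [cross_swap]; linarith)⟩
    · exact ⟨t', ht', s', hs', et, es, h2.1.mpr (by rw [cross_swap]; linarith), h1.2.mpr hc⟩
  choose sL hsL sR hsR hL hR hLL hRR using hpair
  -- `τ` lists the branches at real crossings without repetition; sorting its values yields the
  -- code.
  let τ : {p // p ∈ D.real} × Side → ℝ := fun x => match x.2 with
    | .L => sL x.1
    | .R => sR x.1
  have hτ1 : ∀ x, τ x ∈ Set.Ioo a (a + 1) := by
    rintro ⟨p, c⟩
    cases c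
    · exact hsL p
    · exact hsR p
  have hτ2 : ∀ x, D.curve (τ x) = x.1 := by
    rintro ⟨p, c⟩
    cases c
    · exact hL p
    · exact hR p
  have hτ3 : ∀ x, D.HasSide (τ x) x.2 := by
    rintro ⟨p, c⟩
    cases c
    · exact hLL p
    · exact hRR p
  have hτinj : Function.Injective τ := by
    intro x y hxy
    refine Prod.ext (Subtype.ext ?_) ?_
    · rw [← hτ2, ← hτ2, hxy]
    · exact (hτ3 x).unique (hxy ▸ hτ3 y)
  have hτsurj : ∀ t ∈ Set.Ioo a (a + 1), D.curve t ∈ D.real → ∃ x, τ x = t := by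
    intro t ht hreal
    let p : {p // p ∈ D.real} := ⟨D.curve t, hreal⟩
    have e1 : D.curve (τ (p, .L)) = D.curve t := hτ2 (p, .L)
    have e2 : D.curve (τ (p, .R)) = D.curve t := hτ2 (p, .R)
    rcases D.double _ t _ e1 e2.symm with h | h | h
    · exact ⟨(p, .L), h.eq_of_mem_Ioo (hτ1 (p, .L)) ht⟩
    · exact ⟨(p, .R), (h.eq_of_mem_Ioo ht (hτ1 (p, .R))).symm⟩
    · have := congrArg Prod.snd (hτinj (a₁ := (p, .L)) (a₂ := (p, .R))
        (h.eq_of_mem_Ioo (hτ1 (p, .L)) (hτ1 (p, .R))))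
      simp at this
  let f : {p // p ∈ D.real} ≃ Fin n := D.real.equivFinOfCardEq hn
  let S : Finset ℝ := Finset.univ.map ⟨τ, hτinj⟩
  have hS : S.card = 2 * n := by
    rw [Finset.card_map, Finset.card_univ, Fintype.card_prod, Fintype.card_coe, hn,
      Fintype.card_congr Side.equivBool, Fintype.card_bool, mul_comm]
  let b := S.orderEmbOfFin hS
  have hbS : ∀ i, ∃ x, τ x = b i := fun i => by
    obtain ⟨x, -, hx⟩ := Finset.mem_map.mp (S.orderEmbOfFin_mem hS i)
    exact ⟨x, hx⟩
  choose x hx using hbS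
  have hrange : Set.range b = Set.range τ := by
    rw [Finset.range_orderEmbOfFin]
    ext t
    simp [S]
  refine ⟨⟨fun i => (f (x i).1, (x i).2), ?_⟩, a, f, ha, b, b.strictMono, ?_, ?_⟩
  · rintro ⟨j, c⟩
    have : τ (f.symm j, c) ∈ Set.range b := by
      rw [hrange]; exact ⟨_, rfl⟩
    obtain ⟨i, hi⟩ := this
    refine ⟨i, ?_⟩
    rw [← hx] at hi
    simp [hτinj hi]
  · rw [hrange]
    ext t
    constructor
    · rintro ⟨y, rfl⟩
      exact ⟨hτ1 y, (hτ2 y).symm ▸ y.1.2⟩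
    · rintro ⟨ht, hreal⟩
      exact hτsurj t ht hreal
  · intro i hi
    refine ⟨congrArg f (Subtype.ext ?_), ?_⟩
    · rw [← hτ2, hx]
    · have := hτ3 (x i)
      rwa [hx] at this

end VirtualDiagram

/-! ### All Gauss codes of a diagram are equivalent -/

section Uniqueness

variable {n : ℕ}

open VirtualDiagram

namespace GaussCode

theorem shift_add (k m : ℤ) (w : GaussCode n) : shift m (shift k w) = shift (k + m) w := by
  ext i <;> simp [shift, zpow_add]

theorem shift_zero (w : GaussCode n) : shift 0 w = w := by
  ext i <;> simp [shift]

theorem relabel_refl (w : GaussCode n) : relabel (Equiv.refl _) w = w := by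
  ext i <;> simp [relabel]

theorem oriEquiv_shift (m : ℤ) (w : GaussCode n) : OriEquiv w (shift m w) :=
  ⟨Equiv.refl _, m, by rw [relabel_refl]⟩

theorem oriEquiv_relabel (π : Equiv.Perm (Fin n)) (w : GaussCode n) : OriEquiv w (relabel π w) :=
  ⟨π, 0, by rw [shift_zero]⟩

end GaussCode

namespace VirtualDiagram

open GaussCode

theorem IsGaussCodeAt.unique {D : VirtualDiagram} {a : ℝ} {f : {p // p ∈ D.real} ≃ Fin n}
    {w w' : GaussCode n} (h : D.IsGaussCodeAt a f w) (h' : D.IsGaussCodeAt a f w') : w = w' := by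
  obtain ⟨-, b, hb, hrange, hcode⟩ := h
  obtain ⟨-, b', hb', hrange', hcode'⟩ := h'
  have : b = b' := (hb.range_inj hb').mp (hrange.trans hrange'.symm)
  subst this
  ext1
  funext i
  have hi : D.curve (b i) ∈ D.real := by
    have : b i ∈ Set.range b := ⟨i, rfl⟩
    rw [hrange] at this
    exact this.2
  exact Prod.ext ((hcode i hi).1.trans (hcode' i hi).1.symm) ((hcode i hi).2.unique (hcode' i hi).2)

theorem IsGaussCodeAt.relabel {D : VirtualDiagram} {a : ℝ} {f : {p // p ∈ D.real} ≃ Fin n}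
    {w : GaussCode n} (h : D.IsGaussCodeAt a f w) (π : Equiv.Perm (Fin n)) :
    D.IsGaussCodeAt a (f.trans π) (GaussCode.relabel π w) := by
  obtain ⟨ha, b, hb, hrange, hcode⟩ := h
  exact ⟨ha, b, hb, hrange, fun i hi => ⟨congrArg π (hcode i hi).1, (hcode i hi).2⟩⟩

theorem IsGaussCodeAt.add_int {D : VirtualDiagram} {a : ℝ} {f : {p // p ∈ D.real} ≃ Fin n}
    {w : GaussCode n} (h : D.IsGaussCodeAt a f w) (k : ℤ) : D.IsGaussCodeAt (a + k) f w := by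
  obtain ⟨ha, b, hb, hrange, hcode⟩ := h
  have hper : ∀ t, D.curve (t + k) = D.curve t := fun t =>
    D.periodic'.eq_of_samePoint (SamePoint.add_int t k)
  refine ⟨by rwa [hper], fun i => b i + k, fun i j hij => by simpa using hb hij, ?_, ?_⟩
  · ext t
    have h1 : t ∈ Set.range (fun i => b i + k) ↔ t - k ∈ Set.range b := by
      simp only [Set.mem_range, eq_sub_iff_add_eq]
    have h2 : D.curve (t - k) = D.curve t := by rw [← hper, sub_add_cancel]
    rw [h1, hrange]
    simp only [Set.mem_ofPred_eq, Set.mem_Ioo, h2]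
    constructor <;> rintro ⟨⟨h3, h4⟩, h5⟩ <;> exact ⟨⟨by linarith, by linarith⟩, h5⟩
  · intro i hi
    have e := hper (b i)
    have hi' : D.curve (b i) ∈ D.real := e ▸ hi
    refine ⟨(hcode i hi').1.trans (congrArg f (Subtype.ext e.symm)),
      (hcode i hi').2.congr (SamePoint.add_int _ _).symm⟩

/-- `b` lists the parameters of the real crossings for the Gauss code `w` at the base point `a`. -/
def IsGaussCodeWith (D : VirtualDiagram) (a : ℝ) (f : {p // p ∈ D.real} ≃ Fin n)
    (w : GaussCode n) (b : Fin (2 * n) → ℝ) : Prop :=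
  D.curve a ∉ D.real ∧ StrictMono b ∧
    Set.range b = {t | t ∈ Set.Ioo a (a + 1) ∧ D.curve t ∈ D.real} ∧
    ∀ (i : Fin (2 * n)) (h : D.curve (b i) ∈ D.real),
      (w.seq i).1 = f ⟨D.curve (b i), h⟩ ∧ D.HasSide (b i) (w.seq i).2

theorem isGaussCodeAt_iff {D : VirtualDiagram} {a : ℝ} {f : {p // p ∈ D.real} ≃ Fin n}
    {w : GaussCode n} : D.IsGaussCodeAt a f w ↔ ∃ b, D.IsGaussCodeWith a f w b := by
  simp only [IsGaussCodeAt, IsGaussCodeWith, exists_and_left]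

theorem IsGaussCodeWith.mem {D : VirtualDiagram} {a : ℝ} {f : {p // p ∈ D.real} ≃ Fin n}
    {w : GaussCode n} {b : Fin (2 * n) → ℝ} (h : D.IsGaussCodeWith a f w b) (i : Fin (2 * n)) :
    b i ∈ Set.Ioo a (a + 1) ∧ D.curve (b i) ∈ D.real := by
  have : b i ∈ Set.range b := ⟨i, rfl⟩
  rwa [h.2.2.1] at this

theorem IsGaussCodeWith.exists_eq {D : VirtualDiagram} {a : ℝ} {f : {p // p ∈ D.real} ≃ Fin n}
    {w : GaussCode n} {b : Fin (2 * n) → ℝ} (h : D.IsGaussCodeWith a f w b) {t : ℝ}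
    (ht : t ∈ Set.Ioo a (a + 1)) (ht' : D.curve t ∈ D.real) : ∃ i, b i = t := by
  have : t ∈ Set.range b := by rw [h.2.2.1]; exact ⟨ht, ht'⟩
  exact this

theorem curve_sub_one (D : VirtualDiagram) (t : ℝ) : D.curve (t - 1) = D.curve t := by
  rw [← D.periodic, sub_add_cancel]

/-- Moving the base point without passing a real crossing. -/
theorem IsGaussCodeWith.move {D : VirtualDiagram} {a a' : ℝ} {f : {p // p ∈ D.real} ≃ Fin n}
    {w : GaussCode n} {b : Fin (2 * n) → ℝ} (h : D.IsGaussCodeWith a f w b)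
    (ha' : D.curve a' ∉ D.real) (h1 : a ≤ a') (h2 : a' < a + 1) (h3 : ∀ i, a' ≤ b i) :
    D.IsGaussCodeWith a' f w b := by
  refine ⟨ha', h.2.1, ?_, h.2.2.2⟩
  ext t
  constructor
  · rintro ⟨i, rfl⟩
    have hi := h.mem i
    refine ⟨⟨lt_of_le_of_ne (h3 i) ?_, by linarith [hi.1.2]⟩, hi.2⟩
    intro e
    exact ha' (e ▸ hi.2)
  · rintro ⟨⟨ht1, ht2⟩, ht⟩
    rcases lt_or_ge t (a + 1) with hlt | hge
    · exact h.exists_eq ⟨by linarith, hlt⟩ ht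
    · exfalso
      have ht' : D.curve (t - 1) ∈ D.real := by rwa [curve_sub_one]
      rcases hge.eq_or_lt with heq | hgt
      · rw [← heq, add_sub_cancel_right] at ht'
        exact h.1 ht'
      · obtain ⟨i, hi⟩ := h.exists_eq (t := t - 1) ⟨by linarith, by linarith⟩ ht'
        linarith [h3 i]

theorem finRotate_eq {N : ℕ} (i : Fin N) :
    finRotate N i = if h : (i : ℕ) + 1 < N then ⟨i + 1, h⟩ else ⟨0, i.pos⟩ := by
  cases N with
  | zero => exact i.elim0
  | succ N =>
    rw [finRotate_apply]
    split_ifs with h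
    · exact Fin.ext (Fin.val_add_one_of_lt' h)
    · have : i = Fin.last N := Fin.ext (by have := i.2; simp; omega)
      subst this
      simp

/-- Moving the base point past one real crossing. -/
theorem IsGaussCodeWith.shift_one {D : VirtualDiagram} {a a' : ℝ}
    {f : {p // p ∈ D.real} ≃ Fin n} {w : GaussCode n} {b : Fin (2 * n) → ℝ}
    (h : D.IsGaussCodeWith a f w b) (ha' : D.curve a' ∉ D.real) (hn : 0 < 2 * n)
    (h1 : b ⟨0, hn⟩ < a') (h2 : a' < a + 1) (h3 : ∀ i : Fin (2 * n), (i : ℕ) ≠ 0 → a' < b i) :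
    D.IsGaussCodeWith a' f (shift 1 w) (fun i => if h : (i : ℕ) + 1 < 2 * n then b ⟨i + 1, h⟩
      else b ⟨0, hn⟩ + 1) := by
  have h0 := (h.mem ⟨0, hn⟩).1
  refine ⟨ha', ?_, ?_, ?_⟩
  · intro i j hij
    have hij' : (i : ℕ) < j := hij
    have hi : (i : ℕ) + 1 < 2 * n := by omega
    simp only [hi, dif_pos]
    split_ifs with hj
    · exact h.2.1 (by simpa using hij)
    · linarith [(h.mem ⟨i + 1, hi⟩).1.2, h0.1]
  · ext t
    constructor
    · rintro ⟨i, rfl⟩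
      beta_reduce
      split_ifs with hi
      · have hm := h.mem ⟨i + 1, hi⟩
        have hgt := h3 ⟨i + 1, hi⟩ (by simp)
        exact ⟨⟨hgt, by linarith [hm.1.2, h0.1]⟩, hm.2⟩
      · refine ⟨⟨by linarith [h0.1], by linarith⟩, ?_⟩
        rw [D.periodic]
        exact (h.mem ⟨0, hn⟩).2
    · rintro ⟨⟨ht1, ht2⟩, ht⟩
      have ht' : D.curve (t - 1) ∈ D.real := by rwa [curve_sub_one]
      rcases lt_trichotomy t (a + 1) with hlt | heq | hgt
      · obtain ⟨i, hi⟩ := h.exists_eq ⟨by linarith [h0.1], hlt⟩ ht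
        have hi0 : (i : ℕ) ≠ 0 := by
          intro h0
          have : i = ⟨0, hn⟩ := Fin.ext h0
          rw [this] at hi
          linarith
        have e : (i : ℕ) - 1 + 1 = i := by omega
        refine ⟨⟨i - 1, by omega⟩, ?_⟩
        have hlt' : (i : ℕ) - 1 + 1 < 2 * n := by omega
        simp only [hlt', dif_pos]
        rw [← hi]
        exact congrArg b (Fin.ext e)
      · rw [heq, add_sub_cancel_right] at ht'
        exact absurd ht' h.1
      -- A branch met after `a + 1` is the first one, a period later.
      · obtain ⟨i, hi⟩ := h.exists_eq (t := t - 1) ⟨by linarith, by linarith⟩ ht'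
        have hi0 : (i : ℕ) = 0 := by
          by_contra hne
          linarith [h3 i hne]
        refine ⟨⟨2 * n - 1, by omega⟩, ?_⟩
        have hlt' : ¬ (2 * n - 1 + 1 < 2 * n) := by omega
        simp only [hlt', dif_neg, not_false_eq_true]
        have : i = ⟨0, hn⟩ := Fin.ext hi0
        rw [← this, hi]
        ring
  · intro i
    by_cases hlt : (i : ℕ) + 1 < 2 * n
    · simp only [shift, zpow_one, finRotate_eq, dif_pos hlt]
      exact h.2.2.2 _
    · simp only [shift, zpow_one, finRotate_eq, dif_neg hlt]
      intro hi
      have e := D.periodic (b ⟨0, hn⟩)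
      have hi' : D.curve (b ⟨0, hn⟩) ∈ D.real := e ▸ hi
      refine ⟨(h.2.2.2 _ hi').1.trans (congrArg f (Subtype.ext e.symm)), (h.2.2.2 _ hi').2.congr ?_⟩
      exact SamePoint.symm ⟨1, by simp⟩

/-- There is a base point just behind the first real crossing. -/
theorem IsGaussCodeWith.exists_next {D : VirtualDiagram} {a c : ℝ}
    {f : {p // p ∈ D.real} ≃ Fin n} {w : GaussCode n} {b : Fin (2 * n) → ℝ}
    (h : D.IsGaussCodeWith a f w b) (hn : 0 < 2 * n) (hc : b ⟨0, hn⟩ < c) :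
    ∃ a', D.curve a' ∉ D.real ∧ b ⟨0, hn⟩ < a' ∧ a' < c ∧ a' < a + 1 ∧
      ∀ i : Fin (2 * n), (i : ℕ) ≠ 0 → a' < b i := by
  have h0 := (h.mem ⟨0, hn⟩).1
  have key : ∀ᶠ a' in 𝓝[>] (b ⟨0, hn⟩), a' ∈ Set.Ioo (b ⟨0, hn⟩) (min c (a + 1)) ∧
      ∀ i : Fin (2 * n), (i : ℕ) ≠ 0 → a' < b i := by
    refine Filter.Eventually.and (Ioo_mem_nhdsGT (lt_min hc h0.2)) (Filter.eventually_all.mpr fun i => ?_)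
    by_cases hi : (i : ℕ) = 0
    · exact Filter.Eventually.of_forall fun _ hi' => absurd hi hi'
    · have hlt : b ⟨0, hn⟩ < b i := h.2.1 (Nat.pos_of_ne_zero hi)
      filter_upwards [Ioo_mem_nhdsGT hlt] with a' ha' _ using ha'.2
  obtain ⟨a', ⟨h1, h2⟩, h3⟩ := key.exists
  refine ⟨a', fun hreal => ?_, h1, h2.trans_le (min_le_left _ _), h2.trans_le (min_le_right _ _), h3⟩
  obtain ⟨i, hi⟩ := h.exists_eq ⟨h0.1.trans h1, h2.trans_le (min_le_right _ _)⟩ hreal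
  by_cases hi0 : (i : ℕ) = 0
  · have : i = ⟨0, hn⟩ := Fin.ext hi0
    rw [this] at hi
    linarith
  · linarith [h3 i hi0]

/-- Moving the base point shifts the Gauss code. -/
theorem IsGaussCodeWith.exists_shift {D : VirtualDiagram} {f : {p // p ∈ D.real} ≃ Fin n} {a' : ℝ}
    (ha' : D.curve a' ∉ D.real) (k : ℕ) : ∀ {a : ℝ} {w : GaussCode n} {b : Fin (2 * n) → ℝ},
      D.IsGaussCodeWith a f w b → a ≤ a' → a' < a + 1 → (∀ i, b i < a' → (i : ℕ) < k) →
      ∃ m : ℤ, D.IsGaussCodeAt a' f (shift m w) := by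
  -- The induction is on a bound for the number of branches at real crossings between `a` and `a'`.
  induction k with
  | zero =>
    intro a w b h h1 h2 h3
    refine ⟨0, ?_⟩
    rw [shift_zero]
    exact isGaussCodeAt_iff.mpr ⟨b, h.move ha' h1 h2 fun i => not_lt.mp fun hi => by
      simpa using h3 i hi⟩
  | succ k ih =>
    intro a w b h h1 h2 h3
    by_cases hall : ∀ i, a' ≤ b i
    · refine ⟨0, ?_⟩
      rw [shift_zero]
      exact isGaussCodeAt_iff.mpr ⟨b, h.move ha' h1 h2 hall⟩
    · push Not at hall
      obtain ⟨i, hi⟩ := hall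
      have hn : 0 < 2 * n := i.pos
      have h0 : b ⟨0, hn⟩ < a' := lt_of_le_of_lt (h.2.1.monotone (Nat.zero_le i)) hi
      obtain ⟨c, c1, c2, c3, c4, c5⟩ := h.exists_next hn h0
      have hb0 := (h.mem ⟨0, hn⟩).1
      -- Behind the first branch all indices drop by one. That branch itself moves to the end,
      -- beyond `a + 1` and so beyond `a'`.
      obtain ⟨m, hm⟩ := ih (h.shift_one c1 hn c2 c4 c5) c3.le (by linarith [hb0.1]) (by
        intro j hj
        split_ifs at hj with hlt
        · have := h3 _ hj
          simpa using this
        · linarith [hb0.1])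
      exact ⟨1 + m, by rwa [shift_add] at hm⟩

/-- The Gauss code is unique up to equivalence. -/
theorem IsGaussCode.oriEquiv {D : VirtualDiagram} {w w' : GaussCode n} (h : D.IsGaussCode w)
    (h' : D.IsGaussCode w') : OriEquiv w w' := by
  obtain ⟨a, f, h⟩ := h
  obtain ⟨a', f', h'⟩ := h'
  have h1 := h.relabel (f.symm.trans f')
  have hf : f.trans (f.symm.trans f') = f' := by ext; simp
  rw [hf] at h1
  obtain ⟨b, hb⟩ := isGaussCodeAt_iff.mp h1
  obtain ⟨c, hc, k, hk⟩ := exists_samePoint_mem_Ico a a'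
  have h2 := h'.add_int k
  rw [← hk] at h2
  obtain ⟨m, hm⟩ := IsGaussCodeWith.exists_shift h2.1 (2 * n) hb hc.1 hc.2 fun i _ => i.2
  rw [← hm.unique h2]
  exact (oriEquiv_relabel _ w).trans (oriEquiv_shift m _)

theorem IsGaussCode.shift_one {D : VirtualDiagram} {w : GaussCode n} (h : D.IsGaussCode w) :
    D.IsGaussCode (shift 1 w) := by
  obtain ⟨a, f, h⟩ := h
  obtain ⟨b, hb⟩ := isGaussCodeAt_iff.mp h
  rcases Nat.eq_zero_or_pos (2 * n) with hn | hn
  · have : shift 1 w = w := by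
      ext1
      funext i
      exact absurd i.2 (by omega)
    rw [this]
    exact ⟨a, f, h⟩
  · obtain ⟨c, c1, c2, -, c4, c5⟩ := hb.exists_next hn (lt_add_one _)
    exact ⟨c, f, isGaussCodeAt_iff.mpr ⟨_, hb.shift_one c1 hn c2 c4 c5⟩⟩

theorem IsGaussCode.of_oriEquiv {D : VirtualDiagram} {w w' : GaussCode n} (h : D.IsGaussCode w)
    (hw : OriEquiv w w') : D.IsGaussCode w' := by
  obtain ⟨π, m, rfl⟩ := hw
  have h1 : D.IsGaussCode (GaussCode.relabel π w) := by
    obtain ⟨a, f, h⟩ := h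
    exact ⟨a, _, h.relabel π⟩
  generalize GaussCode.relabel π w = v at h1
  have hnat : ∀ k : ℕ, D.IsGaussCode (shift k v) := by
    intro k
    induction k with
    | zero => rwa [Nat.cast_zero, shift_zero]
    | succ k ih =>
      have := ih.shift_one
      rwa [shift_add] at this
  -- The rotation has finite order, so shifts by natural numbers suffice.
  obtain ⟨k, hk⟩ : ∃ k : ℕ, finRotate (2 * n) ^ k = finRotate (2 * n) ^ m :=
    mem_powers_iff_mem_zpowers.mpr ⟨m, rfl⟩
  have e : shift m v = shift k v := by
    ext1
    funext i
    simp only [shift, zpow_natCast, hk]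
  rw [e]
  exact hnat k

end VirtualDiagram

end Uniqueness

/-! ### Invariance of Gauss codes under moves and reversal -/

section Invariance

variable {n : ℕ}

theorem cross_map (L : Plane →L[ℝ] Plane) (u v : Plane) :
    cross (L u) (L v) = cross (L (EuclideanSpace.single 0 1)) (L (EuclideanSpace.single 1 1)) *
      cross u v := by
  have key : ∀ x : Plane, L x = x 0 • L (EuclideanSpace.single 0 1) +
      x 1 • L (EuclideanSpace.single 1 1) := by
    intro x
    rw [← map_smul, ← map_smul, ← map_add]
    congr 1
    ext i
    fin_cases i <;> simp
  rw [key u, key v]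
  simp only [cross, PiLp.add_apply, PiLp.smul_apply, smul_eq_mul]
  ring

/-- An isotopy of the plane preserves the orientation. -/
theorem cross_fderiv_isotopy_pos {H : ℝ → Plane → Plane}
    (hH : ContDiff ℝ ∞ fun p : ℝ × Plane => H p.1 p.2)
    (hdiffeo : ∀ t ∈ Set.Icc (0 : ℝ) 1,
      ∃ e : Plane ≃ₘ^∞⟮𝓘(ℝ, Plane), 𝓘(ℝ, Plane)⟯ Plane, ∀ x, e x = H t x)
    (h0 : ∀ x, H 0 x = x) (x : Plane) :
    0 < cross (fderiv ℝ (H 1) x (EuclideanSpace.single 0 1))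
      (fderiv ℝ (H 1) x (EuclideanSpace.single 1 1)) := by
  have hdiff : ∀ t, DifferentiableAt ℝ (H t) x := fun t =>
    (hH.differentiable (by simp) (t, x)).comp x (differentiableAt_const t |>.prodMk
      differentiableAt_id)
  have hfd : ∀ t v, fderiv ℝ (H t) x v =
      fderiv ℝ (fun p : ℝ × Plane => H p.1 p.2) (t, x) (0, v) := by
    intro t v
    have h1 := ((hH.differentiable (by simp) (t, x)).hasFDerivAt.comp x
      ((hasFDerivAt_const t x).prodMk (hasFDerivAt_id x))).fderiv
    have h2 : ((fun p : ℝ × Plane => H p.1 p.2) ∘ Prod.mk t) = H t := rfl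
    rw [h2] at h1
    rw [h1]
    simp
  have hcont : ∀ v, Continuous fun t => fderiv ℝ (H t) x v := by
    intro v
    simp only [hfd]
    exact ((hH.continuous_fderiv (by simp)).comp (by fun_prop : Continuous fun t : ℝ => (t, x))).clm_apply
      continuous_const
  -- The Jacobian determinant at `x` is continuous in time, equals 1 at time 0 and does not vanish
  -- on `[0, 1]`. By the intermediate value theorem it stays positive.
  set g : ℝ → ℝ := fun t => cross (fderiv ℝ (H t) x (EuclideanSpace.single 0 1))
    (fderiv ℝ (H t) x (EuclideanSpace.single 1 1)) with hg
  have hgc : Continuous g := by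
    have h1 := hcont (EuclideanSpace.single 0 1)
    have h2 := hcont (EuclideanSpace.single 1 1)
    simp only [hg, cross]
    fun_prop
  have hone : cross (EuclideanSpace.single 0 1) (EuclideanSpace.single 1 1) = 1 := by
    simp [cross]
  have hg0 : g 0 = 1 := by
    have : H 0 = id := funext h0
    simp only [hg, this, fderiv_id, ContinuousLinearMap.id_apply, hone]
  have hne : ∀ t ∈ Set.Icc (0 : ℝ) 1, g t ≠ 0 := by
    intro t ht hgt
    obtain ⟨e, he⟩ := hdiffeo t ht
    have hM : DifferentiableAt ℝ e.symm (H t x) :=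
      e.symm.contMDiff.contDiff.differentiable (by simp) _
    have hcomp := (hM.hasFDerivAt.comp x (hdiff t).hasFDerivAt).fderiv
    have hid : e.symm ∘ H t = id := by
      funext y
      simp [← he]
    rw [hid, fderiv_id] at hcomp
    have h1 := cross_map (fderiv ℝ e.symm (H t x)) (fderiv ℝ (H t) x (EuclideanSpace.single 0 1))
      (fderiv ℝ (H t) x (EuclideanSpace.single 1 1))
    rw [show cross _ _ = 0 from hgt, mul_zero, ← ContinuousLinearMap.comp_apply,
      ← ContinuousLinearMap.comp_apply, ← hcomp] at h1
    simp only [ContinuousLinearMap.id_apply, hone] at h1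
    exact one_ne_zero h1
  by_contra hle
  obtain ⟨t, ht, hgt⟩ := intermediate_value_Icc' zero_le_one hgc.continuousOn
    (show (0 : ℝ) ∈ Set.Icc (g 1) (g 0) from ⟨not_lt.mp hle, by rw [hg0]; exact zero_le_one⟩)
  exact hne t ht hgt

namespace VirtualDiagram

open GaussCode

/-- A change of the parameter that preserves real crossings and sides preserves Gauss codes. -/
theorem IsGaussCode.transfer {S T : VirtualDiagram} {w : GaussCode n} (h : S.IsGaussCode w)
    {φ : ℝ → ℝ} (hmono : StrictMono φ) (hφ : ∀ t, φ (t + 1) = φ t + 1)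
    (hsurj : Function.Surjective φ) (e : {p // p ∈ S.real} ≃ {p // p ∈ T.real})
    (hreal : ∀ t, T.curve (φ t) ∈ T.real → S.curve t ∈ S.real)
    (he : ∀ t (ht : S.curve t ∈ S.real), (e ⟨S.curve t, ht⟩ : Plane) = T.curve (φ t))
    (hcross : ∀ t u, S.curve t ∈ S.real → S.curve u = S.curve t → ∃ c : ℝ, 0 < c ∧
      cross (deriv T.curve (φ t)) (deriv T.curve (φ u)) =
        c * cross (deriv S.curve t) (deriv S.curve u)) : T.IsGaussCode w := by
  obtain ⟨a, f, ha, b, hb, hrange, hcode⟩ := h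
  have hreal' : ∀ t, S.curve t ∈ S.real → T.curve (φ t) ∈ T.real := fun t ht =>
    he t ht ▸ (e _).2
  have hne : ∀ t u, ¬ SamePoint t u → ¬ SamePoint (φ t) (φ u) := by
    rintro t u h ⟨k, hk⟩
    rw [← map_add_int_of_map_add_one hφ] at hk
    exact h ⟨k, hmono.injective hk⟩
  have hside : ∀ t c, S.curve t ∈ S.real → S.HasSide t c → T.HasSide (φ t) c := by
    intro t c ht hc
    have hcurve : ∀ u, S.curve u = S.curve t → T.curve (φ u) = T.curve (φ t) := by
      intro u hu
      rw [← he t ht, ← he u (hu ▸ ht)]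
      simp only [hu]
    cases c <;> obtain ⟨u, h1, h2, h3⟩ := hc <;> obtain ⟨c, hc, hcr⟩ := hcross t u ht h2 <;>
      refine ⟨φ u, hne t u h1, hcurve u h2, ?_⟩ <;> rw [hcr]
    · exact mul_neg_of_pos_of_neg hc h3
    · exact mul_pos hc h3
  refine ⟨φ a, e.symm.trans f, fun h => ha (hreal a h), fun i => φ (b i), hmono.comp hb, ?_, ?_⟩
  · ext t
    obtain ⟨s, rfl⟩ := hsurj t
    have h1 : φ s ∈ Set.range (fun i => φ (b i)) ↔ s ∈ Set.range b := by
      simp only [Set.mem_range, hmono.injective.eq_iff]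
    rw [h1, hrange]
    simp only [Set.mem_ofPred_eq, Set.mem_Ioo, ← hφ, hmono.lt_iff_lt]
    exact and_congr_right fun _ => ⟨hreal' s, hreal s⟩
  · intro i hi
    have hi' := hreal _ hi
    refine ⟨(hcode i hi').1.trans (congrArg f ?_), hside _ _ hi' (hcode i hi').2⟩
    rw [Equiv.eq_symm_apply]
    exact Subtype.ext (he _ hi')

theorem Reparam.isGaussCode {D D' : VirtualDiagram} (h : Reparam D D') {w : GaussCode n}
    (hw : D'.IsGaussCode w) : D.IsGaussCode w := by
  obtain ⟨⟨φ, hsm, hpos, hφ, hcurve⟩, hreal⟩ := h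
  have hder : ∀ t, deriv D'.curve t = deriv φ t • deriv D.curve (φ t) := by
    intro t
    rw [show D'.curve = D.curve ∘ φ from funext hcurve]
    exact deriv.scomp t (D.smooth.differentiable (by simp) _) (hsm.differentiable (by simp) _)
  refine hw.transfer (strictMono_of_deriv_pos hpos) hφ
    (surjective_of_map_add_one hsm.continuous hφ) (Equiv.subtypeEquivRight fun p => by rw [hreal])
    (fun t ht => by rwa [hcurve, hreal]) (fun t _ => hcurve t) fun t u _ _ =>
      ⟨(deriv φ t * deriv φ u)⁻¹, inv_pos.mpr (mul_pos (hpos t) (hpos u)), ?_⟩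
  rw [hder, hder, cross_smul_left, cross_smul_right]
  have h1 := (hpos t).ne'
  have h2 := (hpos u).ne'
  field_simp

theorem Isotopic.isGaussCode {D D' : VirtualDiagram} (h : Isotopic D D') {w : GaussCode n}
    (hw : D.IsGaussCode w) : D'.IsGaussCode w := by
  obtain ⟨H, hH, hdiffeo, h0, hcurve, hreal⟩ := h
  obtain ⟨e, he⟩ := hdiffeo 1 ⟨zero_le_one, le_rfl⟩
  have hinj : Function.Injective (H 1) := by
    rw [← show ⇑e = H 1 from funext he]
    exact e.injective
  have hmem : ∀ p, H 1 p ∈ D'.real ↔ p ∈ D.real := fun p => by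
    rw [← Finset.mem_coe, hreal, hinj.mem_set_image, Finset.mem_coe]
  have hdiff : Differentiable ℝ (H 1) := by
    rw [← show ⇑e = H 1 from funext he]
    exact e.contMDiff.contDiff.differentiable (by simp)
  have hder : ∀ t, deriv D'.curve t = fderiv ℝ (H 1) (D.curve t) (deriv D.curve t) := by
    intro t
    rw [show D'.curve = H 1 ∘ D.curve from funext hcurve]
    exact fderiv_comp_deriv t (hdiff _) (D.smooth.differentiable (by simp) _)
  refine hw.transfer (φ := id) strictMono_id (fun _ => rfl) Function.surjective_id
    (Equiv.ofBijective (fun p => ⟨H 1 p, (hmem p).mpr p.2⟩) ⟨?_, ?_⟩) (fun t ht => ?_)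
    (fun t _ => (hcurve t).symm) fun t u _ htu =>
      ⟨_, cross_fderiv_isotopy_pos hH hdiffeo h0 (D.curve t), ?_⟩
  · intro p q hpq
    exact Subtype.ext (hinj (congrArg Subtype.val hpq))
  · rintro ⟨q, hq⟩
    obtain ⟨p, hp, rfl⟩ := hreal ▸ Finset.mem_coe.mpr hq
    exact ⟨⟨p, hp⟩, rfl⟩
  · rwa [id, hcurve, hmem] at ht
  · rw [id, id, hder, hder, htu, cross_map]

theorem Detour.symm {D D' : VirtualDiagram} (h : Detour D D') : Detour D' D := by
  obtain ⟨hreal, a, b, hab, hba, h1, h2⟩ := h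
  exact ⟨hreal.symm, a, b, hab, hba, fun t ht => (h1 t ht).symm, fun t ht => (h2 t ht).symm⟩

/-- Modulo 1, such a `t` lies in the open complement of the closed detour arc, so the curves agree
on a neighbourhood. -/
theorem Detour.eq_of_mem_real {D D' : VirtualDiagram} (h : Detour D D') {t : ℝ}
    (ht : D.curve t ∈ D.real) :
    D'.curve t = D.curve t ∧ deriv D'.curve t = deriv D.curve t := by
  obtain ⟨-, a, b, hab, hba, h1, h2⟩ := h
  obtain ⟨s, hs, hst⟩ := exists_samePoint_mem_Ico b t
  rw [← D.periodic'.eq_of_samePoint hst] at ht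
  have hbs : b < s := lt_of_le_of_ne hs.1 (by
    rintro rfl
    exact (h1 _ ⟨hab.le, le_rfl⟩).1 ht)
  have hsa : s < a + 1 := by
    by_contra hge
    refine (h1 (s - 1) ⟨by linarith, by linarith [hs.2]⟩).1 ?_
    rwa [curve_sub_one]
  have heq : D'.curve =ᶠ[𝓝 s] D.curve := by
    filter_upwards [Ioo_mem_nhds hbs hsa] with x hx using h2 x ⟨hx.1.le, hx.2.le⟩
  rw [← D.periodic'.eq_of_samePoint hst, ← D'.periodic'.eq_of_samePoint hst,
    ← D.deriv_eq_of_samePoint hst, ← D'.deriv_eq_of_samePoint hst]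
  exact ⟨heq.eq_of_nhds, heq.deriv_eq⟩

theorem Detour.isGaussCode {D D' : VirtualDiagram} (h : Detour D D') {w : GaussCode n}
    (hw : D.IsGaussCode w) : D'.IsGaussCode w := by
  refine hw.transfer (φ := id) strictMono_id (fun _ => rfl) Function.surjective_id
    (Equiv.subtypeEquivRight fun p => by rw [h.1]) (fun t ht => ?_)
    (fun t ht => (h.eq_of_mem_real ht).1.symm) fun t u ht hu => ⟨1, one_pos, ?_⟩
  · have := (h.symm.eq_of_mem_real ht).1
    rw [id] at this ht
    rwa [this, ← h.1]
  · rw [one_mul, id, id, (h.eq_of_mem_real ht).2, (h.eq_of_mem_real (hu ▸ ht)).2]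

/-- One implication suffices. Some code `v` of `D` is a code of `D'`; any code `w` of `D'` is then
equivalent to `v`, hence a code of `D`. -/
theorem isGaussCode_iff_of_imp {D D' : VirtualDiagram}
    (h : ∀ {n} {w : GaussCode n}, D.IsGaussCode w → D'.IsGaussCode w) {w : GaussCode n} :
    D.IsGaussCode w ↔ D'.IsGaussCode w := by
  refine ⟨h, fun hw => ?_⟩
  obtain ⟨v, hv⟩ := D.exists_isGaussCode rfl
  obtain rfl : D.real.card = n := (h hv).card_real.symm.trans hw.card_real
  exact hv.of_oriEquiv ((h hv).oriEquiv hw)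

/-- Gauss codes are invariant under strict equivalence. -/
theorem StrictEquiv.isGaussCode_iff {D D' : VirtualDiagram} (h : StrictEquiv D D')
    {w : GaussCode n} : D.IsGaussCode w ↔ D'.IsGaussCode w := by
  induction h with
  | rel D D' h =>
    rcases h with h | h | h
    · exact (isGaussCode_iff_of_imp h.isGaussCode).symm
    · exact isGaussCode_iff_of_imp h.isGaussCode
    · exact isGaussCode_iff_of_imp h.isGaussCode
  | refl D => rfl
  | symm D D' _ ih => exact ih.symm
  | trans D D' D'' _ _ ih ih' => exact ih.trans ih'

theorem rev_rev (D : VirtualDiagram) : D.rev.rev = D := by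
  cases D
  simp [rev]

/-- Both tangent vectors change sign, so `cross` does not. -/
theorem HasSide.rev {D : VirtualDiagram} {t : ℝ} {c : Side} (h : D.HasSide t c) :
    D.rev.HasSide (-t) c := by
  have hd : ∀ s, deriv D.rev.curve (-s) = -deriv D.curve s := fun s => by
    simp only [VirtualDiagram.rev]
    rw [deriv_comp_neg, neg_neg]
  have hc : ∀ s, D.rev.curve (-s) = D.curve s := fun s => congrArg D.curve (neg_neg s)
  cases c <;> obtain ⟨u, h1, h2, h3⟩ := h <;>
    exact ⟨-u, fun h => h1 (SamePoint.neg_iff.mp h), by rw [hc, hc, h2],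
      by rwa [hd, hd, cross_neg_left, cross_neg_right, neg_neg]⟩

theorem IsGaussCode.rev {D : VirtualDiagram} {w : GaussCode n} (h : D.IsGaussCode w) :
    D.rev.IsGaussCode w.rev := by
  obtain ⟨a, f, ha, b, hb, hrange, hcode⟩ := h
  have hc : ∀ s, D.rev.curve (-s) = D.curve s := fun s => congrArg D.curve (neg_neg s)
  have ha' : D.rev.curve (-(a + 1)) = D.curve a := (hc _).trans (D.periodic a)
  refine ⟨-(a + 1), f, fun h => ha (ha' ▸ h), fun i => -b (Fin.rev i), fun i j hij =>
    neg_lt_neg (hb (Fin.rev_lt_rev.mpr hij)), ?_, fun i hi => ?_⟩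
  · ext t
    obtain ⟨s, rfl⟩ := neg_surjective t
    have h1 : -s ∈ Set.range (fun i => -b (Fin.rev i)) ↔ s ∈ Set.range b := by
      simp only [Set.mem_range, neg_inj]
      exact (Fin.rev_surjective.exists (p := fun i => b i = s)).symm
    rw [h1, hrange]
    simp only [Set.mem_ofPred_eq, Set.mem_Ioo, hc]
    refine and_congr ⟨fun h => ⟨?_, ?_⟩, fun h => ⟨?_, ?_⟩⟩ Iff.rfl <;> linarith [h.1, h.2]
  · have hi' : D.curve (b (Fin.rev i)) ∈ D.real := hc (b (Fin.rev i)) ▸ hi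
    exact ⟨(hcode _ hi').1.trans (congrArg f (Subtype.ext (hc _).symm)), (hcode _ hi').2.rev⟩

theorem isGaussCode_rev_iff {D : VirtualDiagram} {w : GaussCode n} :
    D.rev.IsGaussCode w ↔ D.IsGaussCode w.rev := by
  constructor
  · intro h
    simpa only [rev_rev] using h.rev
  · intro h
    simpa only [GaussCode.rev_rev] using h.rev

theorem StrictEquiv.strictRevEquiv {D D' : VirtualDiagram} (h : StrictEquiv D D') :
    StrictRevEquiv D D' := Relation.EqvGen.mono (fun _ _ => Or.inl) _ _ h

theorem strictRevEquiv_rev (D : VirtualDiagram) : StrictRevEquiv D D.rev := .rel _ _ (Or.inr rfl)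

/-- Gauss codes up to reversal are invariant under strict equivalence and reversal. -/
theorem StrictRevEquiv.isGaussCode_or_iff {D D' : VirtualDiagram} (h : StrictRevEquiv D D')
    {w : GaussCode n} :
    D.IsGaussCode w ∨ D.rev.IsGaussCode w ↔ D'.IsGaussCode w ∨ D'.rev.IsGaussCode w := by
  induction h with
  | rel D D' h =>
    rcases h with h | rfl
    · have h' : StrictEquiv D D' := .rel _ _ h
      rw [isGaussCode_rev_iff, isGaussCode_rev_iff, h'.isGaussCode_iff, h'.isGaussCode_iff]
    · rw [rev_rev, or_comm]
  | refl D => rfl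
  | symm D D' _ ih => exact ih.symm
  | trans D D' D'' _ _ ih ih' => exact ih.trans ih'

theorem IsGaussCode.or_rev_iff {D : VirtualDiagram} {v w : GaussCode n} (h : D.IsGaussCode v) :
    D.IsGaussCode w ∨ D.rev.IsGaussCode w ↔ UnoriEquiv v w := by
  rw [isGaussCode_rev_iff]
  exact or_congr ⟨h.oriEquiv, h.of_oriEquiv⟩ ⟨h.oriEquiv, h.of_oriEquiv⟩

theorem exists_diagram_isGaussCode (w : GaussCode n) :
    ∃ D : Diagram n, D.1.IsGaussCode w := by
  obtain ⟨D, ε, hε, hD⟩ := exists_isNormal w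
  exact ⟨⟨D, hD.card_real⟩, hD.isGaussCode hε one_pos⟩

end VirtualDiagram

/-! ### The two bijections -/

/-- A relation between two types that respects equivalence relations on them, and determines
classes on both sides, induces a bijection of the quotients. -/
theorem exists_quotient_equiv {α β : Type*} (r : Setoid α) (s : Setoid β) (P : α → β → Prop)
    (hex : ∀ x, ∃ y, P x y) (hex' : ∀ y, ∃ x, P x y)
    (hr : ∀ {x x' y}, P x y → (r.r x x' ↔ P x' y)) (hs : ∀ {x y y'}, P x y → (s.r y y' ↔ P x y')) :
    ∃ Φ : Quotient r ≃ Quotient s, ∀ x y, Φ (Quotient.mk r x) = Quotient.mk s y ↔ P x y := by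
  choose F hF using hex
  have hlift : ∀ x x', r x x' → Quotient.mk s (F x) = Quotient.mk s (F x') := fun x x' h =>
    Quotient.sound ((hs ((hr (hF x)).mp h)).mpr (hF x'))
  have hmk : ∀ x y, Quotient.mk s (F x) = Quotient.mk s y ↔ P x y := fun x y =>
    Quotient.eq.trans (hs (hF x))
  refine ⟨Equiv.ofBijective (Quotient.lift (fun x => Quotient.mk s (F x)) hlift) ⟨?_, ?_⟩, hmk⟩
  · rintro ⟨x⟩ ⟨x'⟩ h
    exact Quotient.sound ((hr ((hmk x (F x')).mp h)).mpr (hF x'))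
  · rintro ⟨y⟩
    obtain ⟨x, hx⟩ := hex' y
    exact ⟨Quotient.mk r x, (hmk x y).mpr hx⟩

end Invariance

open VirtualDiagram in
theorem proposition2p3 (n : ℕ) :
    (∃ Φ : DiagramStrict n ≃ GaussOri n, ∀ (D : Diagram n) (w : GaussCode n),
      Φ (Quotient.mk (strictSetoid n) D) = Quotient.mk (GaussCode.oriSetoid n) w ↔
        D.1.IsGaussCode w) ∧
    (∃ Ψ : DiagramStrictRev n ≃ GaussUnori n, ∀ (D : Diagram n) (w : GaussCode n),
      Ψ (Quotient.mk (strictRevSetoid n) D) = Quotient.mk (GaussCode.unoriSetoid n) w ↔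
        D.1.IsGaussCode w ∨ D.1.rev.IsGaussCode w) := by
  constructor
  · refine exists_quotient_equiv _ _ (fun (D : Diagram n) (w : GaussCode n) => D.1.IsGaussCode w)
      (fun D => D.1.exists_isGaussCode D.2) exists_diagram_isGaussCode
      (fun {D D' w} h => ⟨fun hD => ?_, fun h' => h.strictEquiv h'⟩)
      (fun {D w w'} h => ⟨fun hw => h.of_oriEquiv hw, fun h' => h.oriEquiv h'⟩)
    exact (StrictEquiv.isGaussCode_iff (D := D.1) (D' := D'.1) hD).mp h
  · have key : ∀ {D D' : VirtualDiagram} {w : GaussCode n}, D.IsGaussCode w →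
        D'.IsGaussCode w ∨ D'.rev.IsGaussCode w → StrictRevEquiv D D' := by
      rintro D D' w h (h' | h')
      · exact (h.strictEquiv h').strictRevEquiv
      · exact (h.strictEquiv h').strictRevEquiv.trans _ _ _ (.symm _ _ (strictRevEquiv_rev D'))
    refine exists_quotient_equiv _ _
      (fun (D : Diagram n) (w : GaussCode n) => D.1.IsGaussCode w ∨ D.1.rev.IsGaussCode w)
      (fun D => (D.1.exists_isGaussCode D.2).imp fun _ => Or.inl)
      (fun w => (exists_diagram_isGaussCode w).imp fun _ => Or.inl)
      (fun {D D' w} h => ⟨fun hD => ?_, fun h' => ?_⟩) (fun {D w w'} h => ?_)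
    · exact (StrictRevEquiv.isGaussCode_or_iff (D := D.1) (D' := D'.1) hD).mp h
    · rcases h with h | h
      · exact key h h'
      · exact .trans _ _ _ (strictRevEquiv_rev D.1) (key h h')
    -- It is unknown whether `w` belongs to the diagram or to its reverse, so `w` and `w'` are both
    -- compared with a code `v` of the diagram itself.
    · obtain ⟨v, hv⟩ := D.1.exists_isGaussCode D.2
      have h1 : (GaussCode.unoriSetoid n).r v w := hv.or_rev_iff.mp h
      change _ ↔ (D.1.IsGaussCode w' ∨ D.1.rev.IsGaussCode w')
      rw [hv.or_rev_iff]
      exact ⟨fun h2 => (GaussCode.unoriSetoid n).trans h1 h2,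
        fun h2 => (GaussCode.unoriSetoid n).trans ((GaussCode.unoriSetoid n).symm h1) h2⟩
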